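/- Let $n\ge 1$, let $\mathbb R_n$ be the real Clifford algebra with units $e_ie_j+e_je_i=-2\delta_{ij}$, identify $x\in\mathbb R^{n+1}$ with $x_0+\sum_{j=1}^n x_je_j\in\mathbb R_n$, put $\mathrm{Re}[x]=x_0$, $\bar x=x_0-\sum_j x_je_j$, $\mathbb S=\{I\in\mathbb R^{n+1}: I_0=0,\ |I|=1\}$ and $L_I=\mathbb R+I\mathbb R$. Let $V$ be a real Banach space, $V_n=V\otimes\mathbb R_n$ with $\|\sum_A v_Ae_A\|^2=\sum_A\|v_A\|^2$, and let $\mathcal B_n(V_n)$ be the set of bounded operators $\sum_A T_Ae_A$, $T_A\in\mathcal B(V)$, acting by $v\mapsto\sum_{A,B}T_A(v_B)e_Ae_B$. Elements of $\mathbb R_n$ act on $V_n$ by left multiplication. **Operators.** Let $T_0,\dots,T_n$ be closed densely defined linear operators in $V$ and $T=T_0+\sum_j e_jT_j$ on $\mathcal D(T)=\{\sum_B v_Be_B: v_B\in\bigcap_\mu\mathcal D(T_\mu)\}$; assume that $T$ is closed and that $\mathcal D(T)$ and $\mathcal D(T^2)$ are dense in $V_n$. The set $\rho_S(T)$ consists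 of all $s\in\mathbb R^{n+1}$ such that $T^2-2\mathrm{Re}[s]T+|s|^2\mathcal I$ is one-to-one on $\mathcal D(T^2)$ with range $V_n$ and $S^{-1}(s,T):=-(T^2-2\mathrm{Re}[s]T+|s|^2\mathcal I)^{-1}(T-\bar s\mathcal I)$ is on $\mathcal D(T)$ the restriction of an operator in $\mathcal B_n(V_n)$, denoted by the same symbol; $\sigma_S(T)=\mathbb R^{n+1}\setminus\rho_S(T)$. For a bounded operator $A$, $\sigma_S(A)$ is the set of all $s$ for which $A^2-2\mathrm{Re}[s]A+|s|^2\mathcal I$ is not invertible, and $S^{-1}(s,A)$ is given by the same formula. Assume $\rho_S(T)\cap\mathbb R\ne\emptyset$. **Functions.** A function $f$ with values in $\mathbb R_n$ is s-monogenic on an open set $U\subseteq\mathbb R^{n+1}$ if it is real differentiable there and $(\partial_u+I\partial_v)f(u+Iv)=0$ on $U\cap L_I$ for every $I\in\mathbb S$; it is s-monogenic at $\infty$ if it is s-monogenic on some $\{|x|>r\}$ and the limit $f(\infty)=\lim_{x\to\infty}f(x)\in\mathbb R_n$ exists; it is s-monogenic on $U\cup\partial U$ if it is so on an open set containing $U\cup\partial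 U$. It is locally s-monogenic on $\sigma\subseteq\mathbb R^{n+1}$ if it is s-monogenic on an open set $U\supseteq\sigma$ such that, if $n\ge2$, every point of $\sigma$ lies in an open set $D\subseteq U$ which is axially symmetric ($u+Iv\in D$ implies $u+Jv\in D$ for $I,J\in\mathbb S$), meets $\mathbb R$, and has connected intersections with all $L_I$. (This is so, for instance, if $U$ contains for every $u+Iv\in\sigma$ the full sphere of $\mathbb R^{n+1}$ with centre $u$ and radius $|v|$.) **Contours.** Identify $L_I$ with $\mathbb C$ through $u+Iv\mapsto u+iv$. The positively oriented boundary of an open set $G\subseteq L_I$ is a finite system of rectifiable arcs (for instance, rectifiable Jordan curves) with union $\partial G$ whose total winding number is, for $G$ bounded, $1$ about the points of $G$ and $0$ about those outside $G\cup\partial G$, and, for $G$ a neighbourhood of infinity, $0$ about the points of $G$ and $-1$ about those outside $G\cup\partial G$. Write $ds_I=-ds\,I$ and $U_I=U\cap L_I$. **Definition of $\phi(A)$.** Let $A$ be a bounded operator and $\phi$ locally s-monogenic on $\sigma_S(A)$. Then $\phi(A):=\frac1{2\pi}\int_{\partial U_I}S^{-1}(s,A)\,ds_I\,\phi(s)$,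 where $U\supseteq\sigma_S(A)$ is an open set such that $\phi$ is s-monogenic on $U\cup\partial U$ and all $U_J$, $J\in\mathbb S$, are bounded and have positively oriented boundaries as above. We say that $\phi(A)$ is well defined if such sets $U$ exist and the integral does not depend on $U$, on $I\in\mathbb S$, or on the parametrization of the boundary. **Theorem.** Let $f$ be locally s-monogenic on $\sigma_S(T)$ and s-monogenic at $\infty$. For every $k\in\rho_S(T)\cap\mathbb R$ the bounded inverse $A_k=(T-k\mathcal I)^{-1}$ exists, the function $\phi_k(p)=f(p^{-1}+k)$ for $p\neq0$, $\phi_k(0)=f(\infty)$, is locally s-monogenic on $\sigma_S(A_k)$, and $\phi_k(A_k)$ is well defined; the operator $f(T):=\phi_k(A_k)$ does not depend on $k\in\rho_S(T)\cap\mathbb R$. Moreover, for every open $W\supseteq\sigma_S(T)$ that contains some set $\{|x|>r\}$ and is such that $f$ is s-monogenic on $W\cup\partial W$, and for every $I\in\mathbb S$ such that $W_I=W\cap L_I$ has a positively oriented boundary as above, $$f(T)=f(\infty)\mathcal I+\frac1{2\pi}\int_{\partial W_I}S^{-1}(s,T)\,ds_I\,f(s).$$ -/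

import Mathlib

open Set Filter Topology MeasureTheory

noncomputable section

namespace SliceMonogenic

/-! ### The Clifford algebra `ℝ_n` and the two-sided module `V_n = V ⊗ ℝ_n`

An element `∑_A v_A e_A` of `V_n` is stored through its coordinates `v_A ∈ V`, where the multi-index
`A = i_1 < … < i_r` is a finite set `A ⊆ {1, …, n}` (here a `Finset (Fin n)`), with the norm
`‖v‖² = ∑_A ‖v_A‖²`.  For `V = ℝ` this is the Clifford algebra `ℝ_n` itself; the theorem
`exists_equiv_cliffordAlgebra` below identifies it with Mathlib's `CliffordAlgebra`. -/

/-- The Banach space `V_n = V ⊗ ℝ_n`. -/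
def Vn (V : Type*) (n : ℕ) : Type _ := PiLp 2 (fun _ : Finset (Fin n) => V)

instance (V : Type*) [NormedAddCommGroup V] (n : ℕ) : NormedAddCommGroup (Vn V n) :=
  inferInstanceAs (NormedAddCommGroup (PiLp 2 (fun _ : Finset (Fin n) => V)))

instance (V : Type*) [NormedAddCommGroup V] [NormedSpace ℝ V] (n : ℕ) : NormedSpace ℝ (Vn V n) :=
  inferInstanceAs (NormedSpace ℝ (PiLp 2 (fun _ : Finset (Fin n) => V)))

instance (V : Type*) [NormedAddCommGroup V] [CompleteSpace V] (n : ℕ) : CompleteSpace (Vn V n) :=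
  inferInstanceAs (CompleteSpace (PiLp 2 (fun _ : Finset (Fin n) => V)))

/-- The coordinates `(v_A)_A` of `∑_A v_A e_A`. -/
def coords {V : Type*} [NormedAddCommGroup V] [NormedSpace ℝ V] {n : ℕ} :
    Vn V n ≃L[ℝ] (Finset (Fin n) → V) :=
  PiLp.continuousLinearEquiv 2 ℝ (fun _ : Finset (Fin n) => V)

theorem norm_sq_eq {V : Type*} [NormedAddCommGroup V] [NormedSpace ℝ V] {n : ℕ} (v : Vn V n) :
    ‖v‖ ^ 2 = ∑ A, ‖coords v A‖ ^ 2 :=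
  PiLp.norm_sq_eq_of_L2 (fun _ : Finset (Fin n) => V) v

theorem Vn.ext {V : Type*} [NormedAddCommGroup V] [NormedSpace ℝ V] {n : ℕ} {v w : Vn V n}
    (h : ∀ A, coords v A = coords w A) : v = w :=
  coords.injective (funext h)

/-- The real Clifford algebra `ℝ_n`, generated by `e_1, …, e_n` with
`e_i e_j + e_j e_i = -2 δ_ij`. -/
abbrev Cl (n : ℕ) : Type := Vn ℝ n

/-- The sign with `e_A e_B = sgn A B • e_{A ∆ B}`: one factor `-1` for every pair `(a, b) ∈ A × B`
with `b < a` (the units `e_a`, `e_b` have to be interchanged) and for every common element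
(`e_a e_a = -1`). -/
def sgn {n : ℕ} (A B : Finset (Fin n)) : ℝ :=
  ∏ a ∈ A, ∏ b ∈ B, if b ≤ a then -1 else 1

/-- The basis element `e_A` of `ℝ_n`. -/
def eA {n : ℕ} (A : Finset (Fin n)) : Cl n := coords.symm (Pi.single A 1)

section Action

variable {V : Type*} [NormedAddCommGroup V] [NormedSpace ℝ V] {n : ℕ}

/-- Left multiplication by `e_A` on `V_n`: `e_A (∑_B v_B e_B) = ∑_B v_B e_A e_B`. -/
def eAct (A : Finset (Fin n)) : Vn V n →L[ℝ] Vn V n :=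
  (coords (V := V) (n := n)).symm.toContinuousLinearMap ∘L
    ContinuousLinearMap.pi (fun C : Finset (Fin n) =>
      sgn A (symmDiff A C) • ContinuousLinearMap.proj (R := ℝ) (symmDiff A C)) ∘L
    (coords (V := V) (n := n)).toContinuousLinearMap

/-- Left multiplication by `a ∈ ℝ_n` on `V_n`: `a (∑_B v_B e_B) = ∑_{A,B} a_A v_B e_A e_B`.
For `V = ℝ` this is the product `a * b = lmul a b` of `ℝ_n`. -/
def lmul (a : Cl n) : Vn V n →L[ℝ] Vn V n := ∑ A : Finset (Fin n), coords a A • eAct A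

theorem prod_symmDiff_sign {ι : Type*} [DecidableEq ι] (g : ι → ℝ) (hg : ∀ i, g i * g i = 1)
    (A B : Finset ι) : ∏ i ∈ symmDiff A B, g i = (∏ i ∈ A, g i) * ∏ i ∈ B, g i := by
  have hd : Disjoint (A \ B) (B \ A) := disjoint_sdiff_sdiff
  have h1 : (∏ i ∈ A ∩ B, g i) * ∏ i ∈ A ∩ B, g i = 1 := by
    rw [← Finset.prod_mul_distrib]
    exact Finset.prod_eq_one fun i _ => hg i
  have h2 := Finset.prod_inter_mul_prod_sdiff A B g
  have h3 := Finset.prod_inter_mul_prod_sdiff B A g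
  rw [Finset.inter_comm] at h3
  rw [symmDiff_def, Finset.sup_eq_union, Finset.prod_union hd, ← h2, ← h3]
  linear_combination (-(∏ i ∈ A \ B, g i) * ∏ i ∈ B \ A, g i) * h1

theorem sgn_sq (A B : Finset (Fin n)) : sgn A B * sgn A B = 1 := by
  unfold sgn
  rw [← Finset.prod_mul_distrib]
  refine Finset.prod_eq_one fun a _ => ?_
  rw [← Finset.prod_mul_distrib]
  refine Finset.prod_eq_one fun b _ => ?_
  split_ifs <;> norm_num

theorem sgn_symmDiff_left (A B C : Finset (Fin n)) :
    sgn (symmDiff A B) C = sgn A C * sgn B C := by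
  refine prod_symmDiff_sign _ (fun i => ?_) A B
  rw [← Finset.prod_mul_distrib]
  refine Finset.prod_eq_one fun b _ => ?_
  split_ifs <;> norm_num

theorem sgn_symmDiff_right (A B C : Finset (Fin n)) :
    sgn A (symmDiff B C) = sgn A B * sgn A C := by
  unfold sgn
  rw [← Finset.prod_mul_distrib]
  refine Finset.prod_congr rfl fun a _ => ?_
  refine prod_symmDiff_sign _ (fun i => ?_) B C
  split_ifs <;> norm_num

theorem eAct_apply (A : Finset (Fin n)) (v : Vn V n) (C : Finset (Fin n)) :
    coords (eAct A v) C = sgn A (symmDiff A C) • coords v (symmDiff A C) := by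
  simp [eAct]

theorem eAct_eAct (A B : Finset (Fin n)) (v : Vn V n) :
    eAct A (eAct B v) = sgn A B • eAct (symmDiff A B) v := by
  refine Vn.ext fun C => ?_
  have hC : symmDiff B (symmDiff A C) = symmDiff (symmDiff A B) C := by
    rw [← symmDiff_assoc, symmDiff_comm B A]
  rw [eAct_apply, eAct_apply, map_smul, Pi.smul_apply, eAct_apply, hC, smul_smul, smul_smul]
  congr 1
  simp only [sgn_symmDiff_left, sgn_symmDiff_right]
  linear_combination (-(sgn A A * sgn A C * sgn B A * sgn B B * sgn B C)) * sgn_sq A B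

theorem eAct_empty (v : Vn V n) : eAct ∅ v = v := by
  refine Vn.ext fun C => ?_
  have h : symmDiff ∅ C = C := bot_symmDiff C
  simp [eAct_apply, sgn, h]

theorem eAct_eA (A B : Finset (Fin n)) : eAct A (eA B) = sgn A B • eA (symmDiff A B) := by
  refine Vn.ext fun C => ?_
  rw [eAct_apply, map_smul, Pi.smul_apply]
  by_cases h : C = symmDiff A B
  · subst h
    simp [eA]
  · have h' : symmDiff A C ≠ B := by
      rintro rfl
      exact h (by simp)
    simp [eA, h, h']

theorem lmul_apply (a : Cl n) (v : Vn V n) : lmul a v = ∑ A, coords a A • eAct A v := by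
  simp [lmul, sum_apply]

theorem lmul_add (a b : Cl n) : (lmul (a + b) : Vn V n →L[ℝ] Vn V n) = lmul a + lmul b := by
  simp [lmul, add_smul, Finset.sum_add_distrib]

theorem lmul_smul (r : ℝ) (a : Cl n) : (lmul (r • a) : Vn V n →L[ℝ] Vn V n) = r • lmul a := by
  simp [lmul, Finset.smul_sum, smul_smul]

theorem lmul_eA (A : Finset (Fin n)) : (lmul (eA A) : Vn V n →L[ℝ] Vn V n) = eAct A := by
  rw [lmul, Finset.sum_eq_single A]
  · simp [eA]
  · intro B _ hB
    simp [eA, hB]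
  · simp

theorem cl_eq_sum (a : Cl n) : a = ∑ A, coords a A • eA A := by
  refine Vn.ext fun C => ?_
  simp [eA, map_sum, Finset.sum_apply, Pi.single_apply]

theorem lmul_sum {ι : Type*} (s : Finset ι) (a : ι → Cl n) :
    (lmul (∑ i ∈ s, a i) : Vn V n →L[ℝ] Vn V n) = ∑ i ∈ s, lmul (a i) := by
  classical
  induction s using Finset.induction_on with
  | empty => simp [lmul]
  | insert i s hi ih => rw [Finset.sum_insert hi, Finset.sum_insert hi, lmul_add, ih]

/-- Associativity: `(a b) v = a (b v)`. -/
theorem lmul_lmul (a b : Cl n) (v : Vn V n) : lmul (lmul a b) v = lmul a (lmul b v) := by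
  have hb : lmul a b = ∑ A, ∑ B, (coords a A * coords b B * sgn A B) • eA (symmDiff A B) := by
    rw [lmul_apply]
    refine Finset.sum_congr rfl fun A _ => ?_
    conv_lhs => rw [cl_eq_sum b]
    rw [map_sum, Finset.smul_sum]
    refine Finset.sum_congr rfl fun B _ => ?_
    rw [map_smul, eAct_eA, smul_smul, smul_smul, mul_assoc]
  rw [hb, lmul_sum, lmul_apply a, sum_apply]
  refine Finset.sum_congr rfl fun A _ => ?_
  rw [lmul_sum, sum_apply, lmul_apply b, map_sum, Finset.smul_sum]
  refine Finset.sum_congr rfl fun B _ => ?_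
  rw [lmul_smul, lmul_eA, map_smul, eAct_eAct]
  simp only [smul_apply, smul_smul, mul_assoc]

/-- The quadratic form `x ↦ -(x_1² + … + x_n²)`. -/
def negSumSq (n : ℕ) : QuadraticForm ℝ (Fin n → ℝ) :=
  QuadraticMap.weightedSumSquares ℝ fun _ : Fin n => (-1 : ℝ)

/-- The unit `e_i` in Mathlib's Clifford algebra. -/
def unit (i : Fin n) : CliffordAlgebra (negSumSq n) := CliffordAlgebra.ι _ (Pi.single i 1)

/-- The ordered product `e_A = e_{i_1} ⋯ e_{i_r}` in Mathlib's Clifford algebra. -/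
def unitProd (A : Finset (Fin n)) : CliffordAlgebra (negSumSq n) :=
  ((A.sort (· ≤ ·)).map unit).prod

theorem unit_sq (i : Fin n) : unit i * unit i = (-1 : CliffordAlgebra (negSumSq n)) := by
  rw [unit, CliffordAlgebra.ι_sq_scalar, negSumSq, QuadraticMap.weightedSumSquares_apply,
    Finset.sum_eq_single i]
  · simp
  · intro j _ hj
    simp [hj]
  · simp

theorem unit_anticomm {i j : Fin n} (h : i ≠ j) :
    unit i * unit j = -(unit j * unit i : CliffordAlgebra (negSumSq n)) := by
  refine CliffordAlgebra.ι_mul_ι_comm_of_isOrtho ?_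
  rw [QuadraticMap.isOrtho_def]
  simp only [negSumSq, QuadraticMap.weightedSumSquares_apply, ← Finset.sum_add_distrib]
  refine Finset.sum_congr rfl fun k _ => ?_
  by_cases hi : k = i
  · subst hi
    simp [h]
  · simp [hi]

theorem unitProd_insert {i : Fin n} {B : Finset (Fin n)} (h : ∀ b ∈ B, i < b) :
    unitProd (insert i B) = unit i * unitProd B := by
  rw [unitProd, Finset.sort_insert (r := (· ≤ ·)) (fun b hb => (h b hb).le)
    (fun hi => lt_irrefl _ (h i hi))]
  simp [unitProd]

theorem sgn_singleton_insert {i b : Fin n} {B : Finset (Fin n)} (hb : b ∉ B) :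
    sgn {i} (insert b B) = (if b ≤ i then -1 else 1) * sgn {i} B := by
  simp [sgn, Finset.prod_insert hb]

theorem sgn_singleton_of_lt {i : Fin n} {B : Finset (Fin n)} (h : ∀ b ∈ B, i < b) :
    sgn {i} B = 1 := by
  simp only [sgn, Finset.prod_singleton]
  exact Finset.prod_eq_one fun b hb => if_neg (not_le.mpr (h b hb))

theorem unit_mul_unitProd (i : Fin n) (B : Finset (Fin n)) :
    unit i * unitProd B = sgn {i} B • unitProd (symmDiff {i} B) := by
  induction B using Finset.induction_on_min with
  | empty =>
    have h : symmDiff {i} (∅ : Finset (Fin n)) = insert i ∅ := symmDiff_bot {i}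
    rw [h, unitProd_insert (by simp)]
    simp [sgn]
  | insert b B hb ih =>
    have hbB : b ∉ B := fun h => lt_irrefl _ (hb b h)
    rcases lt_trichotomy i b with hib | rfl | hib
    · have hlt : ∀ x ∈ insert b B, i < x := by
        intro x hx
        rcases Finset.mem_insert.mp hx with rfl | hx
        · exact hib
        · exact hib.trans (hb x hx)
      have h : symmDiff {i} (insert b B) = insert i (insert b B) := by
        ext x
        by_cases hxi : x = i
        · subst hxi
          have hx : x ∉ insert b B := fun hx => lt_irrefl _ (hlt x hx)
          rw [Finset.mem_symmDiff]
          simp only [Finset.mem_singleton, Finset.mem_insert_self, hx, not_false_eq_true, and_self,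
            true_or]
        · simp [Finset.mem_symmDiff, hxi]
      rw [h, unitProd_insert hlt, sgn_singleton_of_lt hlt, one_smul]
    · have h : symmDiff {i} (insert i B) = B := by
        ext x
        by_cases hxi : x = i
        · subst hxi
          simp [Finset.mem_symmDiff, hbB]
        · simp [Finset.mem_symmDiff, hxi]
      rw [h, unitProd_insert hb, ← mul_assoc, unit_sq, sgn_singleton_insert hbB,
        sgn_singleton_of_lt hb]
      simp
    · have h : symmDiff {i} (insert b B) = insert b (symmDiff {i} B) := by
        ext x
        by_cases hxb : x = b
        · subst hxb
          simp [Finset.mem_symmDiff, hib.ne]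
        · simp [Finset.mem_symmDiff, hxb]
      have hlt : ∀ x ∈ symmDiff {i} B, b < x := by
        intro x hx
        rcases Finset.mem_symmDiff.mp hx with ⟨hx, _⟩ | ⟨hx, _⟩
        · rw [Finset.mem_singleton.mp hx]
          exact hib
        · exact hb x hx
      rw [h, unitProd_insert hlt, unitProd_insert hb, ← mul_assoc, unit_anticomm hib.ne',
        neg_mul, mul_assoc, ih, sgn_singleton_insert hbB, if_pos hib.le]
      simp

theorem eAct_single_sq (i : Fin n) (v : Vn V n) : eAct {i} (eAct {i} v) = -v := by
  have h : symmDiff {i} {i} = (∅ : Finset (Fin n)) := symmDiff_self _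
  rw [eAct_eAct, h, eAct_empty]
  simp [sgn]

theorem eAct_single_anticomm {i j : Fin n} (hij : i ≠ j) (v : Vn V n) :
    eAct {i} (eAct {j} v) = -eAct {j} (eAct {i} v) := by
  rw [eAct_eAct, eAct_eAct, symmDiff_comm ({j} : Finset (Fin n)) {i}, ← neg_smul]
  congr 1
  rcases lt_or_gt_of_ne hij with h | h
  · simp [sgn, h.le, not_le.mpr h]
  · simp [sgn, h.le, not_le.mpr h]

theorem sum_eAct_sq (x : Fin n → ℝ) (v : Vn V n) :
    (∑ i, x i • (eAct {i} : Vn V n →L[ℝ] Vn V n)) ((∑ i, x i • eAct {i}) v) =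
      negSumSq n x • v := by
  have h1 : (∑ i, x i • (eAct {i} : Vn V n →L[ℝ] Vn V n)) ((∑ i, x i • eAct {i}) v) =
      ∑ i, ∑ j, (x i * x j) • eAct {i} (eAct {j} v) := by
    rw [sum_apply, sum_apply]
    refine Finset.sum_congr rfl fun i _ => ?_
    rw [map_sum]
    refine Finset.sum_congr rfl fun j _ => ?_
    rw [smul_apply, smul_apply, map_smul, smul_smul]
  have h2 : ∀ i j, (x i * x j) • eAct {i} (eAct {j} v) + (x j * x i) • eAct {j} (eAct {i} v) =
      if i = j then (-2 * (x i * x i)) • v else 0 := by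
    intro i j
    split_ifs with h
    · subst h
      rw [eAct_single_sq]
      module
    · rw [eAct_single_anticomm h, mul_comm (x j)]
      module
  have h3 : (2 : ℝ) • ∑ i, ∑ j, (x i * x j) • eAct {i} (eAct {j} v) =
      (2 : ℝ) • negSumSq n x • v := by
    rw [two_smul ℝ]
    conv_lhs =>
      rhs
      rw [Finset.sum_comm]
    simp only [← Finset.sum_add_distrib, h2, Finset.sum_ite_eq, Finset.mem_univ, if_true]
    rw [← Finset.sum_smul, negSumSq, QuadraticMap.weightedSumSquares_apply, smul_smul,
      Finset.mul_sum]
    congr 1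
    refine Finset.sum_congr rfl fun i _ => ?_
    rw [smul_eq_mul]
    ring
  rw [h1]
  exact smul_right_injective _ (two_ne_zero' ℝ) h3

/-- The coordinates `∑_A a_A e_A ↦ (a_A)_A` identify Mathlib's Clifford algebra of the form
`-(x_1² + … + x_n²)` with `Cl n`, and its product with `lmul`. -/
theorem exists_equiv_cliffordAlgebra (n : ℕ) :
    ∃ Ψ : CliffordAlgebra (negSumSq n) ≃ₗ[ℝ] Cl n,
      (∀ A, Ψ (unitProd A) = eA A) ∧ ∀ x y, Ψ (x * y) = lmul (Ψ x) (Ψ y) := by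
  let L : (Fin n → ℝ) →ₗ[ℝ] (Cl n →L[ℝ] Cl n) :=
    ∑ i, (LinearMap.proj i : (Fin n → ℝ) →ₗ[ℝ] ℝ).smulRight (eAct {i} : Cl n →L[ℝ] Cl n)
  have hL : ∀ x, L x = ∑ i, x i • (eAct {i} : Cl n →L[ℝ] Cl n) := by
    intro x
    simp [L]
  have hL2 : ∀ x, L x * L x = algebraMap ℝ _ (negSumSq n x) := by
    intro x
    ext1 v
    rw [mul_apply_eq_comp, hL, sum_eAct_sq]
    rfl
  let ρ := CliffordAlgebra.lift (negSumSq n) ⟨L, hL2⟩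
  have hρι : ∀ x, ρ (CliffordAlgebra.ι _ x) = L x := fun x =>
    CliffordAlgebra.lift_ι_apply _ _ _
  have hρu : ∀ i, ρ (unit i) = eAct {i} := by
    intro i
    rw [unit, hρι, hL, Finset.sum_eq_single i]
    · simp
    · intro j _ hj
      simp [hj]
    · simp
  have hρl : ∀ x, ρ x = lmul (ρ x (eA ∅)) := by
    intro x
    have h1 : ∀ a : Cl n, lmul a (eA ∅) = a := by
      intro a
      rw [lmul_apply]
      conv_rhs => rw [cl_eq_sum a]
      refine Finset.sum_congr rfl fun A _ => ?_
      rw [eAct_eA]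
      have h : symmDiff A ∅ = A := symmDiff_bot A
      simp [sgn, h]
    have h2 : ∀ y : Cl n →L[ℝ] Cl n, (∃ a, y = lmul a) → y = lmul (y (eA ∅)) := by
      rintro _ ⟨a, rfl⟩
      rw [h1]
    refine h2 _ ?_
    induction x using CliffordAlgebra.induction with
    | algebraMap r =>
      refine ⟨r • eA ∅, ?_⟩
      ext1 v
      rw [lmul_smul, lmul_eA, AlgHom.commutes, Algebra.algebraMap_eq_smul_one]
      simp [eAct_empty]
    | ι x =>
      refine ⟨∑ i, x i • eA {i}, ?_⟩
      rw [hρι, hL, lmul_sum]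
      refine Finset.sum_congr rfl fun i _ => ?_
      rw [lmul_smul, lmul_eA]
    | mul a b ha hb =>
      obtain ⟨a', ha⟩ := ha
      obtain ⟨b', hb⟩ := hb
      refine ⟨lmul a' b', ?_⟩
      ext1 v
      rw [map_mul, ha, hb, lmul_lmul]
      rfl
    | add a b ha hb =>
      obtain ⟨a', ha⟩ := ha
      obtain ⟨b', hb⟩ := hb
      exact ⟨a' + b', by rw [map_add, ha, hb, lmul_add]⟩
  let Ψ : CliffordAlgebra (negSumSq n) →ₗ[ℝ] Cl n :=
    { toFun := fun x => ρ x (eA ∅)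
      map_add' := fun x y => by simp
      map_smul' := fun r x => by simp }
  let g : Cl n →ₗ[ℝ] CliffordAlgebra (negSumSq n) :=
    { toFun := fun a => ∑ A, coords a A • unitProd A
      map_add' := fun a b => by simp [add_smul, Finset.sum_add_distrib]
      map_smul' := fun r a => by simp [Finset.smul_sum, smul_smul] }
  have hgA : ∀ A, g (eA A) = unitProd A := by
    intro A
    change ∑ B, coords (eA A) B • unitProd B = unitProd A
    rw [Finset.sum_eq_single A]
    · simp [eA]
    · intro B _ hB
      simp [eA, hB]
    · simp
  have hgρ : ∀ x a, g (ρ x a) = x * g a := by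
    intro x
    induction x using CliffordAlgebra.induction with
    | algebraMap r =>
      intro a
      rw [AlgHom.commutes, Algebra.algebraMap_eq_smul_one, Algebra.algebraMap_eq_smul_one]
      simp
    | ι x =>
      intro a
      have hx : CliffordAlgebra.ι (negSumSq n) x = ∑ i, x i • unit i := by
        conv_lhs => rw [pi_eq_sum_univ' x]
        rw [map_sum]
        refine Finset.sum_congr rfl fun i _ => ?_
        rw [map_smul, unit]
      rw [cl_eq_sum a, hρι, hL, hx, sum_apply, map_sum, Finset.sum_mul]
      refine Finset.sum_congr rfl fun i _ => ?_
      rw [smul_apply, map_smul, smul_mul_assoc]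
      congr 1
      rw [map_sum, map_sum, map_sum, Finset.mul_sum]
      refine Finset.sum_congr rfl fun A _ => ?_
      rw [map_smul, map_smul, map_smul, eAct_eA, map_smul, hgA, hgA, mul_smul_comm,
        unit_mul_unitProd]
    | mul a b ha hb =>
      intro v
      rw [map_mul, mul_apply_eq_comp, ha, hb, mul_assoc]
    | add a b ha hb =>
      intro v
      rw [map_add, add_apply, map_add, ha, hb, add_mul]
  have hgΨ : ∀ x, g (Ψ x) = x := by
    intro x
    change g (ρ x (eA ∅)) = x
    rw [hgρ, hgA]
    simp [unitProd]
  have hΨA : ∀ A, Ψ (unitProd A) = eA A := by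
    intro A
    induction A using Finset.induction_on_min with
    | empty =>
      change ρ _ _ = _
      simp [unitProd]
    | insert b B hb ih =>
      have hbB : b ∉ B := fun h => lt_irrefl _ (hb b h)
      have h : symmDiff {b} B = insert b B := by
        ext x
        by_cases hxb : x = b
        · subst hxb
          simp [Finset.mem_symmDiff, hbB]
        · simp [Finset.mem_symmDiff, hxb]
      change ρ _ (eA ∅) = _
      change ρ _ (eA ∅) = _ at ih
      rw [unitProd_insert hb, map_mul, mul_apply_eq_comp, ih, hρu, eAct_eA, h,
        sgn_singleton_of_lt hb, one_smul]
  have hΨg : ∀ a, Ψ (g a) = a := by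
    intro a
    change Ψ (∑ A, coords a A • unitProd A) = a
    conv_rhs => rw [cl_eq_sum a]
    rw [map_sum]
    refine Finset.sum_congr rfl fun A _ => ?_
    rw [map_smul, hΨA]
  refine ⟨LinearEquiv.ofLinearMap Ψ g (LinearMap.ext hΨg) (LinearMap.ext hgΨ), hΨA, fun x y => ?_⟩
  change ρ (x * y) (eA ∅) = lmul (ρ x (eA ∅)) (ρ y (eA ∅))
  rw [map_mul, mul_apply_eq_comp, ← hρl]

end Action

/-! ### Paravectors: `ℝ^{n+1} ⊆ ℝ_n` -/

/-- The space `ℝ^{n+1}` of paravectors `x = x_0 + x_1 e_1 + … + x_n e_n`. -/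
abbrev Para (n : ℕ) : Type := EuclideanSpace ℝ (Fin (n + 1))

/-- The inclusion `ℝ^{n+1} → ℝ_n`. -/
def toCl {n : ℕ} (x : Para n) : Cl n := x 0 • eA ∅ + ∑ j : Fin n, x j.succ • eA {j}

/-- The real number `k` as a paravector. -/
def ofR {n : ℕ} (k : ℝ) : Para n := EuclideanSpace.single 0 k

/-- The conjugate `x_0 - x_1 e_1 - … - x_n e_n`. -/
def paraConj {n : ℕ} (x : Para n) : Para n := (2 * x 0) • ofR 1 - x

/-- The inverse `x⁻¹ = |x|⁻² x̄` (with value `0` at `0`). -/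
def paraInv {n : ℕ} (x : Para n) : Para n := (‖x‖ ^ 2)⁻¹ • paraConj x

/-- The sphere `𝕊` of unit `1`-vectors. -/
def unitSphere (n : ℕ) : Set (Para n) := {I | I 0 = 0 ∧ ‖I‖ = 1}

/-- The point `u + I v` of the complex line `L_I`, for `z = u + i v ∈ ℂ`. -/
def sl {n : ℕ} (I : Para n) (z : ℂ) : Para n := z.re • ofR 1 + z.im • I

/-- The set `U ∩ L_I`, read in `ℂ` through `u + i v ↦ u + I v`. -/
def slice {n : ℕ} (I : Para n) (U : Set (Para n)) : Set ℂ := {z | sl I z ∈ U}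

/-! ### Slice-monogenic functions -/

/-- `f` is (left) s-monogenic on the open set `U`: it is real differentiable and
`(∂_u + I ∂_v) f(u + I v) = 0` at all points `u + I v ∈ U`, for every `I ∈ 𝕊`. -/
def SMonogenicOn {n : ℕ} (f : Para n → Cl n) (U : Set (Para n)) : Prop :=
  IsOpen U ∧ DifferentiableOn ℝ f U ∧
    ∀ I ∈ unitSphere n, ∀ z ∈ slice I U,
      fderiv ℝ f (sl I z) (ofR 1) + lmul (toCl I) (fderiv ℝ f (sl I z) I) = 0

/-- `f` is s-monogenic at infinity with `f(∞) = c`. -/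
def SMonogenicAtInfty {n : ℕ} (f : Para n → Cl n) (c : Cl n) : Prop :=
  (∃ r : ℝ, SMonogenicOn f {x | r < ‖x‖}) ∧ Tendsto f (Bornology.cobounded (Para n)) (𝓝 c)

/-- Axially symmetric s-domains: open sets that are unions of spheres `u + 𝕊 v`, meet the real
axis, and have connected intersections with all complex lines `L_I`. -/
def IsAxialSDomain {n : ℕ} (D : Set (Para n)) : Prop :=
  IsOpen D ∧ (∀ I ∈ unitSphere n, ∀ J ∈ unitSphere n, ∀ z : ℂ, sl I z ∈ D → sl J z ∈ D) ∧
    (∃ u : ℝ, ofR u ∈ D) ∧ ∀ I ∈ unitSphere n, IsConnected (slice I D)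

/-- `f` is locally s-monogenic on `σ`: it is s-monogenic on an open set `U ⊇ σ` which, if `n ≥ 2`,
contains around every point of `σ` an axially symmetric s-domain.
(This holds in particular if `U` contains, for every `u + I v ∈ σ`, the whole sphere of `ℝ^{n+1}`
with centre `u` and radius `|v|`.) -/
def LocallySMonogenic {n : ℕ} (f : Para n → Cl n) (σ : Set (Para n)) : Prop :=
  ∃ U : Set (Para n), SMonogenicOn f U ∧ σ ⊆ U ∧
    (2 ≤ n → ∀ s ∈ σ, ∃ D ⊆ U, s ∈ D ∧ IsAxialSDomain D)

/-- `f` is s-monogenic on `U ∪ ∂U`, that is, on an open set containing it. -/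
def SMonogenicOnClosure {n : ℕ} (f : Para n → Cl n) (U : Set (Para n)) : Prop :=
  ∃ U' : Set (Para n), closure U ⊆ U' ∧ SMonogenicOn f U'

/-! ### Contours -/

/-- The finitely many rectifiable arcs `γ j : [0,1] → ℂ` (parametrized as Lipschitz maps, e.g. by
a multiple of arc length; a closed curve is an arc with equal end points) make up the positively
oriented boundary of the open set `G`: the union of the arcs is `∂G`, and the winding number of the
system is `w` about the points of `G` and `w - 1` about the points outside `G ∪ ∂G`.
Here `w = 1` if `G` is bounded, and `w = 0` if `G` is a neighbourhood of infinity. -/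
def IsOrientedBoundary (w : ℤ) {m : ℕ} (γ : Fin m → ℝ → ℂ) (G : Set ℂ) : Prop :=
  (∀ j, ∃ K, LipschitzOnWith K (γ j) (Icc 0 1)) ∧
  (⋃ j, γ j '' Icc 0 1) = frontier G ∧
  (∀ z ∈ G,
    ∑ j, ∫ t in (0 : ℝ)..1, deriv (γ j) t / (γ j t - z) = 2 * Real.pi * Complex.I * w) ∧
  (∀ z ∉ closure G,
    ∑ j, ∫ t in (0 : ℝ)..1, deriv (γ j) t / (γ j t - z) = 2 * Real.pi * Complex.I * (w - 1))

section Operators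

variable {V : Type*} [NormedAddCommGroup V] [NormedSpace ℝ V] {n : ℕ}

/-- `(1/2π) ∫_γ R(s) ds_I f(s)` for a system `γ` of curves in `L_I`, where `ds_I = -ds I`, that is
`ds_I = u + I v` with `u + i v = -i γ'(t) dt`.  Elements of `ℝ_n` act as left multiplications. -/
def contourIntegral (R : Para n → Vn V n →L[ℝ] Vn V n) (f : Para n → Cl n) (I : Para n)
    {m : ℕ} (γ : Fin m → ℝ → ℂ) : Vn V n →L[ℝ] Vn V n :=
  (2 * Real.pi)⁻¹ • ∑ j, ∫ t in (0 : ℝ)..1,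
    R (sl I (γ j t)) ∘L lmul (toCl (sl I (-Complex.I * deriv (γ j) t))) ∘L lmul (f (sl I (γ j t)))

/-! ### The functional calculus for bounded operators -/

/-- `A² - 2 Re[s] A + |s|² 𝓘` for a bounded operator `A`. -/
def quadB (A : Vn V n →L[ℝ] Vn V n) (s : Para n) : Vn V n →L[ℝ] Vn V n :=
  A * A - (2 * s 0) • A + (‖s‖ ^ 2) • 1

/-- The `S`-spectrum of a bounded operator. -/
def sSpectrumB (A : Vn V n →L[ℝ] Vn V n) : Set (Para n) := {s | ¬ IsUnit (quadB A s)}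

/-- The `S`-resolvent operator `-(A² - 2 Re[s] A + |s|² 𝓘)⁻¹ (A - s̄ 𝓘)` of a bounded operator. -/
def sResolventB (A : Vn V n →L[ℝ] Vn V n) (s : Para n) : Vn V n →L[ℝ] Vn V n :=
  -(Ring.inverse (quadB A s) * (A - lmul (toCl (paraConj s))))

/-- The open sets `U` that are used to compute `φ(A)`. -/
def IsAdmissible (A : Vn V n →L[ℝ] Vn V n) (φ : Para n → Cl n) (U : Set (Para n)) : Prop :=
  IsOpen U ∧ sSpectrumB A ⊆ U ∧ SMonogenicOnClosure φ U ∧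
    ∀ I ∈ unitSphere n, ∃ (m : ℕ) (γ : Fin m → ℝ → ℂ), IsOrientedBoundary 1 γ (slice I U)

/-- `φ(A)` is defined and equals `B`: `φ` is locally s-monogenic on `σ_S(A)`, there is an open set
`U` as required, and `(1/2π) ∫_{∂U_I} S⁻¹(s,A) ds_I φ(s) = B` for all such `U` and all `I ∈ 𝕊`. -/
def HasSCalculus (A : Vn V n →L[ℝ] Vn V n) (φ : Para n → Cl n) (B : Vn V n →L[ℝ] Vn V n) : Prop :=
  LocallySMonogenic φ (sSpectrumB A) ∧ (∃ U, IsAdmissible A φ U) ∧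
    ∀ U, IsAdmissible A φ U → ∀ I ∈ unitSphere n, ∀ (m : ℕ) (γ : Fin m → ℝ → ℂ),
      IsOrientedBoundary 1 γ (slice I U) → contourIntegral (sResolventB A) φ I γ = B

/-! ### Unbounded operators -/

/-- The operator `T = T_0 + ∑_j e_j T_j` on the domain of all `∑_B v_B e_B` with
`v_B ∈ ⋂_μ 𝓓(T_μ)`; here `T v = ∑_B T_0(v_B) e_B + ∑_{j,B} T_j(v_B) e_j e_B`. -/
def opT (T : Fin (n + 1) → V →ₗ.[ℝ] V) : Vn V n →ₗ.[ℝ] Vn V n where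
  domain :=
    { carrier := {v | ∀ B μ, coords v B ∈ (T μ).domain}
      add_mem' := fun {v w} hv hw B μ => by
        rw [map_add]
        exact (T μ).domain.add_mem (hv B μ) (hw B μ)
      zero_mem' := fun B μ => by
        rw [map_zero]
        exact (T μ).domain.zero_mem
      smul_mem' := fun c v hv B μ => by
        rw [map_smul]
        exact (T μ).domain.smul_mem c (hv B μ) }
  toFun :=
    { toFun := fun v => ∑ μ, lmul (toCl (EuclideanSpace.single μ 1))
        (coords.symm fun B => T μ ⟨coords v.1 B, v.2 B μ⟩)
      map_add' := by
        intro v w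
        rw [← Finset.sum_add_distrib]
        refine Finset.sum_congr rfl fun μ _ => ?_
        rw [← map_add, ← map_add]
        congr 2
        funext B
        rw [Pi.add_apply, ← (T μ).map_add]
        rfl
      map_smul' := by
        intro c v
        rw [RingHom.id_apply, Finset.smul_sum]
        refine Finset.sum_congr rfl fun μ _ => ?_
        rw [← map_smul, ← map_smul]
        congr 2
        funext B
        rw [Pi.smul_apply, ← (T μ).map_smul]
        rfl }

/-- The domain `𝓓(T²)` of all `v ∈ 𝓓(T)` with `T v ∈ 𝓓(T)`. -/
def domSq (T : Vn V n →ₗ.[ℝ] Vn V n) : Set (Vn V n) :=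
  {v | ∃ h : v ∈ T.domain, T ⟨v, h⟩ ∈ T.domain}

/-- `T² - 2 Re[s] T + |s|² 𝓘` on `𝓓(T²)`. -/
def quad (T : Vn V n →ₗ.[ℝ] Vn V n) (s : Para n) (v : domSq T) : Vn V n :=
  T ⟨T ⟨v.1, v.2.choose⟩, v.2.choose_spec⟩ - (2 * s 0) • T ⟨v.1, v.2.choose⟩ + (‖s‖ ^ 2) • v.1

/-- The standing assumptions on `T = T_0 + ∑_j e_j T_j`: the components `T_μ` are closed and
densely defined, `T` is closed, and `𝓓(T)`, `𝓓(T²)` are dense in `V_n`. -/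
structure IsClosedOperator (T : Fin (n + 1) → V →ₗ.[ℝ] V) : Prop where
  closed_comp : ∀ μ, (T μ).IsClosed
  dense_comp : ∀ μ, Dense ((T μ).domain : Set V)
  closed : (opT T).IsClosed
  dense_dom : Dense ((opT T).domain : Set (Vn V n))
  dense_domSq : Dense (domSq (opT T))

/-- The set `𝓑_n(V_n)` of the bounded operators `R = ∑_A R_A e_A`, where `R_A ∈ 𝓑(V)` and
`R(v) = ∑_{A,B} R_A(v_B) e_A e_B`. -/
def boundedOps (V : Type*) [NormedAddCommGroup V] [NormedSpace ℝ V] (n : ℕ) :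
    Set (Vn V n →L[ℝ] Vn V n) :=
  {R | ∃ R' : Finset (Fin n) → V →L[ℝ] V,
    ∀ v, R v = ∑ A, eAct A (coords.symm fun B => R' A (coords v B))}

/-- `R` is the `S`-resolvent operator `S⁻¹(s,T)`: the operator `T² - 2 Re[s] T + |s|² 𝓘` is
one-to-one on `𝓓(T²)` with range `V_n`, and `R ∈ 𝓑_n(V_n)` is given on `𝓓(T)` by
`-(T² - 2 Re[s] T + |s|² 𝓘)⁻¹ (T - s̄ 𝓘)`. -/
def IsSResolvent (T : Vn V n →ₗ.[ℝ] Vn V n) (s : Para n) (R : Vn V n →L[ℝ] Vn V n) : Prop :=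
  Function.Bijective (quad T s) ∧ R ∈ boundedOps V n ∧
    ∀ v : T.domain, ∃ x : domSq T, quad T s x = T v - lmul (toCl (paraConj s)) v.1 ∧ R v.1 = -x.1

/-- The `S`-resolvent set `ρ_S(T)`. -/
def sResolventSet (T : Vn V n →ₗ.[ℝ] Vn V n) : Set (Para n) := {s | ∃ R, IsSResolvent T s R}

/-- The `S`-spectrum `σ_S(T)`. -/
def sSpectrum (T : Vn V n →ₗ.[ℝ] Vn V n) : Set (Para n) := (sResolventSet T)ᶜ

open Classical in
/-- The `S`-resolvent operator `S⁻¹(s,T)` for `s ∈ ρ_S(T)` (and `0` for other `s`). -/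
def sResolvent (T : Vn V n →ₗ.[ℝ] Vn V n) (s : Para n) : Vn V n →L[ℝ] Vn V n :=
  if h : ∃ R, IsSResolvent T s R then h.choose else 0

/-- The bounded operator `A` is the inverse `(T - k 𝓘)⁻¹`. -/
def IsInverse (T : Vn V n →ₗ.[ℝ] Vn V n) (k : ℝ) (A : Vn V n →L[ℝ] Vn V n) : Prop :=
  (∀ v, ∃ x : T.domain, x.1 = A v ∧ T x - k • x.1 = v) ∧
    ∀ x : T.domain, A (T x - k • x.1) = x.1

end Operators

open Classical in
/-- The function `φ = f ∘ Φ⁻¹` with `Φ⁻¹(p) = p⁻¹ + k` and `Φ⁻¹(0) = ∞`; here `c = f(∞)`. -/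
def transform {n : ℕ} (f : Para n → Cl n) (c : Cl n) (k : ℝ) (p : Para n) : Cl n :=
  if p = 0 then c else f (paraInv p + ofR k)

end SliceMonogenic

end

open SliceMonogenic

namespace SliceMonogenic

open Complex (I)
open scoped Real ContDiff

/-! ### The Cauchy-Riemann operator in the plane and the Cauchy-Pompeiu formula -/

/-- The Cauchy-Riemann operator `∂̄`. -/
noncomputable def dbar (g : ℂ → ℂ) (z : ℂ) : ℂ := (fderiv ℝ g z 1 + I * fderiv ℝ g z I) / 2

theorem dbar_congr {g h : ℂ → ℂ} {z : ℂ} (H : g =ᶠ[𝓝 z] h) : dbar g z = dbar h z := by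
  rw [dbar, dbar, H.fderiv_eq]

theorem dbar_const (c z : ℂ) : dbar (fun _ => c) z = 0 := by
  simp [dbar]

theorem dbar_mul_of_differentiableAt {g h : ℂ → ℂ} {z : ℂ} (hg : DifferentiableAt ℝ g z)
    (hh : DifferentiableAt ℂ h z) : dbar (fun w => g w * h w) z = dbar g z * h z := by
  have hh' : HasFDerivAt h ((fderiv ℂ h z).restrictScalars ℝ) z :=
    hh.hasFDerivAt.restrictScalars ℝ
  have h1 : fderiv ℂ h z I = I * fderiv ℂ h z 1 := by
    rw [← mul_one I, ← smul_eq_mul, map_smul, smul_eq_mul, smul_eq_mul, mul_one]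
  have h2 := (hg.hasFDerivAt.mul hh').fderiv
  rw [dbar, dbar]
  change (fderiv ℝ (g * h) z 1 + I * fderiv ℝ (g * h) z I) / 2 = _
  rw [h2]
  simp only [add_apply, smul_apply, ContinuousLinearMap.coe_restrictScalars',
    smul_eq_mul, h1]
  linear_combination (g z * fderiv ℂ h z 1 / 2) * Complex.I_mul_I

theorem continuous_dbar {g : ℂ → ℂ} (hg : ContDiff ℝ 1 g) : Continuous (dbar g) := by
  have h := hg.continuous_fderiv one_ne_zero
  unfold dbar
  fun_prop

theorem hasCompactSupport_dbar {g : ℂ → ℂ} (hg : HasCompactSupport g) :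
    HasCompactSupport (dbar g) := by
  refine (hg.fderiv (𝕜 := ℝ)).mono fun z hz => ?_
  contrapose! hz
  rw [Function.mem_support, not_not] at hz ⊢
  simp [dbar, hz]

/-- In polar coordinates the integrand becomes half of ∂_r g plus i/r times ∂_θ g. The first term
integrates to -g(0) along every ray, the second to 0 around every circle. -/
theorem integral_dbar_div {g : ℂ → ℂ} (hg : ContDiff ℝ 1 g) (hc : HasCompactSupport g) :
    ∫ z, dbar g z / z = -(π * g 0) := by
  obtain ⟨R, hR0, hR⟩ : ∃ R : ℝ, 0 < R ∧ ∀ z : ℂ, R ≤ ‖z‖ → g z = 0 ∧ fderiv ℝ g z = 0 := by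
    obtain ⟨R, hR⟩ := hc.isCompact.isBounded.subset_ball 0
    refine ⟨max R 1, by positivity, fun z hz => ?_⟩
    have hz' : z ∉ tsupport g := by
      intro h
      have := hR h
      rw [mem_ball_zero_iff] at this
      exact absurd (le_trans (le_max_left _ _) hz) (not_le.mpr this)
    exact ⟨image_eq_zero_of_notMem_tsupport hz', fderiv_of_notMem_tsupport _ hz'⟩
  let e : ℝ → ℂ := fun θ => Real.cos θ + Real.sin θ * I
  have he : Continuous e := by fun_prop
  have hen : ∀ θ, e θ ≠ 0 := fun θ h => by
    have := congrArg (‖·‖ ^ 2) h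
    simp [e, ← Complex.normSq_eq_norm_sq, Complex.normSq_apply, ← pow_two, -Complex.ofReal_cos, -Complex.ofReal_sin] at this
  have hD := hg.continuous_fderiv one_ne_zero
  let A : ℝ × ℝ → ℂ := fun p => fderiv ℝ g (p.1 * e p.2) (e p.2)
  let B : ℝ × ℝ → ℂ := fun p => fderiv ℝ g (p.1 * e p.2) (I * e p.2)
  have hA : Continuous A := by
    have : Continuous fun p : ℝ × ℝ => (p.1 : ℂ) * e p.2 := by fun_prop
    exact (hD.comp this).clm_apply (he.comp continuous_snd)
  have hB : Continuous B := by
    have : Continuous fun p : ℝ × ℝ => (p.1 : ℂ) * e p.2 := by fun_prop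
    exact (hD.comp this).clm_apply (continuous_const.mul (he.comp continuous_snd))
  have hIA : IntegrableOn A (Ioc 0 R ×ˢ Ioo (-π) π) :=
    (hA.continuousOn.integrableOn_compact (isCompact_Icc.prod isCompact_Icc)).mono_set
      (prod_mono Ioc_subset_Icc_self Ioo_subset_Icc_self)
  have hIB : IntegrableOn B (Ioc 0 R ×ˢ Ioo (-π) π) :=
    (hB.continuousOn.integrableOn_compact (isCompact_Icc.prod isCompact_Icc)).mono_set
      (prod_mono Ioc_subset_Icc_self Ioo_subset_Icc_self)
  have hne : ∀ θ, ‖e θ‖ = 1 := fun θ => by simp [e]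
  have hlin : ∀ (L : ℂ →L[ℝ] ℂ) (w : ℂ), L w = w.re * L 1 + w.im * L I := fun L w => by
    conv_lhs => rw [← Complex.re_add_im w]
    rw [map_add, show ((w.re : ℂ)) = w.re • (1 : ℂ) by simp,
      show ((w.im : ℂ) * I) = w.im • I by simp, map_smul, map_smul]
    simp
  -- Here A = ∂_r g and r B = ∂_θ g, and ∂̄ = (e^{iθ}/2)(∂_r + (i/r) ∂_θ). The Jacobian r and the
  -- factor e^{iθ} cancel against 1/z.
  have hpt : ∀ p : ℝ × ℝ, 0 < p.1 →
      p.1 • (dbar g (p.1 * e p.2) / (p.1 * e p.2)) = (A p + I * B p) / 2 := by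
    intro p hp
    have hp' : (p.1 : ℂ) ≠ 0 := by exact_mod_cast hp.ne'
    have h1 : p.1 • (dbar g (p.1 * e p.2) / (p.1 * e p.2)) = dbar g (p.1 * e p.2) / e p.2 := by
      rw [Complex.real_smul]
      field_simp
    rw [h1, div_eq_iff (hen _)]
    simp only [A, B, dbar]
    rw [hlin _ (e p.2), hlin _ (I * e p.2)]
    have h2 : Complex.re (e p.2) = Real.cos p.2 := by simp [e, -Complex.ofReal_cos, -Complex.ofReal_sin]
    have h3 : Complex.im (e p.2) = Real.sin p.2 := by simp [e, -Complex.ofReal_cos, -Complex.ofReal_sin]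
    have h4 : Complex.re (I * e p.2) = -Real.sin p.2 := by simp [h3]
    have h5 : Complex.im (I * e p.2) = Real.cos p.2 := by simp [h2]
    rw [h2, h3, h4, h5]
    have h6 : (Real.cos p.2 : ℂ) ^ 2 + (Real.sin p.2 : ℂ) ^ 2 = 1 := by
      exact_mod_cast Real.cos_sq_add_sin_sq p.2
    simp only [e, Complex.ofReal_neg]
    generalize (Real.cos p.2 : ℂ) = c at *
    generalize (Real.sin p.2 : ℂ) = s at *
    generalize fderiv ℝ g _ 1 = x
    generalize fderiv ℝ g _ I = y
    have hI := Complex.I_mul_I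
    linear_combination (-(x + I * y) / 2) * h6 + ((x + I * y) * s ^ 2 / 2 - s * y * (c + s * I) / 2) * hI
  rw [← Complex.integral_comp_polarCoord_symm]
  have h1 : ∫ p in polarCoord.target, p.1 • (dbar g (Complex.polarCoord.symm p) /
      Complex.polarCoord.symm p) = ∫ p in Ioc 0 R ×ˢ Ioo (-π) π, (A p + I * B p) / 2 := by
    have h2 : ∫ p in polarCoord.target, p.1 • (dbar g (Complex.polarCoord.symm p) /
      Complex.polarCoord.symm p) = ∫ p in polarCoord.target, (A p + I * B p) / 2 := by
      refine setIntegral_congr_fun polarCoord.open_target.measurableSet fun p hp => ?_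
      rw [polarCoord_target] at hp
      rw [← hpt p hp.1, Complex.polarCoord_symm_apply]
    rw [h2, polarCoord_target]
    refine (setIntegral_eq_of_subset_of_forall_sdiff_eq_zero
      (measurableSet_Ioi.prod measurableSet_Ioo) (prod_mono Ioc_subset_Ioi_self subset_rfl) ?_)
    intro p hp
    have hp1 : R ≤ p.1 := by
      by_contra h
      exact hp.2 ⟨⟨hp.1.1, (not_le.mp h).le⟩, hp.1.2⟩
    have : fderiv ℝ g (p.1 * e p.2) = 0 := by
      refine (hR _ ?_).2
      rw [norm_mul, hne, mul_one, Complex.norm_real, Real.norm_eq_abs]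
      exact hp1.trans (le_abs_self _)
    simp [A, B, this]
  have hder : ∀ r θ : ℝ, HasDerivAt (fun r : ℝ => g (r * e θ)) (A (r, θ)) r := by
    intro r θ
    have h2 : HasDerivAt (fun r : ℝ => (r : ℂ) * e θ) (e θ) r := by
      simpa using (Complex.ofRealCLM.hasDerivAt (x := r)).mul_const (e θ)
    exact ((hg.differentiable one_ne_zero).differentiableAt.hasFDerivAt.comp_hasDerivAt r h2)
  have hder' : ∀ r θ : ℝ, HasDerivAt (fun θ : ℝ => g (r * e θ)) (r * B (r, θ)) θ := by
    intro r θ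
    have h3 : HasDerivAt e (I * e θ) θ := by
      have h4 := (Real.hasDerivAt_cos θ).ofReal_comp
      have h5 := ((Real.hasDerivAt_sin θ).ofReal_comp).mul_const I
      convert! h4.add h5 using 1
      simp only [e]
      push_cast
      linear_combination (Complex.sin θ) * Complex.I_mul_I
    have h2 : HasDerivAt (fun θ : ℝ => (r : ℂ) * e θ) (r • (I * e θ)) θ := by
      simpa using h3.const_mul (r : ℂ)
    have := ((hg.differentiable one_ne_zero).differentiableAt.hasFDerivAt.comp_hasDerivAt θ h2)
    rw [map_smul, Complex.real_smul] at this
    exact this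
  have hAint : ∫ p in Ioc 0 R ×ˢ Ioo (-π) π, A p = -(2 * π * g 0) := by
    rw [Measure.volume_eq_prod] at hIA ⊢
    rw [setIntegral_prod _ hIA, integral_integral_swap]
    · have : ∀ θ : ℝ, ∫ r in Ioc 0 R, A (r, θ) = -g 0 := by
        intro θ
        rw [← intervalIntegral.integral_of_le hR0.le,
          intervalIntegral.integral_eq_sub_of_hasDerivAt (fun r _ => hder r θ)
            ((hA.comp (by fun_prop : Continuous fun r : ℝ => (r, θ))).intervalIntegrable _ _)]
        rw [(hR (R * e θ) _).1]
        · simp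
        · rw [norm_mul, hne, mul_one, Complex.norm_real, Real.norm_eq_abs]
          exact le_abs_self _
      simp only [this]
      simp [Real.pi_pos.le]
      left
      ring
    · rw [Measure.prod_restrict]
      exact hIA
  have hBint : ∫ p in Ioc 0 R ×ˢ Ioo (-π) π, B p = 0 := by
    rw [Measure.volume_eq_prod] at hIB ⊢
    rw [setIntegral_prod _ hIB]
    refine setIntegral_eq_zero_of_forall_eq_zero fun r hr => ?_
    rw [← integral_Ioc_eq_integral_Ioo, ← intervalIntegral.integral_of_le (by linarith [Real.pi_pos])]
    have hr' : (r : ℂ) ≠ 0 := by exact_mod_cast hr.1.ne'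
    have h2 : (r : ℂ) * ∫ θ in (-π)..π, B (r, θ) = 0 := by
      rw [← intervalIntegral.integral_const_mul,
        intervalIntegral.integral_eq_sub_of_hasDerivAt (fun θ _ => hder' r θ)
            ((continuous_const.mul (hB.comp (by fun_prop : Continuous fun θ : ℝ => (r, θ)))).intervalIntegrable _ _)]
      simp [e]
    exact (mul_eq_zero.mp h2).resolve_left hr'
  rw [h1, integral_div, integral_add hIA (hIB.const_mul I), integral_const_mul, hAint, hBint]
  ring

/-- The Cauchy-Pompeiu formula for functions with compact support. -/
theorem integral_dbar_div_sub {g : ℂ → ℂ} (hg : ContDiff ℝ 1 g) (hc : HasCompactSupport g)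
    (ζ : ℂ) : ∫ z, dbar g z / (ζ - z) = π * g ζ := by
  have hg' : ContDiff ℝ 1 (fun z => g (ζ + z)) := hg.comp (by fun_prop)
  have hc' : HasCompactSupport (fun z => g (ζ + z)) :=
    hc.comp_homeomorph (Homeomorph.addLeft ζ)
  have h := integral_dbar_div hg' hc'
  have h1 : ∀ z, dbar (fun z => g (ζ + z)) z = dbar g (ζ + z) := by
    intro z
    rw [dbar, dbar, fderiv_comp_add_left]
  simp only [h1, add_zero] at h
  rw [← integral_add_left_eq_self _ ζ]
  have h2 : ∀ z : ℂ, dbar g (ζ + z) / (ζ - (ζ + z)) = -(dbar g (ζ + z) / z) := by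
    intro z
    rw [sub_add_cancel_left, div_neg]
  simp only [h2]
  rw [integral_neg, h, neg_neg]

/-- The Cauchy-Pompeiu formula for z g(z) at the point 0, where this function vanishes. -/
theorem integral_dbar {g : ℂ → ℂ} (hg : ContDiff ℝ 1 g) (hc : HasCompactSupport g) :
    ∫ z, dbar g z = 0 := by
  have h := integral_dbar_div_sub (g := fun z => g z * z) (hg.mul contDiff_id) hc.mul_right 0
  have h1 : ∀ z : ℂ, dbar (fun z => g z * z) z = dbar g z * z := fun z =>
    dbar_mul_of_differentiableAt (hg.differentiable one_ne_zero).differentiableAt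
      differentiableAt_id
  simp only [h1, zero_sub, mul_zero] at h
  have h2 : (fun z => dbar g z * z / -z) =ᵐ[volume] fun z => -dbar g z := by
    have : ∀ᵐ z : ℂ, z ≠ 0 := by
      simp [ae_iff]
    filter_upwards [this] with z hz
    field_simp
  rw [integral_congr_ae h2, integral_neg] at h
  exact neg_eq_zero.mp h

end SliceMonogenic

namespace SliceMonogenic

open Complex (I)
open scoped Real ContDiff ENNReal NNReal

/-! ### Cut-off functions and contour integrals as area integrals -/

/-- `χ` is a `C¹` function that is `1` near `C` and `0` near the complement of `O`. -/
structure IsCutoff (χ : ℂ → ℝ) (C O : Set ℂ) : Prop where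
  contDiff : ContDiff ℝ 1 χ
  eq_one : ∀ z ∈ C, ∀ᶠ w in 𝓝 z, χ w = 1
  eq_zero : ∀ z ∉ O, ∀ᶠ w in 𝓝 z, χ w = 0

theorem IsCutoff.mono {χ : ℂ → ℝ} {C C' O O' : Set ℂ} (h : IsCutoff χ C O) (hC : C' ⊆ C)
    (hO : O ⊆ O') : IsCutoff χ C' O' :=
  ⟨h.contDiff, fun z hz => h.eq_one z (hC hz), fun z hz => h.eq_zero z fun hz' => hz (hO hz')⟩

theorem exists_isCutoff {C O : Set ℂ} (hC : IsClosed C) (hO : IsOpen O) (h : C ⊆ O) :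
    ∃ χ, IsCutoff χ C O := by
  obtain ⟨χ, h0, h1, -⟩ := exists_contMDiffMap_zero_one_nhds_of_isClosed
    (modelWithCornersSelf ℝ ℂ) (n := 1) hO.isClosed_compl hC
    (disjoint_compl_left_iff_subset.mpr h)
  rw [eventually_nhdsSet_iff_forall] at h0 h1
  exact ⟨χ, χ.contMDiff.contDiff, h1, fun z hz => h0 z hz⟩

/-- The cut-off function may be chosen invariant under complex conjugation. -/
theorem exists_isCutoff_conj {C O : Set ℂ} (hC : IsClosed C) (hO : IsOpen O) (h : C ⊆ O)
    (hC' : ∀ z ∈ C, star z ∈ C) (hO' : ∀ z ∈ O, star z ∈ O) :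
    ∃ χ, IsCutoff χ C O ∧ ∀ z, χ (star z) = χ z := by
  obtain ⟨χ, hχ⟩ := exists_isCutoff hC hO h
  have hs : ∀ z : ℂ, Tendsto (fun w : ℂ => star w) (𝓝 z) (𝓝 (star z)) := fun z =>
    continuous_star.tendsto z
  refine ⟨fun z => (χ z + χ (star z)) / 2, ⟨?_, fun z hz => ?_, fun z hz => ?_⟩, fun z => ?_⟩
  · have : ContDiff ℝ 1 fun z : ℂ => star z := Complex.conjCLE.contDiff
    exact (hχ.contDiff.add (hχ.contDiff.comp this)).div_const 2
  · filter_upwards [hχ.eq_one z hz, (hs z).eventually (hχ.eq_one _ (hC' z hz))] with w h1 h2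
    rw [h1, h2]
    norm_num
  · have hz' : star z ∉ O := fun h => hz (by simpa using hO' _ h)
    filter_upwards [hχ.eq_zero z hz, (hs z).eventually (hχ.eq_zero _ hz')] with w h1 h2
    rw [h1, h2]
    norm_num
  · simp only [star_star]
    ring

/-- The complex contour integral over a system of arcs. -/
noncomputable def arcIntegral {m : ℕ} (γ : Fin m → ℝ → ℂ) (h : ℂ → ℂ) : ℂ :=
  ∑ j, ∫ t in (0 : ℝ)..1, h (γ j t) * deriv (γ j) t

/-- The properties of the positively oriented boundary of `G` that matter for integration. -/
structure IsContour (w : ℤ) {m : ℕ} (γ : Fin m → ℝ → ℂ) (G : Set ℂ) : Prop where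
  lipschitz : ∀ j, ∃ K, LipschitzOnWith K (γ j) (Icc 0 1)
  mem_closure : ∀ j, ∀ t ∈ Icc (0 : ℝ) 1, γ j t ∈ closure G
  notMem : ∀ j, ∀ t ∈ Icc (0 : ℝ) 1, γ j t ∉ G
  winding : ∀ z ∈ G, arcIntegral γ (fun ζ => (ζ - z)⁻¹) = 2 * π * I * w
  winding_compl : ∀ z ∉ closure G, arcIntegral γ (fun ζ => (ζ - z)⁻¹) = 2 * π * I * (w - 1)

theorem IsOrientedBoundary.isContour {w : ℤ} {m : ℕ} {γ : Fin m → ℝ → ℂ} {G : Set ℂ}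
    (hG : IsOpen G) (h : IsOrientedBoundary w γ G) : IsContour w γ G := by
  obtain ⟨h1, h2, h3, h4⟩ := h
  have h5 : ∀ j, ∀ t ∈ Icc (0 : ℝ) 1, γ j t ∈ closure G \ G := fun j t ht => by
    rw [← hG.frontier_eq, ← h2]
    exact mem_iUnion.mpr ⟨j, mem_image_of_mem _ ht⟩
  refine ⟨h1, fun j t ht => (h5 j t ht).1, fun j t ht => (h5 j t ht).2, fun z hz => ?_,
    fun z hz => ?_⟩
  · rw [← h3 z hz, arcIntegral]
    simp only [div_eq_mul_inv, mul_comm]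
  · rw [← h4 z hz, arcIntegral]
    simp only [div_eq_mul_inv, mul_comm]

theorem norm_deriv_le_of_lipschitzOn_Icc {E : Type*} [NormedAddCommGroup E] [NormedSpace ℝ E]
    {γ : ℝ → E} {K : ℝ≥0} (h : LipschitzOnWith K γ (Icc 0 1)) {t : ℝ} (ht : t ∈ Ioo (0 : ℝ) 1) :
    ‖deriv γ t‖ ≤ K :=
  norm_deriv_le_of_lipschitzOn (Icc_mem_nhds ht.1 ht.2) h

/-- A continuous function times a bounded derivative is integrable. -/
theorem intervalIntegrable_clm_deriv {E : Type*} [NormedAddCommGroup E] [NormedSpace ℝ E]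
    {γ : ℝ → ℂ} {K : ℝ≥0} (h : LipschitzOnWith K γ (Icc 0 1)) {f : ℝ → ℂ →L[ℝ] E}
    (hf : ContinuousOn f (Icc 0 1)) :
    IntervalIntegrable (fun t => f t (deriv γ t)) volume 0 1 := by
  rw [intervalIntegrable_iff_integrableOn_Ioo_of_le zero_le_one]
  have h1 : IntegrableOn f (Ioo 0 1) :=
    (hf.integrableOn_compact isCompact_Icc).mono_set Ioo_subset_Icc_self
  have h2 : AEStronglyMeasurable (fun t => deriv γ t) (volume.restrict (Ioo (0 : ℝ) 1)) :=
    (measurable_deriv γ).aestronglyMeasurable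
  refine Integrable.mono' (h1.norm.mul_const (K : ℝ)) ?_ ?_
  · exact (isBoundedBilinearMap_apply (𝕜 := ℝ) (E := ℂ) (F := E)).continuous.comp_aestronglyMeasurable₂
      h1.aestronglyMeasurable h2
  · filter_upwards [ae_restrict_mem measurableSet_Ioo] with t ht
    exact (ContinuousLinearMap.le_opNorm _ _).trans
      (mul_le_mul_of_nonneg_left (norm_deriv_le_of_lipschitzOn_Icc h ht) (norm_nonneg _))

theorem intervalIntegrable_mul_deriv {γ : ℝ → ℂ} {K : ℝ≥0} (h : LipschitzOnWith K γ (Icc 0 1))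
    {f : ℝ → ℂ} (hf : ContinuousOn f (Icc 0 1)) :
    IntervalIntegrable (fun t => f t * deriv γ t) volume 0 1 :=
  intervalIntegrable_clm_deriv h (f := fun t => ContinuousLinearMap.mul ℝ ℂ (f t))
    ((ContinuousLinearMap.mul ℝ ℂ).continuous.comp_continuousOn hf)

/-- Integrate the Cauchy-Pompeiu representation of g along γ and exchange the integrals. The curve
has positive distance δ from the support of ∂̄g, so the kernel is bounded by K/δ and Fubini applies.
-/
theorem integral_comp_mul_deriv_eq {g : ℂ → ℂ} (hg : ContDiff ℝ 1 g) (hc : HasCompactSupport g)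
    {γ : ℝ → ℂ} {K : ℝ≥0} (h : LipschitzOnWith K γ (Icc 0 1))
    (h0 : ∀ t ∈ Icc (0 : ℝ) 1, γ t ∉ tsupport (dbar g)) :
    Integrable (fun z => dbar g z * ∫ t in (0 : ℝ)..1, (γ t - z)⁻¹ * deriv γ t) ∧
    ∫ t in (0 : ℝ)..1, g (γ t) * deriv γ t =
      (π : ℂ)⁻¹ * ∫ z, dbar g z * ∫ t in (0 : ℝ)..1, (γ t - z)⁻¹ * deriv γ t := by
  have hγ : ContinuousOn γ (Icc 0 1) := h.continuousOn
  have hcd := hasCompactSupport_dbar hc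
  have hd := continuous_dbar hg
  obtain ⟨δ, hδ0, hδ⟩ := Metric.exists_pos_forall_lt_edist (isCompact_Icc.image_of_continuousOn hγ)
    (isClosed_tsupport (dbar g)) (by
      rw [disjoint_left]
      rintro _ ⟨t, ht, rfl⟩
      exact h0 t ht)
  have hδ' : ∀ t ∈ Icc (0 : ℝ) 1, ∀ z ∈ tsupport (dbar g), (δ : ℝ) ≤ ‖γ t - z‖ := by
    intro t ht z hz
    have := hδ (γ t) (mem_image_of_mem _ ht) z hz
    rw [edist_dist, ← ENNReal.ofReal_coe_nnreal, dist_eq_norm] at this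
    exact ((ENNReal.ofReal_lt_ofReal_iff_of_nonneg δ.2).mp this).le
  let F : ℝ × ℂ → ℂ := fun p => (γ p.1 - p.2)⁻¹ * deriv γ p.1 * dbar g p.2
  have hF : Integrable F ((volume.restrict (Ioo (0 : ℝ) 1)).prod volume) := by
    have h1 : Integrable (dbar g) volume := hd.integrable_of_hasCompactSupport hcd
    have h2 : Integrable (fun p : ℝ × ℂ => ‖dbar g p.2‖ * ((δ : ℝ)⁻¹ * K))
        ((volume.restrict (Ioo (0 : ℝ) 1)).prod volume) := by
      exact (h1.norm.comp_snd _).mul_const _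
    refine h2.mono' ?_ ?_
    · have m1 : AEStronglyMeasurable γ (volume.restrict (Ioo (0 : ℝ) 1)) :=
        ((hγ.mono Ioo_subset_Icc_self).aestronglyMeasurable measurableSet_Ioo)
      have m2 : AEStronglyMeasurable (deriv γ) (volume.restrict (Ioo (0 : ℝ) 1)) :=
        (measurable_deriv γ).aestronglyMeasurable
      have m3 : AEStronglyMeasurable (fun p : ℝ × ℂ => γ p.1 - p.2)
          ((volume.restrict (Ioo (0 : ℝ) 1)).prod volume) :=
        m1.comp_fst.sub continuous_snd.aestronglyMeasurable
      exact ((m3.aemeasurable.inv.aestronglyMeasurable).mul m2.comp_fst).mul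
        hd.aestronglyMeasurable.comp_snd
    · have h3 : ∀ᵐ p ∂((volume.restrict (Ioo (0 : ℝ) 1)).prod (volume : Measure ℂ)),
          p.1 ∈ Ioo (0 : ℝ) 1 := by
        have := Measure.quasiMeasurePreserving_fst (μ := volume.restrict (Ioo (0 : ℝ) 1))
          (ν := (volume : Measure ℂ))
        exact this.ae (ae_restrict_mem measurableSet_Ioo)
      filter_upwards [h3] with p hp
      simp only [F, norm_mul, norm_inv]
      rw [mul_comm]
      by_cases hz : p.2 ∈ tsupport (dbar g)
      · gcongr
        · exact hδ' _ (Ioo_subset_Icc_self hp) _ hz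
        · exact norm_deriv_le_of_lipschitzOn_Icc h hp
      · rw [image_eq_zero_of_notMem_tsupport hz]
        simp
  have hint : ∀ z, ∫ t in Ioo (0 : ℝ) 1, F (t, z) =
      dbar g z * ∫ t in (0 : ℝ)..1, (γ t - z)⁻¹ * deriv γ t := by
    intro z
    rw [intervalIntegral.integral_of_le zero_le_one, integral_Ioc_eq_integral_Ioo,
      ← integral_const_mul]
    simp only [F, mul_comm]
  constructor
  · refine hF.integral_prod_right.congr (Eventually.of_forall fun z => hint z)
  · have h4 := integral_integral_swap (f := fun t z => F (t, z)) hF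
    simp only [hint] at h4
    rw [← h4, intervalIntegral.integral_of_le zero_le_one, integral_Ioc_eq_integral_Ioo,
      ← integral_const_mul]
    refine setIntegral_congr_fun measurableSet_Ioo fun t _ => ?_
    have h5 := integral_dbar_div_sub hg hc (γ t)
    have h6 : ∀ z, F (t, z) = deriv γ t * (dbar g z / (γ t - z)) := fun z => by
      simp only [F]
      ring
    simp only [h6]
    rw [integral_const_mul, h5]
    have : (π : ℂ) ≠ 0 := by exact_mod_cast Real.pi_ne_zero
    field_simp

/-- Contour integrals of holomorphic functions as area integrals: here `h` is holomorphic near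
`G ∪ ∂G` outside the closed set `C ⊆ G`. -/
theorem IsContour.arcIntegral_eq {w : ℤ} {m : ℕ} {γ : Fin m → ℝ → ℂ} {G Ω C : Set ℂ}
    (hγ : IsContour w γ G) (hΩ : IsOpen Ω) (hC : IsClosed C)
    (hGΩ : closure G ⊆ Ω) (hb : Bornology.IsBounded (G \ C)) {χ : ℂ → ℝ} (hχ : IsCutoff χ C G)
    {h : ℂ → ℂ} (hh : DifferentiableOn ℂ h (Ω \ C)) :
    arcIntegral γ h = -(2 * I * ∫ z, h z * dbar (fun z => (χ z : ℂ)) z) := by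
  obtain ⟨M, hM⟩ := hb.subset_ball 0
  let N : Set ℂ := interior {z | χ z = 1}
  have hCN : C ⊆ N := fun z hz => mem_interior_iff_mem_nhds.mpr (hχ.eq_one z hz)
  -- Outside the ball, `O₂` lies in the region where χ = 1, so χ₂ (1 - χ) has compact support even
  -- if `G` is unbounded.
  let O₂ : Set ℂ := Ω ∩ (Metric.ball 0 (M + 1) ∪ N)
  have hGO : closure G ⊆ O₂ := by
    intro z hz
    refine ⟨hGΩ hz, ?_⟩
    by_cases hzC : z ∈ C
    · exact Or.inr (hCN hzC)
    · left
      have h1 : z ∈ closure (G \ C) := by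
        rw [sdiff_eq]
        have := hC.isOpen_compl.inter_closure (s := Cᶜ) (t := G) ⟨hzC, hz⟩
        rwa [inter_comm] at this
      have h2 := Metric.closure_ball_subset_closedBall (closure_mono hM h1)
      rw [Metric.mem_closedBall] at h2
      rw [Metric.mem_ball]
      linarith
  obtain ⟨χ₂, hχ₂⟩ := exists_isCutoff isClosed_closure
    (hΩ.inter (Metric.isOpen_ball.union isOpen_interior)) hGO
  -- η is 1 near the frontier of `G`, where the arcs run, and 0 near `C`; thus η h agrees with h on
  -- the arcs and is C¹ on the whole plane.
  let η : ℂ → ℂ := fun z => ((χ₂ z * (1 - χ z) : ℝ) : ℂ)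
  have hη : ContDiff ℝ 1 η :=
    Complex.ofRealCLM.contDiff.comp (hχ₂.contDiff.mul (contDiff_const.sub hχ.contDiff))
  let g : ℂ → ℂ := fun z => η z * h z
  have hh' : ∀ z ∈ Ω \ C, DifferentiableAt ℂ h z := fun z hz =>
    hh.differentiableAt ((hΩ.sdiff hC).mem_nhds hz)
  have hη0 : ∀ z ∉ Ω \ C, η =ᶠ[𝓝 z] 0 := by
    intro z hz
    by_cases hzC : z ∈ C
    · filter_upwards [hχ.eq_one z hzC] with v hv
      simp [η, hv]
    · have hz2 : z ∉ O₂ := fun h => hz ⟨h.1, hzC⟩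
      filter_upwards [hχ₂.eq_zero z hz2] with v hv
      simp [η, hv]
  have hg0 : ∀ z ∉ Ω \ C, g =ᶠ[𝓝 z] 0 := by
    intro z hz
    filter_upwards [hη0 z hz] with v hv
    simp [g, hv]
  have hg : ContDiff ℝ 1 g := by
    rw [contDiff_iff_contDiffAt]
    intro z
    by_cases hz : z ∈ Ω \ C
    · have h1 : ContDiffAt ℂ 1 h z :=
        ((hh.contDiffOn (hΩ.sdiff hC)).contDiffAt ((hΩ.sdiff hC).mem_nhds hz))
      exact hη.contDiffAt.mul (h1.restrict_scalars ℝ)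
    · exact contDiffAt_const.congr_of_eventuallyEq (hg0 z hz)
  have hdg : ∀ z, dbar g z = dbar η z * h z := by
    intro z
    by_cases hz : z ∈ Ω \ C
    · exact dbar_mul_of_differentiableAt (hη.differentiable one_ne_zero).differentiableAt (hh' z hz)
    · rw [dbar_congr (hg0 z hz), dbar_congr (hη0 z hz)]
      simp [Pi.zero_def, dbar_const]
  have hgc : HasCompactSupport g := by
    refine HasCompactSupport.intro (isCompact_closedBall (0 : ℂ) (M + 1)) fun z hz => ?_
    by_cases hz2 : z ∈ O₂
    · rcases hz2.2 with h1 | h1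
      · exact absurd (Metric.ball_subset_closedBall h1) hz
      · have h2 : χ z = 1 := (interior_subset h1 : z ∈ {z | χ z = 1})
        simp [g, η, h2]
    · have h2 := (hχ₂.eq_zero z hz2).self_of_nhds
      simp [g, η, h2]
  have hfr : ∀ z ∈ closure G, z ∉ G → η =ᶠ[𝓝 z] fun _ => 1 := by
    intro z hz hzG
    filter_upwards [hχ₂.eq_one z hz, hχ.eq_zero z hzG] with v h1 h2
    simp [η, h1, h2]
  have hη1 : ∀ z ∈ G, η =ᶠ[𝓝 z] fun z => 1 - (χ z : ℂ) := by
    intro z hz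
    filter_upwards [hχ₂.eq_one z (subset_closure hz)] with v h1
    simp [η, h1]
  have hts : ∀ j, ∀ t ∈ Icc (0 : ℝ) 1, γ j t ∉ tsupport (dbar g) := by
    intro j t ht
    rw [notMem_tsupport_iff_eventuallyEq]
    have h1 := hfr _ (hγ.mem_closure j t ht) (hγ.notMem j t ht)
    filter_upwards [h1.eventually_nhds] with v hv
    rw [hdg, dbar_congr hv, dbar_const, zero_mul, Pi.zero_apply]
  choose K hK using hγ.lipschitz
  have hmain := fun j => integral_comp_mul_deriv_eq hg hgc (hK j) (hts j)
  have h1 : arcIntegral γ h = ∑ j, ∫ t in (0 : ℝ)..1, g (γ j t) * deriv (γ j) t := by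
    refine Finset.sum_congr rfl fun j _ => intervalIntegral.integral_congr fun t ht => ?_
    rw [uIcc_of_le zero_le_one] at ht
    have := (hfr _ (hγ.mem_closure j t ht) (hγ.notMem j t ht)).self_of_nhds
    simp only [g, this, one_mul]
  rw [h1, Finset.sum_congr rfl fun j _ => (hmain j).2, ← Finset.mul_sum,
    ← integral_finsetSum _ fun j _ => (hmain j).1]
  -- On `G` the winding number is w = (w - 1) + 1 and ∂̄g = -h ∂̄χ; off the closure of `G` it is w -
  -- 1; on the frontier ∂̄g = 0. The term with w - 1 is a constant times ∂̄g, whose integral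
  -- vanishes, so w drops out.
  have h2 : ∀ z, ∑ j, dbar g z * ∫ t in (0 : ℝ)..1, (γ j t - z)⁻¹ * deriv (γ j) t =
      2 * π * I * (w - 1) * dbar g z - 2 * π * I * (h z * dbar (fun z => (χ z : ℂ)) z) := by
    intro z
    rw [← Finset.mul_sum]
    change dbar g z * arcIntegral γ (fun ζ => (ζ - z)⁻¹) = _
    by_cases hz : z ∈ G
    · have hχd : DifferentiableAt ℝ (fun z => (χ z : ℂ)) z :=
        (Complex.ofRealCLM.contDiff.comp hχ.contDiff).differentiable one_ne_zero z
      have h3 : dbar g z = -(h z * dbar (fun z => (χ z : ℂ)) z) := by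
        rw [hdg, dbar_congr (hη1 z hz)]
        have h4 : dbar (fun z => 1 - (χ z : ℂ)) z = -dbar (fun z => (χ z : ℂ)) z := by
          rw [dbar, dbar, fderiv_const_sub]
          simp only [neg_apply]
          ring
        rw [h4]
        ring
      rw [hγ.winding z hz, h3]
      ring
    · have h3 : dbar (fun z => (χ z : ℂ)) z = 0 := by
        have h4 : (fun z => (χ z : ℂ)) =ᶠ[𝓝 z] fun _ => 0 := by
          filter_upwards [hχ.eq_zero z hz] with v hv
          simp [hv]
        rw [dbar_congr h4, dbar_const]
      rw [h3, mul_zero, mul_zero, sub_zero]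
      by_cases hz' : z ∈ closure G
      · rw [hdg, dbar_congr (hfr z hz' hz), dbar_const]
        simp
      · rw [hγ.winding_compl z hz']
        ring
  simp only [h2]
  have hi1 : Integrable (dbar g) :=
    (continuous_dbar hg).integrable_of_hasCompactSupport (hasCompactSupport_dbar hgc)
  -- Integrability is read off from the identity just proved, the two other terms being integrable.
  have hi2 : Integrable fun z => h z * dbar (fun z => (χ z : ℂ)) z := by
    have h5 := integrable_finsetSum Finset.univ fun j (_ : j ∈ Finset.univ) => (hmain j).1
    simp only [h2] at h5
    have h6 := ((hi1.const_mul (2 * π * I * (w - 1))).sub h5).const_mul (2 * π * I)⁻¹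
    refine h6.congr (Eventually.of_forall fun z => ?_)
    simp only [Pi.sub_apply, sub_sub_cancel]
    rw [inv_mul_cancel_left₀ Complex.two_pi_I_ne_zero]
  rw [integral_sub (hi1.const_mul _) (hi2.const_mul _), integral_const_mul, integral_const_mul,
    integral_dbar hg hgc]
  have : (π : ℂ) ≠ 0 := by exact_mod_cast Real.pi_ne_zero
  field_simp
  ring

/-- Cauchy's theorem. -/
theorem IsContour.arcIntegral_eq_zero {w : ℤ} {m : ℕ} {γ : Fin m → ℝ → ℂ} {G Ω : Set ℂ}
    (hγ : IsContour w γ G) (hΩ : IsOpen Ω) (hGΩ : closure G ⊆ Ω)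
    (hb : Bornology.IsBounded G) {h : ℂ → ℂ} (hh : DifferentiableOn ℂ h Ω) :
    arcIntegral γ h = 0 := by
  rw [hγ.arcIntegral_eq hΩ isClosed_empty hGΩ (by simpa using hb) (χ := fun _ => 0)
    ⟨contDiff_const, by simp, by simp⟩ (by simpa using hh)]
  simp [dbar_const]

end SliceMonogenic

namespace SliceMonogenic

open Complex (I)
open scoped Real ComplexConjugate

/-! ### Neighbourhoods with polygonal boundary -/

/-- The closed squares of a grid of mesh `δ`. -/
def cell (δ : ℝ) (p : ℤ × ℤ) : Set ℂ :=
  Icc (p.1 * δ) ((p.1 + 1) * δ) ×ℂ Icc (p.2 * δ) ((p.2 + 1) * δ)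

/-- The index of the neighbour of a square beyond its side `d` (right, top, left, bottom). -/
def nbr : Fin 4 → ℤ × ℤ := ![(1, 0), (0, 1), (-1, 0), (0, -1)]

/-- The initial point of the side `d`, in units of the mesh, relative to the lower left corner. -/
def sideStart : Fin 4 → ℂ := ![1, 1 + I, I, 0]

/-- The direction of the side `d` in the positive orientation. -/
def sideDir : Fin 4 → ℂ := ![I, -1, -I, 1]

/-- The side `d` of the square `p`, positively oriented. -/
noncomputable def side (δ : ℝ) (p : ℤ × ℤ) (d : Fin 4) (t : ℝ) : ℂ :=
  δ * (p.1 + p.2 * I + sideStart d) + t * (δ * sideDir d)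

theorem mem_cell {δ : ℝ} {p : ℤ × ℤ} {z : ℂ} : z ∈ cell δ p ↔
    (p.1 * δ ≤ z.re ∧ z.re ≤ (p.1 + 1) * δ) ∧ (p.2 * δ ≤ z.im ∧ z.im ≤ (p.2 + 1) * δ) :=
  Iff.rfl

theorem isClosed_cell (δ : ℝ) (p : ℤ × ℤ) : IsClosed (cell δ p) :=
  isClosed_Icc.reProdIm isClosed_Icc

theorem cell_eq_closure {δ : ℝ} (hδ : 0 < δ) (p : ℤ × ℤ) :
    cell δ p = closure (Ioo (p.1 * δ) ((p.1 + 1) * δ) ×ℂ Ioo (p.2 * δ) ((p.2 + 1) * δ)) := by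
  rw [Complex.closure_reProdIm, closure_Ioo (by nlinarith), closure_Ioo (by nlinarith), cell]

/-- Describing sides as intersections of neighbouring squares makes the frontier of a union of
squares a purely combinatorial matter. -/
theorem mem_side_iff {δ : ℝ} (hδ : 0 < δ) (p : ℤ × ℤ) (d : Fin 4) (z : ℂ) :
    z ∈ side δ p d '' Icc 0 1 ↔ z ∈ cell δ p ∧ z ∈ cell δ (p + nbr d) := by
  obtain ⟨a, b⟩ := p
  constructor
  · rintro ⟨t, ⟨h0, h1⟩, rfl⟩
    rw [mem_cell, mem_cell]
    fin_cases d <;> simp [side, nbr, sideStart, sideDir] <;> (refine ⟨⟨⟨?_, ?_⟩, ⟨?_, ?_⟩⟩, ⟨⟨?_, ?_⟩, ⟨?_, ?_⟩⟩⟩ <;> nlinarith)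
  · rintro ⟨h1, h2⟩
    rw [mem_cell] at h1 h2
    obtain ⟨⟨h3, h4⟩, ⟨h5, h6⟩⟩ := h1
    obtain ⟨⟨h7, h8⟩, ⟨h9, h10⟩⟩ := h2
    have key : ∀ x : ℝ, 0 ≤ x → x ≤ δ → x / δ ∈ Icc (0 : ℝ) 1 := fun x h h' =>
      ⟨div_nonneg h hδ.le, (div_le_one hδ).mpr h'⟩
    fin_cases d <;> simp [nbr] at h3 h4 h5 h6 h7 h8 h9 h10
    · refine ⟨(z.im - b * δ) / δ, key _ (by linarith) (by linarith), ?_⟩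
      apply Complex.ext
      · simp [side, sideStart, sideDir]
        linarith
      · simp [side, sideStart, sideDir]
        field_simp
        ring
    · refine ⟨((a + 1) * δ - z.re) / δ, key _ (by linarith) (by linarith), ?_⟩
      apply Complex.ext
      · simp [side, sideStart, sideDir]
        field_simp
        ring
      · simp [side, sideStart, sideDir]
        linarith
    · refine ⟨((b + 1) * δ - z.im) / δ, key _ (by linarith) (by linarith), ?_⟩
      apply Complex.ext
      · simp [side, sideStart, sideDir]
        linarith
      · simp [side, sideStart, sideDir]
        field_simp
        ring
    · refine ⟨(z.re - a * δ) / δ, key _ (by linarith) (by linarith), ?_⟩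
      apply Complex.ext
      · simp [side, sideStart, sideDir]
        field_simp
        ring
      · simp [side, sideStart, sideDir]
        linarith

/-- In `Fin 4` the side opposite to d is d + 2. Neighbouring squares traverse their common side in
opposite directions, which is why interior sides cancel. -/
theorem side_add_nbr (δ : ℝ) (p : ℤ × ℤ) (d : Fin 4) (t : ℝ) :
    side δ (p + nbr d) (d + 2) t = side δ p d (1 - t) := by
  obtain ⟨a, b⟩ := p
  fin_cases d <;> simp [side, nbr, sideStart, sideDir] <;> ring

theorem nbr_add_two (d : Fin 4) : nbr d + nbr (d + 2) = 0 := by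
  fin_cases d <;> rfl

theorem nbr_ne_zero (d : Fin 4) : nbr d ≠ 0 := by
  fin_cases d <;> decide

theorem deriv_side (δ : ℝ) (p : ℤ × ℤ) (d : Fin 4) (t : ℝ) :
    deriv (side δ p d) t = δ * sideDir d := by
  have h : HasDerivAt (side δ p d) (1 * (δ * sideDir d)) t :=
    ((Complex.ofRealCLM.hasDerivAt (x := t)).mul_const ((δ : ℂ) * sideDir d)).const_add _
  rw [h.deriv, one_mul]

/-- The integral of `1 / (ζ - z)` along a side. -/
noncomputable def sideIntegral (δ : ℝ) (z : ℂ) (p : ℤ × ℤ) (d : Fin 4) : ℂ :=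
  ∫ t in (0 : ℝ)..1, (side δ p d t - z)⁻¹ * (δ * sideDir d)

theorem sideDir_add_two (d : Fin 4) : sideDir (d + 2) = -sideDir d := by
  fin_cases d <;> simp [sideDir]

theorem sideIntegral_add_nbr (δ : ℝ) (z : ℂ) (p : ℤ × ℤ) (d : Fin 4) :
    sideIntegral δ z (p + nbr d) (d + 2) = -sideIntegral δ z p d := by
  simp only [sideIntegral, side_add_nbr, sideDir_add_two]
  rw [intervalIntegral.integral_comp_sub_left (fun t => (side δ p d t - z)⁻¹ * (δ * -sideDir d)) 1]
  simp only [sub_self, sub_zero, mul_neg, intervalIntegral.integral_neg]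

/-- The principal logarithm is a primitive along a segment that avoids its slit. The companion for
the negated segment uses the branch slit along the positive axis. -/
theorem integral_inv_mul_eq_log {P v : ℂ} (h : ∀ t ∈ Icc (0 : ℝ) 1, P + t * v ∈ Complex.slitPlane) :
    ∫ t in (0 : ℝ)..1, (P + t * v)⁻¹ * v = Complex.log (P + v) - Complex.log P := by
  have h1 : ∀ t ∈ uIcc (0 : ℝ) 1,
      HasDerivAt (fun t : ℝ => Complex.log (P + t * v)) ((P + t * v)⁻¹ * v) t := by
    intro t ht
    rw [uIcc_of_le zero_le_one] at ht
    have h2 : HasDerivAt (fun t : ℝ => P + t * v) v t := by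
      simpa using ((Complex.ofRealCLM.hasDerivAt (x := t)).mul_const v).const_add P
    have := h2.clog_real (h t ht)
    rwa [div_eq_inv_mul] at this
  rw [intervalIntegral.integral_eq_sub_of_hasDerivAt h1]
  · simp
  · refine ContinuousOn.intervalIntegrable fun t ht => ?_
    rw [uIcc_of_le zero_le_one] at ht
    have : P + t * v ≠ 0 := Complex.slitPlane_ne_zero (h t ht)
    have h2 : ContinuousAt (fun t : ℝ => P + t * v) t := by fun_prop
    exact ((h2.inv₀ this).mul continuousAt_const).continuousWithinAt

theorem integral_inv_mul_eq_log_neg {P v : ℂ}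
    (h : ∀ t ∈ Icc (0 : ℝ) 1, -(P + t * v) ∈ Complex.slitPlane) :
    ∫ t in (0 : ℝ)..1, (P + t * v)⁻¹ * v = Complex.log (-(P + v)) - Complex.log (-P) := by
  have h1 := integral_inv_mul_eq_log (P := -P) (v := -v) fun t ht => by
    convert! h t ht using 1
    ring
  rw [neg_add, ← h1]
  refine intervalIntegral.integral_congr fun t _ => ?_
  have : -P + (t : ℂ) * -v = -(P + t * v) := by ring
  simp only [this]
  rw [inv_neg, neg_mul_neg]

theorem sideStart_add_one (d : Fin 4) : sideStart (d + 1) = sideStart d + sideDir d := by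
  fin_cases d <;> simp [sideStart, sideDir]

/-- The initial point of the side `d` of the square `p`. -/
noncomputable def vertex (δ : ℝ) (p : ℤ × ℤ) (d : Fin 4) : ℂ :=
  δ * (p.1 + p.2 * I + sideStart d)

theorem vertex_add_one (δ : ℝ) (p : ℤ × ℤ) (d : Fin 4) :
    vertex δ p (d + 1) = vertex δ p d + δ * sideDir d := by
  rw [vertex, vertex, sideStart_add_one]
  ring

theorem side_sub (δ : ℝ) (z : ℂ) (p : ℤ × ℤ) (d : Fin 4) (t : ℝ) :
    side δ p d t - z = vertex δ p d - z + t * (δ * sideDir d) := by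
  rw [side, vertex]
  ring

theorem sideIntegral_eq_log {δ : ℝ} {z : ℂ} {p : ℤ × ℤ} {d : Fin 4}
    (h : ∀ t ∈ Icc (0 : ℝ) 1, side δ p d t - z ∈ Complex.slitPlane) :
    sideIntegral δ z p d =
      Complex.log (vertex δ p (d + 1) - z) - Complex.log (vertex δ p d - z) := by
  simp only [side_sub] at h
  simp only [sideIntegral, side_sub]
  rw [integral_inv_mul_eq_log h, vertex_add_one, add_sub_right_comm]

theorem sideIntegral_eq_log_neg {δ : ℝ} {z : ℂ} {p : ℤ × ℤ} {d : Fin 4}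
    (h : ∀ t ∈ Icc (0 : ℝ) 1, -(side δ p d t - z) ∈ Complex.slitPlane) :
    sideIntegral δ z p d =
      Complex.log (-(vertex δ p (d + 1) - z)) - Complex.log (-(vertex δ p d - z)) := by
  simp only [side_sub] at h
  simp only [sideIntegral, side_sub]
  rw [integral_inv_mul_eq_log_neg h, vertex_add_one, add_sub_right_comm]

theorem side_mem_cell {δ : ℝ} (hδ : 0 < δ) (p : ℤ × ℤ) (d : Fin 4) {t : ℝ}
    (ht : t ∈ Icc (0 : ℝ) 1) : side δ p d t ∈ cell δ p :=
  ((mem_side_iff hδ p d _).mp (mem_image_of_mem _ ht)).1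

/-- Seen from z the square lies in an open half-plane (right, left, upper or lower), so one branch
of the logarithm serves all four sides and the sum telescopes. -/
theorem sum_sideIntegral_of_notMem {δ : ℝ} (hδ : 0 < δ) {z : ℂ} {p : ℤ × ℤ} (hz : z ∉ cell δ p) :
    ∑ d, sideIntegral δ z p d = 0 := by
  have h1 : (∀ d, ∀ t ∈ Icc (0 : ℝ) 1, side δ p d t - z ∈ Complex.slitPlane) →
      ∑ d, sideIntegral δ z p d = 0 := by
    intro h
    simp only [sideIntegral_eq_log (h _), Fin.sum_univ_four]
    simp
  have h2 : (∀ d, ∀ t ∈ Icc (0 : ℝ) 1, -(side δ p d t - z) ∈ Complex.slitPlane) →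
      ∑ d, sideIntegral δ z p d = 0 := by
    intro h
    simp only [sideIntegral_eq_log_neg (h _), Fin.sum_univ_four, ]
    simp
  rw [mem_cell] at hz
  by_cases hx1 : p.1 * δ ≤ z.re
  · by_cases hx2 : z.re ≤ (p.1 + 1) * δ
    · by_cases hy1 : p.2 * δ ≤ z.im
      · have hy2 : ¬ z.im ≤ (p.2 + 1) * δ := fun h => hz ⟨⟨hx1, hx2⟩, hy1, h⟩
        refine h2 fun d t ht => Complex.mem_slitPlane_iff.mpr (Or.inr ?_)
        have h3 := (mem_cell.mp (side_mem_cell hδ p d ht)).2.2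
        rw [Complex.neg_im, Complex.sub_im]
        linarith
      · refine h1 fun d t ht => Complex.mem_slitPlane_iff.mpr (Or.inr ?_)
        have h3 := (mem_cell.mp (side_mem_cell hδ p d ht)).2.1
        rw [Complex.sub_im]
        linarith
    · refine h2 fun d t ht => Complex.mem_slitPlane_iff.mpr (Or.inl ?_)
      have h3 := (mem_cell.mp (side_mem_cell hδ p d ht)).1.2
      rw [Complex.neg_re, Complex.sub_re]
      linarith
  · refine h1 fun d t ht => Complex.mem_slitPlane_iff.mpr (Or.inl ?_)
    have h3 := (mem_cell.mp (side_mem_cell hδ p d ht)).1.1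
    rw [Complex.sub_re]
    linarith

/-- The principal logarithm works on the right, top and bottom sides. The left side crosses the slit
and needs the other branch; the two branches differ by πi at each of its end points, with signs that
add up to 2πi. -/
theorem sum_sideIntegral_of_mem {δ : ℝ} {z : ℂ} {p : ℤ × ℤ}
    (hx : z.re ∈ Ioo (p.1 * δ) ((p.1 + 1) * δ)) (hy : z.im ∈ Ioo (p.2 * δ) ((p.2 + 1) * δ)) :
    ∑ d, sideIntegral δ z p d = 2 * π * I := by
  obtain ⟨hx1, hx2⟩ := hx
  obtain ⟨hy1, hy2⟩ := hy
  have h0 := sideIntegral_eq_log (δ := δ) (z := z) (p := p) (d := 0) fun t _ =>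
    Complex.mem_slitPlane_iff.mpr (Or.inl (by
      simp [side, sideStart, sideDir]
      linarith))
  have h1 := sideIntegral_eq_log (δ := δ) (z := z) (p := p) (d := 1) fun t _ =>
    Complex.mem_slitPlane_iff.mpr (Or.inr (by
      simp [side, sideStart, sideDir]
      linarith))
  have h2 := sideIntegral_eq_log_neg (δ := δ) (z := z) (p := p) (d := 2) fun t _ =>
    Complex.mem_slitPlane_iff.mpr (Or.inl (by
      simp [side, sideStart, sideDir]
      linarith))
  have h3 := sideIntegral_eq_log (δ := δ) (z := z) (p := p) (d := 3) fun t _ =>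
    Complex.mem_slitPlane_iff.mpr (Or.inr (by
      simp [side, sideStart, sideDir]
      linarith))
  have h4 : 0 < (vertex δ p 2 - z).im := by
    simp [vertex, sideStart]
    linarith
  have h5 : (vertex δ p 3 - z).im < 0 := by
    simp [vertex, sideStart]
    linarith
  have hlog1 : Complex.log (-(vertex δ p 2 - z)) = Complex.log (vertex δ p 2 - z) - π * I := by
    rw [Complex.log, Complex.log, norm_neg, Complex.arg_neg_eq_arg_sub_pi_of_im_pos h4]
    push_cast
    ring
  have hlog2 : Complex.log (-(vertex δ p 3 - z)) = Complex.log (vertex δ p 3 - z) + π * I := by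
    rw [Complex.log, Complex.log, norm_neg, Complex.arg_neg_eq_arg_add_pi_of_im_neg h5]
    push_cast
    ring
  rw [Fin.sum_univ_four, h0, h1, h2, h3]
  simp only [show (0 : Fin 4) + 1 = 1 from rfl, show (1 : Fin 4) + 1 = 2 from rfl,
    show (2 : Fin 4) + 1 = 3 from rfl, show (3 : Fin 4) + 1 = 0 from rfl]
  rw [hlog1, hlog2]
  ring

end SliceMonogenic

/-! ### Winding numbers of the boundary of a union of grid squares -/

namespace SliceMonogenic

open Complex (I)
open scoped Real ComplexConjugate

/-- Dominated convergence. Continuity carries winding numbers from points off the grid lines to the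
points on them. -/
theorem continuousAt_sideIntegral {δ : ℝ} {p : ℤ × ℤ} {d : Fin 4} {z : ℂ}
    (hz : z ∉ side δ p d '' Icc 0 1) : ContinuousAt (fun w => sideIntegral δ w p d) z := by
  have hc : Continuous (side δ p d) := by
    unfold side
    fun_prop
  obtain ⟨ε, hε, hball⟩ := Metric.isOpen_iff.mp
    (isCompact_Icc.image hc).isClosed.isOpen_compl z hz
  refine intervalIntegral.continuousAt_of_dominated_interval
    (bound := fun _ => (ε / 2)⁻¹ * ‖(δ : ℂ) * sideDir d‖) ?_ ?_ (by simp) ?_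
  · refine Eventually.of_forall fun w => Measurable.aestronglyMeasurable ?_
    exact ((hc.measurable.sub_const w).inv).mul_const _
  · filter_upwards [Metric.ball_mem_nhds z (half_pos hε)] with w hw
    refine Eventually.of_forall fun t ht => ?_
    rw [uIoc_of_le zero_le_one] at ht
    rw [norm_mul, norm_inv]
    gcongr
    by_contra h
    rw [not_le] at h
    refine hball (a := side δ p d t) ?_ (mem_image_of_mem _ (Ioc_subset_Icc_self ht))
    rw [mem_ball_iff_norm] at hw ⊢
    calc ‖side δ p d t - z‖ ≤ ‖side δ p d t - w‖ + ‖w - z‖ := norm_sub_le_norm_sub_add_norm_sub _ _ _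
      _ < ε := by linarith
  · refine Eventually.of_forall fun t ht => ?_
    rw [uIoc_of_le zero_le_one] at ht
    have : side δ p d t - z ≠ 0 := fun h =>
      hz ⟨t, Ioc_subset_Icc_self ht, sub_eq_zero.mp h⟩
    exact (ContinuousAt.inv₀ (by fun_prop) this).mul continuousAt_const

theorem exists_mem_cell {δ : ℝ} (hδ : 0 < δ) (z : ℂ) : ∃ p, z ∈ cell δ p := by
  refine ⟨(⌊z.re / δ⌋, ⌊z.im / δ⌋), mem_cell.mpr ⟨⟨?_, ?_⟩, ?_, ?_⟩⟩
  · exact (le_div_iff₀ hδ).mp (Int.floor_le _)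
  · exact (div_le_iff₀ hδ).mp (Int.lt_floor_add_one _).le
  · exact (le_div_iff₀ hδ).mp (Int.floor_le _)
  · exact (div_le_iff₀ hδ).mp (Int.lt_floor_add_one _).le

/-- The grid intervals are locally finite: the floor and ceiling of x/δ bound a neighbourhood of x
that meets only intervals containing x. -/
theorem eventually_mem_Icc_int {δ : ℝ} (hδ : 0 < δ) (x : ℝ) :
    ∀ᶠ y in 𝓝 x, ∀ a : ℤ, y ∈ Icc (a * δ) ((a + 1) * δ) → x ∈ Icc (a * δ) ((a + 1) * δ) := by
  have h1 : x < (⌊x / δ⌋ + 1) * δ := (div_lt_iff₀ hδ).mp (Int.lt_floor_add_one _)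
  have h2 : (⌈x / δ⌉ - 1) * δ < x := by
    have := Int.ceil_lt_add_one (x / δ)
    rw [← lt_div_iff₀ hδ]
    linarith
  filter_upwards [eventually_lt_nhds h1, eventually_gt_nhds h2] with y hy1 hy2 a ⟨h3, h4⟩
  constructor
  · have h5 : (a : ℝ) < ⌊x / δ⌋ + 1 := lt_of_mul_lt_mul_right (h3.trans_lt hy1) hδ.le
    have h6 : a ≤ ⌊x / δ⌋ := by
      have : a < ⌊x / δ⌋ + 1 := by exact_mod_cast h5
      omega
    exact (le_div_iff₀ hδ).mp (Int.le_floor.mp h6)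
  · have h5 : (⌈x / δ⌉ : ℝ) - 1 < a + 1 := lt_of_mul_lt_mul_right (hy2.trans_le h4) hδ.le
    have h6 : ⌈x / δ⌉ ≤ a + 1 := by
      have : ⌈x / δ⌉ - 1 < a + 1 := by exact_mod_cast h5
      omega
    have := Int.ceil_le.mp h6
    push_cast at this
    exact (div_le_iff₀ hδ).mp this

theorem eventually_mem_cell {δ : ℝ} (hδ : 0 < δ) (z : ℂ) :
    ∀ᶠ w in 𝓝 z, ∀ p, w ∈ cell δ p → z ∈ cell δ p := by
  filter_upwards [Complex.continuous_re.continuousAt.eventually (eventually_mem_Icc_int hδ z.re),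
    Complex.continuous_im.continuousAt.eventually (eventually_mem_Icc_int hδ z.im)] with w h1 h2 p hp
  exact ⟨h1 _ hp.1, h2 _ hp.2⟩

/-- The interior of the union of the squares in `S`. -/
def gridRegion (δ : ℝ) (S : Finset (ℤ × ℤ)) : Set ℂ := {z | ∀ p, z ∈ cell δ p → p ∈ S}

theorem isOpen_gridRegion {δ : ℝ} (hδ : 0 < δ) (S : Finset (ℤ × ℤ)) :
    IsOpen (gridRegion δ S) := by
  rw [isOpen_iff_eventually]
  intro z hz
  filter_upwards [eventually_mem_cell hδ z] with w hw p hp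
  exact hz p (hw p hp)

theorem closure_gridRegion_subset {δ : ℝ} (hδ : 0 < δ) (S : Finset (ℤ × ℤ)) :
    closure (gridRegion δ S) ⊆ ⋃ p ∈ S, cell δ p := by
  refine closure_minimal (fun z hz => ?_) (S.finite_toSet.isClosed_biUnion fun p _ => isClosed_cell δ p)
  obtain ⟨p, hp⟩ := exists_mem_cell hδ z
  exact mem_biUnion (hz p hp) hp

theorem eq_of_mem_Ioo_of_mem_Icc {δ : ℝ} (hδ : 0 < δ) {x : ℝ} {a b : ℤ}
    (ha : x ∈ Ioo (a * δ) ((a + 1) * δ)) (hb : x ∈ Icc (b * δ) ((b + 1) * δ)) : b = a := by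
  have h1 : (b : ℝ) < a + 1 := lt_of_mul_lt_mul_right (hb.1.trans_lt ha.2) hδ.le
  have h2 : (a : ℝ) < b + 1 := lt_of_mul_lt_mul_right (ha.1.trans_le hb.2) hδ.le
  have h3 : b < a + 1 := by exact_mod_cast h1
  have h4 : a < b + 1 := by exact_mod_cast h2
  omega

theorem cell_subset_closure_gridRegion {δ : ℝ} (hδ : 0 < δ) {S : Finset (ℤ × ℤ)} {p : ℤ × ℤ}
    (hp : p ∈ S) : cell δ p ⊆ closure (gridRegion δ S) := by
  rw [cell_eq_closure hδ]
  refine closure_mono fun z hz q hq => ?_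
  have : q = p := Prod.ext (eq_of_mem_Ioo_of_mem_Icc hδ hz.1 hq.1)
    (eq_of_mem_Ioo_of_mem_Icc hδ hz.2 hq.2)
  rwa [this]

/-- The sides of the squares in `S` that do not separate two squares in `S`. -/
def boundarySides (S : Finset (ℤ × ℤ)) : Finset ((ℤ × ℤ) × Fin 4) :=
  (S ×ˢ Finset.univ).filter fun q => q.1 + nbr q.2 ∉ S

theorem mem_boundarySides {S : Finset (ℤ × ℤ)} {q : (ℤ × ℤ) × Fin 4} :
    q ∈ boundarySides S ↔ q.1 ∈ S ∧ q.1 + nbr q.2 ∉ S := by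
  simp [boundarySides]

theorem eq_or_eq_of_mem_Icc {δ : ℝ} (hδ : 0 < δ) {x : ℝ} {a b : ℤ}
    (ha : x ∈ Icc (a * δ) ((a + 1) * δ)) (hb : x ∈ Icc (b * δ) ((b + 1) * δ)) :
    b = a ∨ b = a + 1 ∨ b = a + -1 := by
  have h1 : (b : ℝ) ≤ a + 1 := le_of_mul_le_mul_right (hb.1.trans ha.2) hδ
  have h2 : (a : ℝ) ≤ b + 1 := le_of_mul_le_mul_right (ha.1.trans hb.2) hδ
  have h3 : b ≤ a + 1 := by exact_mod_cast h1
  have h4 : a ≤ b + 1 := by exact_mod_cast h2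
  omega

/-- The squares may touch only at a corner, so one passes from p to p' by changing one index at a
time. The intermediate square also contains z, and one of the two moves leaves S. -/
theorem exists_boundarySide {δ : ℝ} (hδ : 0 < δ) {S : Finset (ℤ × ℤ)} {z : ℂ} {p p' : ℤ × ℤ}
    (hp : p ∈ S) (hp' : p' ∉ S) (hz : z ∈ cell δ p) (hz' : z ∈ cell δ p') :
    ∃ q ∈ boundarySides S, z ∈ side δ q.1 q.2 '' Icc 0 1 := by
  have hq : z ∈ cell δ (p'.1, p.2) := ⟨hz'.1, hz.2⟩
  have step : ∀ r r' : ℤ × ℤ, r ∈ S → r' ∉ S → z ∈ cell δ r → z ∈ cell δ r' →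
      (∃ d, r' = r + nbr d) → ∃ q ∈ boundarySides S, z ∈ side δ q.1 q.2 '' Icc 0 1 := by
    rintro r r' h1 h2 h3 h4 ⟨d, rfl⟩
    exact ⟨(r, d), mem_boundarySides.mpr ⟨h1, h2⟩, (mem_side_iff hδ r d z).mpr ⟨h3, h4⟩⟩
  by_cases h : (p'.1, p.2) ∈ S
  · refine step (p'.1, p.2) p' h hp' hq hz' ?_
    rcases eq_or_eq_of_mem_Icc hδ hz.2 hz'.2 with h1 | h1 | h1
    · exact absurd h (by rwa [← h1])
    · exact ⟨1, Prod.ext (by simp [nbr]) (by simp [nbr, h1])⟩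
    · exact ⟨3, Prod.ext (by simp [nbr]) (by simp [nbr, h1])⟩
  · refine step p (p'.1, p.2) hp h hz hq ?_
    rcases eq_or_eq_of_mem_Icc hδ hz.1 hz'.1 with h1 | h1 | h1
    · exact absurd hp (by rwa [h1] at h)
    · exact ⟨0, Prod.ext (by simp [nbr, h1]) (by simp [nbr])⟩
    · exact ⟨2, Prod.ext (by simp [nbr, h1]) (by simp [nbr])⟩

theorem frontier_gridRegion {δ : ℝ} (hδ : 0 < δ) (S : Finset (ℤ × ℤ)) :
    frontier (gridRegion δ S) = ⋃ q ∈ boundarySides S, side δ q.1 q.2 '' Icc 0 1 := by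
  rw [(isOpen_gridRegion hδ S).frontier_eq]
  ext z
  constructor
  · rintro ⟨h1, h2⟩
    obtain ⟨p, hp, hz⟩ := mem_iUnion₂.mp (closure_gridRegion_subset hδ S h1)
    obtain ⟨p', hz', hp'⟩ : ∃ p', z ∈ cell δ p' ∧ p' ∉ S := by
      simpa [gridRegion] using h2
    obtain ⟨q, hq, hzq⟩ := exists_boundarySide hδ hp hp' hz hz'
    exact mem_biUnion hq hzq
  · intro h
    obtain ⟨q, hq, hz⟩ := mem_iUnion₂.mp h
    rw [mem_side_iff hδ] at hz
    rw [mem_boundarySides] at hq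
    exact ⟨cell_subset_closure_gridRegion hδ hq.1 hz.1, fun h => hq.2 (h _ hz.2)⟩

/-- Each side between two squares of S occurs twice with opposite orientation, so the contributions
cancel under the involution that passes to the neighbour. -/
theorem sum_boundarySides (δ : ℝ) (S : Finset (ℤ × ℤ)) (z : ℂ) :
    ∑ q ∈ boundarySides S, sideIntegral δ z q.1 q.2 = ∑ p ∈ S, ∑ d, sideIntegral δ z p d := by
  rw [← Finset.sum_product', boundarySides,
    ← Finset.sum_filter_add_sum_filter_not (S ×ˢ Finset.univ) (fun q => q.1 + nbr q.2 ∉ S),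
    left_eq_add]
  have h2 : ∀ d : Fin 4, d + 2 + 2 = d := by decide
  refine Finset.sum_involution (fun q _ => (q.1 + nbr q.2, q.2 + 2)) ?_ ?_ ?_ ?_
  · intro q _
    simp only [sideIntegral_add_nbr]
    ring
  · intro q _ _ h
    exact nbr_ne_zero q.2 (by simpa using congrArg Prod.fst h)
  · intro q hq
    simp only [Finset.mem_filter, Finset.mem_product, Finset.mem_univ, and_true, not_not] at hq ⊢
    exact ⟨hq.2, by rw [add_assoc, nbr_add_two, add_zero]; exact hq.1⟩
  · intro q _
    refine Prod.ext ?_ (h2 _)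
    simp only
    rw [add_assoc, nbr_add_two, add_zero]

theorem dense_off_grid (δ : ℝ) : Dense {z : ℂ | (∀ a : ℤ, z.re ≠ a * δ) ∧ ∀ a : ℤ, z.im ≠ a * δ} := by
  have h1 : Dense (range fun a : ℤ => (a : ℝ) * δ)ᶜ := (countable_range _).dense_compl ℝ
  have h2 : {z : ℂ | (∀ a : ℤ, z.re ≠ a * δ) ∧ ∀ a : ℤ, z.im ≠ a * δ} =
      (range fun a : ℤ => (a : ℝ) * δ)ᶜ ×ℂ (range fun a : ℤ => (a : ℝ) * δ)ᶜ := by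
    ext z
    simp [Complex.mem_reProdIm, eq_comm]
  rw [h2, dense_iff_closure_eq, Complex.closure_reProdIm, h1.closure_eq]
  ext z
  simp [Complex.mem_reProdIm]

theorem sum_boundarySides_off_grid {δ : ℝ} (hδ : 0 < δ) (S : Finset (ℤ × ℤ)) {z : ℂ}
    (hx : ∀ a : ℤ, z.re ≠ a * δ) (hy : ∀ a : ℤ, z.im ≠ a * δ) :
    (z ∈ gridRegion δ S → ∑ q ∈ boundarySides S, sideIntegral δ z q.1 q.2 = 2 * π * I) ∧
    (z ∉ closure (gridRegion δ S) → ∑ q ∈ boundarySides S, sideIntegral δ z q.1 q.2 = 0) := by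
  rw [sum_boundarySides]
  constructor
  · intro hz
    obtain ⟨p, hp⟩ := exists_mem_cell hδ z
    have h1 : z.re ∈ Ioo (p.1 * δ) ((p.1 + 1) * δ) :=
      ⟨lt_of_le_of_ne hp.1.1 (hx _).symm, lt_of_le_of_ne hp.1.2 (by exact_mod_cast hx (p.1 + 1))⟩
    have h2 : z.im ∈ Ioo (p.2 * δ) ((p.2 + 1) * δ) :=
      ⟨lt_of_le_of_ne hp.2.1 (hy _).symm, lt_of_le_of_ne hp.2.2 (by exact_mod_cast hy (p.2 + 1))⟩
    rw [Finset.sum_eq_single_of_mem p (hz p hp), sum_sideIntegral_of_mem h1 h2]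
    intro q _ hq
    refine sum_sideIntegral_of_notMem hδ fun h => hq ?_
    exact Prod.ext (eq_of_mem_Ioo_of_mem_Icc hδ h1 h.1) (eq_of_mem_Ioo_of_mem_Icc hδ h2 h.2)
  · intro hz
    exact Finset.sum_eq_zero fun p hp => sum_sideIntegral_of_notMem hδ fun h =>
      hz (cell_subset_closure_gridRegion hδ hp h)

/-- The sum is continuous off the frontier and constant on the points of a neighbourhood that avoid
the grid lines; these points are dense. -/
theorem sum_boundarySides_eq {δ : ℝ} (hδ : 0 < δ) (S : Finset (ℤ × ℤ)) (z : ℂ) :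
    (z ∈ gridRegion δ S → ∑ q ∈ boundarySides S, sideIntegral δ z q.1 q.2 = 2 * π * I) ∧
    (z ∉ closure (gridRegion δ S) → ∑ q ∈ boundarySides S, sideIntegral δ z q.1 q.2 = 0) := by
  have key : z ∉ frontier (gridRegion δ S) → ∀ (U : Set ℂ) (c : ℂ), U ∈ 𝓝 z →
      (∀ w ∈ U, (∀ a : ℤ, w.re ≠ a * δ) → (∀ a : ℤ, w.im ≠ a * δ) →
        ∑ q ∈ boundarySides S, sideIntegral δ w q.1 q.2 = c) →
      ∑ q ∈ boundarySides S, sideIntegral δ z q.1 q.2 = c := by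
    intro hz U c hU h
    rw [frontier_gridRegion hδ] at hz
    have hcont : ContinuousAt (fun w => ∑ q ∈ boundarySides S, sideIntegral δ w q.1 q.2) z :=
      tendsto_finsetSum _ fun q hq => continuousAt_sideIntegral fun h' => hz (mem_biUnion hq h')
    have hne : (𝓝[{z : ℂ | (∀ a : ℤ, z.re ≠ a * δ) ∧ ∀ a : ℤ, z.im ≠ a * δ}] z).NeBot :=
      mem_closure_iff_nhdsWithin_neBot.mp (dense_off_grid δ z)
    refine tendsto_nhds_unique (hcont.mono_left (nhdsWithin_le_nhds
      (s := {z : ℂ | (∀ a : ℤ, z.re ≠ a * δ) ∧ ∀ a : ℤ, z.im ≠ a * δ}))) ?_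
    refine tendsto_const_nhds.congr' ?_
    filter_upwards [self_mem_nhdsWithin, nhdsWithin_le_nhds hU] with w hw hwU
    exact (h w hwU hw.1 hw.2).symm
  have ho := isOpen_gridRegion hδ S
  constructor
  · intro hz
    refine key ?_ _ _ (ho.mem_nhds hz) fun w hw hx hy =>
      (sum_boundarySides_off_grid hδ S hx hy).1 hw
    rw [ho.frontier_eq]
    exact fun h => h.2 hz
  · intro hz
    refine key (fun h => hz h.1) _ _ (isClosed_closure.isOpen_compl.mem_nhds hz) fun w hw hx hy =>
      (sum_boundarySides_off_grid hδ S hx hy).2 hw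

theorem exists_isOrientedBoundary_gridRegion {δ : ℝ} (hδ : 0 < δ) (S : Finset (ℤ × ℤ)) :
    ∃ (m : ℕ) (γ : Fin m → ℝ → ℂ), IsOrientedBoundary 1 γ (gridRegion δ S) := by
  let e := (boundarySides S).equivFin.symm
  have hsum : ∀ z, ∑ j, ∫ t in (0 : ℝ)..1, deriv (side δ (e j).1.1 (e j).1.2) t /
      (side δ (e j).1.1 (e j).1.2 t - z) = ∑ q ∈ boundarySides S, sideIntegral δ z q.1 q.2 := by
    intro z
    rw [← Finset.sum_coe_sort (boundarySides S), ← e.sum_comp]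
    refine Finset.sum_congr rfl fun j _ => ?_
    simp only [deriv_side, sideIntegral, div_eq_inv_mul]
  refine ⟨_, fun j => side δ (e j).1.1 (e j).1.2, fun j => ?_, ?_, fun z hz => ?_, fun z hz => ?_⟩
  · refine ⟨‖(δ : ℂ) * sideDir (e j).1.2‖₊, LipschitzOnWith.of_dist_le_mul fun x _ y _ => ?_⟩
    have : side δ (e j).1.1 (e j).1.2 x - side δ (e j).1.1 (e j).1.2 y =
        ((x - y : ℝ) : ℂ) * (δ * sideDir (e j).1.2) := by
      simp only [side]
      push_cast
      ring
    rw [dist_eq_norm, this, norm_mul, Complex.norm_real, mul_comm, dist_eq_norm, coe_nnnorm]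
  · rw [frontier_gridRegion hδ]
    ext z
    simp only [mem_iUnion]
    constructor
    · rintro ⟨j, hj⟩
      exact ⟨_, (e j).2, hj⟩
    · rintro ⟨q, hq, hz⟩
      refine ⟨e.symm ⟨q, hq⟩, ?_⟩
      rwa [e.apply_symm_apply]
  · rw [hsum, (sum_boundarySides_eq hδ S z).1 hz]
    simp
  · rw [hsum, (sum_boundarySides_eq hδ S z).2 hz]
    simp

theorem norm_sub_le_of_mem_cell {δ : ℝ} {p : ℤ × ℤ} {z w : ℂ} (hz : z ∈ cell δ p)
    (hw : w ∈ cell δ p) : ‖z - w‖ ≤ 2 * δ := by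
  obtain ⟨⟨h1, h2⟩, h3, h4⟩ := mem_cell.mp hz
  obtain ⟨⟨h5, h6⟩, h7, h8⟩ := mem_cell.mp hw
  refine (Complex.norm_le_abs_re_add_abs_im _).trans ?_
  have h9 : |(z - w).re| ≤ δ := by
    rw [Complex.sub_re, abs_le]
    constructor <;> linarith
  have h10 : |(z - w).im| ≤ δ := by
    rw [Complex.sub_im, abs_le]
    constructor <;> linarith
  linarith

/-- Reflection sends the row [bδ, (b+1)δ] to [-(b+1)δ, -bδ], which has index -b - 1. The grid is
thus invariant under conjugation. -/
theorem star_mem_cell {δ : ℝ} {p : ℤ × ℤ} {z : ℂ} :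
    star z ∈ cell δ p ↔ z ∈ cell δ (p.1, -p.2 - 1) := by
  rw [mem_cell, mem_cell, Complex.star_def, Complex.conj_re, Complex.conj_im]
  push_cast
  constructor <;> rintro ⟨h, h1, h2⟩ <;> exact ⟨h, by linarith, by linarith⟩

theorem finite_cell_inter {δ : ℝ} (hδ : 0 < δ) {K : Set ℂ} (hK : Bornology.IsBounded K) :
    {p | (cell δ p ∩ K).Nonempty}.Finite := by
  obtain ⟨M, hM⟩ := hK.subset_closedBall 0
  obtain ⟨N, hN⟩ := exists_int_gt (M / δ + 1)
  have hN' : M + δ < N * δ := by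
    have := (mul_lt_mul_iff_left₀ hδ).mpr hN
    rwa [add_mul, div_mul_cancel₀ _ hδ.ne', one_mul] at this
  refine ((finite_Icc (-N) N).prod (finite_Icc (-N) N)).subset ?_
  rintro p ⟨z, hz, hzK⟩
  obtain ⟨⟨h1, h2⟩, h3, h4⟩ := mem_cell.mp hz
  have h5 := hM hzK
  rw [mem_closedBall_zero_iff] at h5
  have h6 := abs_le.mp ((Complex.abs_re_le_norm z).trans h5)
  have h7 := abs_le.mp ((Complex.abs_im_le_norm z).trans h5)
  have key : ∀ (a : ℤ) (x : ℝ), -M ≤ x ∧ x ≤ M → a * δ ≤ x → x ≤ (a + 1) * δ → a ∈ Icc (-N) N := by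
    rintro a x ⟨h1, h2⟩ h3 h4
    have h5 : (a : ℝ) < N := lt_of_mul_lt_mul_right (by linarith) hδ.le
    have h6 : -(N : ℝ) < a := lt_of_mul_lt_mul_right (by linarith) hδ.le
    have h7 : a < N := by exact_mod_cast h5
    have h8 : -N < a := by exact_mod_cast h6
    exact ⟨h8.le, h7.le⟩
  exact ⟨key _ _ h6 h1 h2, key _ _ h7 h3 h4⟩

/-- A compact set has arbitrarily small neighbourhoods with a positively oriented boundary, which
may be chosen invariant under conjugation if the compact set is. -/
theorem exists_isOrientedBoundary {K O : Set ℂ} (hK : IsCompact K) (hO : IsOpen O) (hKO : K ⊆ O)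
    (hs : ∀ z ∈ K, star z ∈ K) :
    ∃ G : Set ℂ, IsOpen G ∧ K ⊆ G ∧ closure G ⊆ O ∧ Bornology.IsBounded G ∧
      (∀ z ∈ G, star z ∈ G) ∧ ∃ (m : ℕ) (γ : Fin m → ℝ → ℂ), IsOrientedBoundary 1 γ G := by
  -- The region is made of the squares of mesh ε/2 that meet K: their diameter is at most 2 · (ε/2),
  -- so they stay in the ε-thickening. A symmetric K selects a symmetric set of squares.
  obtain ⟨ε, hε, hεO⟩ := hK.exists_cthickening_subset_open hO hKO
  have hδ : 0 < ε / 2 := half_pos hε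
  have hfin := finite_cell_inter hδ hK.isBounded
  let S := hfin.toFinset
  have hS : ∀ p, p ∈ S ↔ (cell (ε / 2) p ∩ K).Nonempty := fun p => by
    simp [S]
  have hcl : closure (gridRegion (ε / 2) S) ⊆ Metric.cthickening ε K := by
    refine (closure_gridRegion_subset hδ S).trans (iUnion₂_subset fun p hp z hz => ?_)
    obtain ⟨w, hw, hwK⟩ := (hS p).mp hp
    refine Metric.mem_cthickening_of_dist_le z w ε K hwK ?_
    rw [dist_eq_norm]
    linarith [norm_sub_le_of_mem_cell hz hw]
  refine ⟨gridRegion (ε / 2) S, isOpen_gridRegion hδ S, fun z hz p hp => (hS p).mpr ⟨z, hp, hz⟩,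
    hcl.trans hεO, (hK.isBounded.cthickening).subset (subset_closure.trans hcl), fun z hz p hp => ?_,
    exists_isOrientedBoundary_gridRegion hδ S⟩
  rw [star_mem_cell] at hp
  obtain ⟨w, hw, hwK⟩ := (hS _).mp (hz _ hp)
  refine (hS p).mpr ⟨star w, ?_, hs w hwK⟩
  rwa [star_mem_cell]

end SliceMonogenic

namespace SliceMonogenic

open Complex (I)
open scoped Real ComplexConjugate

/-! ### Holomorphy with respect to a complex structure -/

section Holo

variable {𝔸 : Type*} [NormedRing 𝔸] [NormedAlgebra ℝ 𝔸]

/-- `F` is real differentiable at `z` and `∂_v F = J ∂_u F`. -/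
def LeftHolo (J : 𝔸) (F : ℂ → 𝔸) (z : ℂ) : Prop :=
  ∃ F' : ℂ →L[ℝ] 𝔸, HasFDerivAt F F' z ∧ F' I = J * F' 1

/-- `R` is real differentiable at `z` and `∂_v R = (∂_u R) J`. -/
def RightHolo (J : 𝔸) (R : ℂ → 𝔸) (z : ℂ) : Prop :=
  ∃ R' : ℂ →L[ℝ] 𝔸, HasFDerivAt R R' z ∧ R' I = R' 1 * J

theorem LeftHolo.continuousAt {J : 𝔸} {F : ℂ → 𝔸} {z : ℂ} (h : LeftHolo J F z) :
    ContinuousAt F z := by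
  obtain ⟨F', h, -⟩ := h
  exact h.continuousAt

theorem RightHolo.continuousAt {J : 𝔸} {F : ℂ → 𝔸} {z : ℂ} (h : RightHolo J F z) :
    ContinuousAt F z := by
  obtain ⟨F', h, -⟩ := h
  exact h.continuousAt

theorem clm_apply_eq (L : ℂ →L[ℝ] 𝔸) (w : ℂ) : L w = w.re • L 1 + w.im • L I := by
  conv_lhs => rw [← Complex.re_add_im w]
  rw [map_add, show ((w.re : ℂ)) = w.re • (1 : ℂ) by simp,
    show ((w.im : ℂ) * I) = w.im • I by simp, map_smul, map_smul]

theorem LeftHolo.congr {J : 𝔸} {F G : ℂ → 𝔸} {z : ℂ} (h : LeftHolo J F z) (hG : G =ᶠ[𝓝 z] F) :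
    LeftHolo J G z := by
  obtain ⟨F', h, h'⟩ := h
  exact ⟨F', h.congr_of_eventuallyEq hG, h'⟩

theorem RightHolo.congr {J : 𝔸} {F G : ℂ → 𝔸} {z : ℂ} (h : RightHolo J F z)
    (hG : G =ᶠ[𝓝 z] F) : RightHolo J G z := by
  obtain ⟨F', h, h'⟩ := h
  exact ⟨F', h.congr_of_eventuallyEq hG, h'⟩

/-- By real linearity F'(i) = J F'(1) extends to F'(i w) = J F'(w) for all w, and this survives
composition with a complex linear derivative. -/
theorem LeftHolo.comp {J : 𝔸} (hJ : J * J = -1) {F : ℂ → 𝔸} {g : ℂ → ℂ} {z g' : ℂ}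
    (h : LeftHolo J F (g z)) (hg : HasDerivAt g g' z) : LeftHolo J (fun w => F (g w)) z := by
  obtain ⟨F', h, h'⟩ := h
  have hg' : HasFDerivAt g _ z := hg.hasFDerivAt.restrictScalars ℝ
  refine ⟨_, h.comp z hg', ?_⟩
  simp only [ContinuousLinearMap.comp_apply, ContinuousLinearMap.coe_restrictScalars',
    ContinuousLinearMap.toSpanSingleton_apply, smul_eq_mul, one_mul]
  rw [clm_apply_eq F' (I * g'), clm_apply_eq F' g', h']
  simp only [Complex.I_mul_re, Complex.I_mul_im, mul_add, mul_smul_comm, ← mul_assoc, hJ]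
  simp only [neg_mul, one_mul, neg_smul, smul_neg]
  abel

theorem RightHolo.comp {J : 𝔸} (hJ : J * J = -1) {F : ℂ → 𝔸} {g : ℂ → ℂ} {z g' : ℂ}
    (h : RightHolo J F (g z)) (hg : HasDerivAt g g' z) : RightHolo J (fun w => F (g w)) z := by
  obtain ⟨F', h, h'⟩ := h
  have hg' : HasFDerivAt g _ z := hg.hasFDerivAt.restrictScalars ℝ
  refine ⟨_, h.comp z hg', ?_⟩
  simp only [ContinuousLinearMap.comp_apply, ContinuousLinearMap.coe_restrictScalars',
    ContinuousLinearMap.toSpanSingleton_apply, smul_eq_mul, one_mul]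
  rw [clm_apply_eq F' (I * g'), clm_apply_eq F' g', h']
  simp only [Complex.I_mul_re, Complex.I_mul_im, add_mul, smul_mul_assoc, mul_assoc, hJ]
  simp only [mul_neg, mul_one, neg_smul, smul_neg]
  abel

theorem RightHolo.const_mul {J : 𝔸} {R : ℂ → 𝔸} {z : ℂ} (h : RightHolo J R z) (a : 𝔸) :
    RightHolo J (fun w => a * R w) z := by
  obtain ⟨R', h, h'⟩ := h
  refine ⟨_, h.const_mul a, ?_⟩
  simp [h', mul_assoc]

theorem RightHolo.neg {J : 𝔸} {R : ℂ → 𝔸} {z : ℂ} (h : RightHolo J R z) :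
    RightHolo J (fun w => -R w) z := by
  obtain ⟨R', h, h'⟩ := h
  refine ⟨_, h.neg, ?_⟩
  simp [h']

theorem rightHolo_const {J a : 𝔸} {z : ℂ} : RightHolo J (fun _ => a) z :=
  ⟨0, hasFDerivAt_const _ _, by simp⟩

/-- The complex valued function `h` with `Re (h w) = ℓ(R (Re w + (Im w) J) F)`. -/
noncomputable def pairing (ℓ : 𝔸 →L[ℝ] ℝ) (J : 𝔸) (R F : ℂ → 𝔸) (z : ℂ) : ℂ :=
  (ℓ (R z * F z) : ℂ) - I * (ℓ (R z * J * F z) : ℂ)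

/-- The right structure of R and the left structure of F use the same J and meet in the product: i
∂_u and ∂_v agree because a J coming from either factor lands between R and F. This is the bridge
from operators to scalar holomorphic functions. -/
theorem differentiableAt_pairing {J : 𝔸} (hJ : J * J = -1) (ℓ : 𝔸 →L[ℝ] ℝ) {R F : ℂ → 𝔸} {z : ℂ}
    (hR : RightHolo J R z) (hF : LeftHolo J F z) : DifferentiableAt ℂ (pairing ℓ J R F) z := by
  obtain ⟨R', hR, hR'⟩ := hR
  obtain ⟨F', hF, hF'⟩ := hF
  have h1 := Complex.ofRealCLM.hasFDerivAt.comp z (ℓ.hasFDerivAt.comp z (hR.mul' hF))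
  have h2 := (Complex.ofRealCLM.hasFDerivAt.comp z
    (ℓ.hasFDerivAt.comp z ((hR.mul_const' J).mul' hF))).const_mul I
  have h3 := h1.sub h2
  have h4 : HasFDerivAt (pairing ℓ J R F) _ z := h3
  rw [differentiableAt_complex_iff_differentiableAt_real]
  refine ⟨h4.differentiableAt, ?_⟩
  rw [h4.fderiv]
  simp only [sub_apply, add_apply, smul_apply, ContinuousLinearMap.comp_apply,
    Complex.ofRealCLM_apply, smul_eq_mul, hR', hF', map_add, op_smul_eq_mul]
  have e1 : R z * J * (J * F' 1) = -(R z * F' 1) := by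
    rw [mul_assoc, ← mul_assoc J, hJ, neg_mul, one_mul, mul_neg]
  have e2 : R' 1 * J * J * F z = -(R' 1 * F z) := by
    rw [mul_assoc (R' 1), hJ, mul_neg, mul_one, neg_mul]
  have e3 : R z * (J * F' 1) = R z * J * F' 1 := (mul_assoc _ _ _).symm
  rw [e1, e2, e3, map_neg, map_neg]
  push_cast
  linear_combination (ℓ (R z * J * F' 1) + ℓ (R' 1 * J * F z) : ℂ) * Complex.I_mul_I

/-- The function `(a - b z)⁻¹` for commuting `a`, `b`, where `z = u + i v` acts from the right as
`u + v J`. -/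
noncomputable def resolv (a b J : 𝔸) (z : ℂ) : 𝔸 :=
  Ring.inverse (a * a - (2 * z.re) • (a * b) + (‖z‖ ^ 2) • (b * b)) *
    (a - b * (z.re • 1 - z.im • J))

theorem norm_sq_eq_re_im (z : ℂ) : ‖z‖ ^ 2 = z.re * z.re + z.im * z.im := by
  rw [Complex.sq_norm, Complex.normSq_apply]

/-- J need not commute with a and b, so this is not the holomorphy of an inverse. The polynomial P
to be inverted has coefficients commuting with a and b; with c = a - u b it is c² + v² b², and the
second factor is M = c + v b J. Taking b = 1 gives the resolvent of a bounded operator, a = 1 that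
of the inverse of an unbounded one. -/
theorem rightHolo_resolv [CompleteSpace 𝔸] {a b J : 𝔸} (hab : a * b = b * a) (hJ : J * J = -1)
    {z : ℂ} (hz : IsUnit (a * a - (2 * z.re) • (a * b) + (‖z‖ ^ 2) • (b * b))) :
    RightHolo J (resolv a b J) z := by
  have hre : HasFDerivAt (fun w : ℂ => w.re) Complex.reCLM z := Complex.reCLM.hasFDerivAt
  have him : HasFDerivAt (fun w : ℂ => w.im) Complex.imCLM z := Complex.imCLM.hasFDerivAt
  have hP : HasFDerivAt (fun w : ℂ => a * a - (2 * w.re) • (a * b) +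
      (w.re * w.re + w.im * w.im) • (b * b)) _ z :=
    (((hre.const_mul 2).smul_const (a * b)).const_sub (a * a)).add
      (((hre.mul hre).add (him.mul him)).smul_const (b * b))
  have hM : HasFDerivAt (fun w : ℂ => a - b * (w.re • 1 - w.im • J)) _ z :=
    (((hre.smul_const (1 : 𝔸)).sub (him.smul_const J)).const_mul b).const_sub a
  rw [norm_sq_eq_re_im] at hz
  obtain ⟨x, hx⟩ := hz
  have hinv0 := hasFDerivAt_ringInverse (𝕜 := ℝ) x
  rw [hx] at hinv0
  have hinv := HasFDerivAt.comp (f := fun w : ℂ => a * a - (2 * w.re) • (a * b) +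
    (w.re * w.re + w.im * w.im) • (b * b)) (g := Ring.inverse) z hinv0 hP
  have hR := hinv.mul' hM
  have hfun : resolv a b J = fun w : ℂ => Ring.inverse (a * a - (2 * w.re) • (a * b) +
      (w.re * w.re + w.im * w.im) • (b * b)) * (a - b * (w.re • 1 - w.im • J)) := by
    funext w
    rw [resolv, norm_sq_eq_re_im]
  rw [hfun]
  refine ⟨_, hR, ?_⟩
  rw [Function.comp_apply, ← hx, Ring.inverse_unit]
  set q : 𝔸 := ↑x⁻¹
  set u := z.re
  set v := z.im
  have hPb : b * (x : 𝔸) = x * b := by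
    rw [hx]
    simp only [mul_add, mul_sub, add_mul, sub_mul, mul_smul_comm, smul_mul_assoc]
    rw [← mul_assoc b a a, ← hab, mul_assoc a b a, ← hab, ← mul_assoc b a b, ← hab]
    simp only [mul_assoc]
  have hqb : b * q = q * b := by
    calc b * q = q * (x * b) * q := by simp [q, ← mul_assoc]
      _ = q * (b * x) * q := by rw [hPb]
      _ = q * b := by simp [q, mul_assoc]
  have hPa : a * (x : 𝔸) = x * a := by
    rw [hx]
    simp only [mul_add, mul_sub, add_mul, sub_mul, mul_smul_comm, smul_mul_assoc]
    rw [mul_assoc a b a, ← hab, mul_assoc b b a, ← hab, ← mul_assoc b a b, ← hab, mul_assoc a b b]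
    simp only [mul_assoc]
  have hqa : a * q = q * a := by
    calc a * q = q * (x * a) * q := by simp [q, ← mul_assoc]
      _ = q * (a * x) * q := by rw [hPa]
      _ = q * a := by simp [q, mul_assoc]
  set c : 𝔸 := a - u • b with hc
  have hqc : c * q = q * c := by
    rw [hc, sub_mul, mul_sub, hqa, smul_mul_assoc, mul_smul_comm, hqb]
  have hcb : c * b = b * c := by
    rw [hc, sub_mul, mul_sub, hab, smul_mul_assoc, mul_smul_comm]
  have hx' : (x : 𝔸) = c * c + v • v • (b * b) := by
    rw [hx, hc]
    simp only [mul_sub, sub_mul, mul_smul_comm, smul_mul_assoc, ← hab]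
    module
  have hMc : a - b * (u • 1 - v • J) = c + v • (b * J) := by
    rw [hc, mul_sub, mul_smul_comm, mul_smul_comm, mul_one]
    abel
  have hqx : q * (c * c + v • v • (b * b)) = 1 := by
    rw [← hx']
    simp [q]
  rw [hMc]
  simp only [add_apply, sub_apply, neg_apply, smul_apply, ContinuousLinearMap.comp_apply,
    ContinuousLinearMap.smulRight_apply, Complex.reCLM_apply, Complex.imCLM_apply,
    ContinuousLinearMap.mulLeftRight_apply, op_smul_eq_mul, smul_eq_mul, Complex.one_re,
    Complex.one_im, Complex.I_re, Complex.I_im, zero_smul, one_smul]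
  -- With q = P⁻¹, both partial derivatives of q M contain the left factor q b; after removing it,
  -- ∂_v R = (∂_u R) J is exactly this identity, which comes from q (c² + v² b²) = 1.
  have hE : v • (b * q * (c + v • (b * J))) + c * q * ((c + v • (b * J)) * J) = J := by
    have h1 : (c + v • (b * J)) * J = c * J - v • b := by
      rw [add_mul, smul_mul_assoc, mul_assoc, hJ, mul_neg, mul_one, smul_neg, sub_eq_add_neg]
    rw [h1, hqb, hqc, mul_assoc, mul_assoc, ← mul_smul_comm, ← mul_add]
    have h2 : v • (b * (c + v • (b * J))) + c * (c * J - v • b) =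
        (c * c + v • v • (b * b)) * J := by
      simp only [mul_add, mul_sub, add_mul, mul_smul_comm, smul_mul_assoc, smul_add, ← mul_assoc,
        hcb]
      abel
    rw [h2, ← mul_assoc, hqx, one_mul]
  set M : 𝔸 := c + v • (b * J)
  have e1 : -(((2 : ℝ) * 0) • (a * b)) + (u * 0 + u * 0 + (v * 1 + v * 1)) • (b * b) =
      (2 : ℝ) • (b * (v • b)) := by
    rw [mul_smul_comm]
    module
  have e2 : -(((2 : ℝ) * 1) • (a * b)) + (u * 1 + u * 1 + (v * 0 + v * 0)) • (b * b) =
      -((2 : ℝ) • (b * c)) := by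
    rw [hc, mul_sub, mul_smul_comm, hab]
    module
  have e3 : v • (b * q * M) = J - c * q * (M * J) := eq_sub_of_add_eq hE
  have e4 : q * ((2 : ℝ) • (b * (v • b))) * q * M = (2 : ℝ) • (q * b * (v • (b * q * M))) := by
    simp only [mul_smul_comm, smul_mul_assoc, mul_assoc]
  have e5 : q * (-((2 : ℝ) • (b * c))) * q * M * J = -((2 : ℝ) • (q * b * (c * q * (M * J)))) := by
    simp only [mul_smul_comm, smul_mul_assoc, mul_assoc, mul_neg, neg_mul]
  rw [e1, e2, add_mul, neg_mul, neg_mul, neg_mul, e4, e5, e3]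
  simp only [zero_sub, sub_zero, mul_neg, neg_neg, mul_one, mul_sub, smul_sub, neg_mul, mul_assoc]
  module

end Holo

end SliceMonogenic

namespace SliceMonogenic

open scoped Real ComplexConjugate

/-! ### Paravectors and the complex lines `L_I` -/

section Paravectors

variable {n : ℕ}

instance : FiniteDimensional ℝ (Cl n) :=
  (coords (V := ℝ) (n := n)).symm.toLinearEquiv.finiteDimensional

theorem toCl_add (x y : Para n) : toCl (x + y) = toCl x + toCl y := by
  simp only [toCl, PiLp.add_apply, add_smul, Finset.sum_add_distrib]
  abel

theorem toCl_smul (r : ℝ) (x : Para n) : toCl (r • x) = r • toCl x := by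
  simp only [toCl, PiLp.smul_apply, smul_add, Finset.smul_sum, smul_smul, smul_eq_mul]

theorem ofR_zero_apply (k : ℝ) : (ofR k : Para n) 0 = k := by
  simp [ofR]

theorem ofR_succ_apply (k : ℝ) (j : Fin n) : (ofR k : Para n) j.succ = 0 := by
  simp [ofR]

theorem toCl_ofR (k : ℝ) : toCl (ofR k : Para n) = k • eA ∅ := by
  simp [toCl, ofR_zero_apply, ofR_succ_apply]

theorem ofR_eq_smul (k : ℝ) : (ofR k : Para n) = k • ofR 1 := by
  ext i
  refine Fin.cases ?_ (fun j => ?_) i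
  · simp [ofR_zero_apply]
  · simp [ofR_succ_apply]

theorem norm_sq_para (x : Para n) : ‖x‖ ^ 2 = x 0 ^ 2 + ∑ j : Fin n, x j.succ ^ 2 := by
  rw [EuclideanSpace.norm_sq_eq, Fin.sum_univ_succ]
  simp

theorem sl_zero_apply {I : Para n} (hI : I ∈ unitSphere n) (z : ℂ) : sl I z 0 = z.re := by
  simp [sl, ofR_zero_apply, hI.1]

theorem sl_succ_apply (I : Para n) (z : ℂ) (j : Fin n) : sl I z j.succ = z.im * I j.succ := by
  simp [sl, ofR_succ_apply]

theorem sum_sq_of_mem_unitSphere {I : Para n} (hI : I ∈ unitSphere n) :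
    ∑ j : Fin n, I j.succ ^ 2 = 1 := by
  have := norm_sq_para I
  rw [hI.1, hI.2] at this
  linarith

theorem norm_sl {I : Para n} (hI : I ∈ unitSphere n) (z : ℂ) : ‖sl I z‖ = ‖z‖ := by
  have h : ‖sl I z‖ ^ 2 = ‖z‖ ^ 2 := by
    rw [norm_sq_para, sl_zero_apply hI, norm_sq_eq_re_im]
    simp only [sl_succ_apply, mul_pow, ← Finset.mul_sum, sum_sq_of_mem_unitSphere hI]
    ring
  exact (pow_left_inj₀ (norm_nonneg _) (norm_nonneg _) two_ne_zero).mp h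

theorem sl_add (I : Para n) (z w : ℂ) : sl I (z + w) = sl I z + sl I w := by
  simp only [sl, Complex.add_re, Complex.add_im, add_smul]
  abel

theorem sl_ofReal (I : Para n) (k : ℝ) : sl I (k : ℂ) = ofR k := by
  rw [sl, ofR_eq_smul k]
  simp

theorem sl_zero (I : Para n) : sl I 0 = 0 := by
  simp [sl]

/-- `sl I` as a continuous linear map. -/
noncomputable def slL (I : Para n) : ℂ →L[ℝ] Para n :=
  Complex.reCLM.smulRight (ofR 1) + Complex.imCLM.smulRight I

theorem continuous_sl (I : Para n) : Continuous (sl I) := (slL I).continuous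

theorem paraConj_sl {I : Para n} (hI : I ∈ unitSphere n) (z : ℂ) :
    paraConj (sl I z) = sl I (star z) := by
  rw [paraConj, sl_zero_apply hI, sl, sl]
  simp only [Complex.star_def, Complex.conj_re, Complex.conj_im]
  module

theorem paraInv_sl {I : Para n} (hI : I ∈ unitSphere n) (z : ℂ) :
    paraInv (sl I z) = sl I z⁻¹ := by
  rw [paraInv, paraConj_sl hI, norm_sl hI, sl, sl]
  simp only [Complex.star_def, Complex.conj_re, Complex.conj_im, Complex.inv_re, Complex.inv_im,
    Complex.normSq_eq_norm_sq]
  module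

theorem sl_eq_zero_iff {I : Para n} (hI : I ∈ unitSphere n) {z : ℂ} : sl I z = 0 ↔ z = 0 := by
  rw [← norm_eq_zero, norm_sl hI, norm_eq_zero]

theorem neg_mem_unitSphere {I : Para n} (hI : I ∈ unitSphere n) : -I ∈ unitSphere n :=
  ⟨by simp [hI.1], by simp [hI.2]⟩

theorem sl_neg (I : Para n) (z : ℂ) : sl (-I) z = sl I (star z) := by
  simp [sl]

theorem isCompact_unitSphere : IsCompact (unitSphere n) := by
  have h : unitSphere n = {I : Para n | I 0 = 0} ∩ Metric.sphere 0 1 := by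
    ext I
    simp [unitSphere]
  rw [h]
  exact (isCompact_sphere _ _).inter_left (isClosed_eq (by fun_prop) continuous_const)

theorem exists_mem_unitSphere (hn : 1 ≤ n) : ∃ I, I ∈ unitSphere n := by
  refine ⟨EuclideanSpace.single (Fin.succ ⟨0, hn⟩) 1, ?_, by simp⟩
  simp

theorem exists_sl_eq (hn : 1 ≤ n) (x : Para n) : ∃ I ∈ unitSphere n, ∃ z, sl I z = x := by
  let y : Para n := x - ofR (x 0)
  have hy0 : y 0 = 0 := by simp [y, ofR_zero_apply]
  by_cases hy : y = 0
  · obtain ⟨I, hI⟩ := exists_mem_unitSphere hn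
    exact ⟨I, hI, (x 0 : ℂ), by rw [sl_ofReal, eq_comm, ← sub_eq_zero]; exact hy⟩
  · have hy' : ‖y‖ ≠ 0 := norm_ne_zero_iff.mpr hy
    refine ⟨‖y‖⁻¹ • y, ⟨by simp [hy0], ?_⟩, ⟨x 0, ‖y‖⟩, ?_⟩
    · rw [norm_smul, norm_inv, norm_norm, inv_mul_cancel₀ hy']
    · rw [sl, smul_smul, mul_inv_cancel₀ hy', one_smul, ← ofR_eq_smul]
      simp [y]

end Paravectors

/-! ### Left multiplications and operator-valued contour integrals -/

section Operators

variable {V : Type*} [NormedAddCommGroup V] [NormedSpace ℝ V] {n : ℕ}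

theorem lmul_eA_empty : (lmul (eA ∅) : Vn V n →L[ℝ] Vn V n) = 1 := by
  ext1 v
  rw [lmul_eA, eAct_empty]
  rfl

theorem lmul_mul (a b : Cl n) : (lmul (lmul a b) : Vn V n →L[ℝ] Vn V n) = lmul a * lmul b := by
  ext1 v
  exact lmul_lmul a b v

theorem lmul_toCl (x : Para n) : (lmul (toCl x) : Vn V n →L[ℝ] Vn V n) =
    x 0 • 1 + ∑ j : Fin n, x j.succ • eAct {j} := by
  rw [toCl, lmul_add, lmul_smul, lmul_eA_empty, lmul_sum]
  simp only [lmul_smul, lmul_eA]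

theorem lmul_toCl_mul_self {I : Para n} (hI : I ∈ unitSphere n) :
    (lmul (toCl I) : Vn V n →L[ℝ] Vn V n) * lmul (toCl I) = -1 := by
  ext1 v
  have h := sum_eAct_sq (fun j : Fin n => I j.succ) v
  have h2 : negSumSq n (fun j : Fin n => I j.succ) = -1 := by
    rw [← neg_eq_iff_eq_neg, ← sum_sq_of_mem_unitSphere hI, negSumSq,
      QuadraticMap.weightedSumSquares_apply, ← Finset.sum_neg_distrib]
    refine Finset.sum_congr rfl fun j _ => ?_
    rw [smul_eq_mul]
    ring
  rw [h2] at h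
  rw [lmul_toCl, hI.1, zero_smul, zero_add]
  simpa using h

theorem lmul_toCl_sl (I : Para n) (z : ℂ) : (lmul (toCl (sl I z)) : Vn V n →L[ℝ] Vn V n) =
    z.re • 1 + z.im • lmul (toCl I) := by
  rw [sl, toCl_add, toCl_smul, toCl_smul, toCl_ofR, one_smul, lmul_add, lmul_smul, lmul_smul,
    lmul_eA_empty]

theorem lmul_sl_mul {I : Para n} (hI : I ∈ unitSphere n) (z w : ℂ) :
    (lmul (toCl (sl I (z * w))) : Vn V n →L[ℝ] Vn V n) =
      lmul (toCl (sl I z)) * lmul (toCl (sl I w)) := by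
  simp only [lmul_toCl_sl, Complex.mul_re, Complex.mul_im, add_mul, mul_add, smul_mul_assoc,
    mul_smul_comm, lmul_toCl_mul_self hI, mul_one, one_mul]
  module

theorem lmul_apply_eA_empty (a : Cl n) : lmul a (eA ∅) = a := by
  rw [lmul_apply]
  conv_rhs => rw [cl_eq_sum a]
  refine Finset.sum_congr rfl fun A _ => ?_
  rw [eAct_eA]
  have h : symmDiff A ∅ = A := symmDiff_bot A
  simp [sgn, h]

/-- Left multiplication as a continuous linear map. -/
noncomputable def lmulL (V : Type*) [NormedAddCommGroup V] [NormedSpace ℝ V] (n : ℕ) :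
    Cl n →L[ℝ] Vn V n →L[ℝ] Vn V n :=
  LinearMap.toContinuousLinearMap
    { toFun := lmul
      map_add' := lmul_add
      map_smul' := lmul_smul }

theorem lmulL_apply (a : Cl n) : lmulL V n a = lmul a := rfl

/-- Multiply by I and use I² = -1: this turns the equation ∂_u f + I ∂_v f = 0 into the form ∂_v f =
I ∂_u f used by `LeftHolo`. -/
theorem add_lmul_eq_zero_iff {I : Para n} (hI : I ∈ unitSphere n) (x y : Cl n) :
    x + lmul (toCl I) y = 0 ↔ y = lmul (toCl I) x := by
  have h : ∀ v : Cl n, lmul (toCl I) (lmul (toCl I) v) = -v := fun v => by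
    have := congrArg (fun L : Cl n →L[ℝ] Cl n => L v) (lmul_toCl_mul_self hI (V := ℝ))
    simpa using this
  constructor
  · intro h1
    have h2 := congrArg (lmul (toCl I) : Cl n →L[ℝ] Cl n) h1
    rw [map_add, h, map_zero] at h2
    exact (eq_of_sub_eq_zero (by rwa [sub_eq_add_neg])).symm
  · rintro rfl
    rw [h, add_neg_cancel]

theorem hasFDerivAt_lmul_comp_sl {f : Para n → Cl n} {I : Para n} {z : ℂ}
    (hf : DifferentiableAt ℝ f (sl I z)) :
    HasFDerivAt (fun w => (lmul (f (sl I w)) : Vn V n →L[ℝ] Vn V n))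
      (lmulL V n ∘L fderiv ℝ f (sl I z) ∘L slL I) z := by
  have h1 : HasFDerivAt f (fderiv ℝ f (sl I z)) (slL I z) := hf.hasFDerivAt
  exact (lmulL V n).hasFDerivAt.comp z (h1.comp z (slL I).hasFDerivAt)

theorem slL_one (I : Para n) : slL I 1 = ofR 1 := by simp [slL]

theorem slL_I (I : Para n) : slL I Complex.I = I := by simp [slL]

theorem SMonogenicOn.leftHolo {f : Para n → Cl n} {U : Set (Para n)} (hf : SMonogenicOn f U)
    {I : Para n} (hI : I ∈ unitSphere n) {z : ℂ} (hz : sl I z ∈ U) :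
    LeftHolo (lmul (toCl I)) (fun w => (lmul (f (sl I w)) : Vn V n →L[ℝ] Vn V n)) z := by
  refine ⟨_, hasFDerivAt_lmul_comp_sl (hf.2.1.differentiableAt (hf.1.mem_nhds hz)), ?_⟩
  have h2 := (add_lmul_eq_zero_iff hI _ _).mp (hf.2.2 I hI z hz)
  simp only [ContinuousLinearMap.comp_apply, slL_one, slL_I, lmulL_apply]
  rw [h2, lmul_mul]

/-- The operator identity is brought back to Clifford numbers by evaluation at e_∅ = 1. -/
theorem smonogenicOn_of_leftHolo {f : Para n → Cl n} {U : Set (Para n)} (hU : IsOpen U)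
    (hd : DifferentiableOn ℝ f U) (hf : ∀ I ∈ unitSphere n, ∀ z, sl I z ∈ U →
      LeftHolo (lmul (toCl I)) (fun w => (lmul (f (sl I w)) : Cl n →L[ℝ] Cl n)) z) :
    SMonogenicOn f U := by
  refine ⟨hU, hd, fun I hI z hz => ?_⟩
  rw [add_lmul_eq_zero_iff hI]
  obtain ⟨F', h1, h2⟩ := hf I hI z hz
  have h3 := h1.unique (hasFDerivAt_lmul_comp_sl (V := ℝ)
    (hd.differentiableAt (hU.mem_nhds hz)))
  rw [h3] at h2
  simp only [ContinuousLinearMap.comp_apply, slL_one, slL_I, lmulL_apply] at h2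
  rw [← lmul_mul] at h2
  have := congrArg (fun L : Cl n →L[ℝ] Cl n => L (eA ∅)) h2
  simpa only [lmul_apply_eA_empty] using this

/-- The integrand of a contour integral, in terms of the real and imaginary part of `γ'`. -/
theorem contour_integrand_eq (R F : Vn V n →L[ℝ] Vn V n) (I : Para n) (w : ℂ) :
    R ∘L lmul (toCl (sl I (-Complex.I * w))) ∘L F =
      w.im • (R * F) - w.re • (R * lmul (toCl I) * F) := by
  change R * (lmul (toCl (sl I (-Complex.I * w))) * F) = _
  rw [lmul_toCl_sl]
  simp only [neg_mul,
    Complex.neg_re, Complex.neg_im, Complex.I_mul_re, Complex.I_mul_im, neg_neg, add_mul, mul_add,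
    smul_mul_assoc, mul_smul_comm, one_mul, neg_smul, mul_neg, mul_assoc, sub_eq_add_neg]

theorem intervalIntegrable_contour {R : Para n → Vn V n →L[ℝ] Vn V n}
    {f : Para n → Cl n} {I : Para n} {γ : ℝ → ℂ} {K : NNReal} (hγ : LipschitzOnWith K γ (Icc 0 1))
    (hR : ∀ t ∈ Icc (0 : ℝ) 1, ContinuousAt (fun z => R (sl I z)) (γ t))
    (hf : ∀ t ∈ Icc (0 : ℝ) 1,
      ContinuousAt (fun z => (lmul (f (sl I z)) : Vn V n →L[ℝ] Vn V n)) (γ t)) :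
    IntervalIntegrable (fun t => R (sl I (γ t)) ∘L lmul (toCl (sl I (-Complex.I * deriv γ t))) ∘L
      lmul (f (sl I (γ t)))) volume 0 1 := by
  have hRc : ContinuousOn (fun t => R (sl I (γ t))) (Icc 0 1) := fun t ht =>
    ContinuousAt.comp_continuousWithinAt (f := γ) (hR t ht) (hγ.continuousOn t ht)
  have hFc : ContinuousOn (fun t => (lmul (f (sl I (γ t))) : Vn V n →L[ℝ] Vn V n)) (Icc 0 1) :=
    fun t ht => ContinuousAt.comp_continuousWithinAt (f := γ) (hf t ht) (hγ.continuousOn t ht)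
  let G : ℝ → ℂ →L[ℝ] (Vn V n →L[ℝ] Vn V n) := fun t =>
    ContinuousLinearMap.smulRightL ℝ ℂ _ Complex.imCLM (R (sl I (γ t)) * lmul (f (sl I (γ t)))) -
    ContinuousLinearMap.smulRightL ℝ ℂ _ Complex.reCLM
      (R (sl I (γ t)) * lmul (toCl I) * lmul (f (sl I (γ t))))
  have hG : ContinuousOn G (Icc 0 1) :=
    ((ContinuousLinearMap.continuous _).comp_continuousOn (hRc.mul hFc)).sub
      ((ContinuousLinearMap.continuous _).comp_continuousOn ((hRc.mul continuousOn_const).mul hFc))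
  refine (intervalIntegrable_clm_deriv hγ hG).congr fun t _ => ?_
  exact (contour_integrand_eq _ _ _ _).symm

/-- A continuous functional applied to an operator-valued contour integral. -/
theorem apply_contourIntegral (ℓ : (Vn V n →L[ℝ] Vn V n) →L[ℝ] ℝ) [CompleteSpace V]
    {R : Para n → Vn V n →L[ℝ] Vn V n}
    {f : Para n → Cl n} {I : Para n} {m : ℕ} {γ : Fin m → ℝ → ℂ}
    (hγ : ∀ j, ∃ K, LipschitzOnWith K (γ j) (Icc 0 1))
    (hR : ∀ j, ∀ t ∈ Icc (0 : ℝ) 1, ContinuousAt (fun z => R (sl I z)) (γ j t))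
    (hf : ∀ j, ∀ t ∈ Icc (0 : ℝ) 1,
      ContinuousAt (fun z => (lmul (f (sl I z)) : Vn V n →L[ℝ] Vn V n)) (γ j t)) :
    ℓ (contourIntegral R f I γ) = (2 * π)⁻¹ * (arcIntegral γ
      (pairing ℓ (lmul (toCl I)) (fun z => R (sl I z)) (fun z => lmul (f (sl I z))))).im := by
  rw [contourIntegral, map_smul, smul_eq_mul, map_sum, arcIntegral, Complex.im_sum]
  congr 1
  refine Finset.sum_congr rfl fun j _ => ?_
  obtain ⟨K, hK⟩ := hγ j
  have hRc : ContinuousOn (fun t => R (sl I (γ j t))) (Icc 0 1) := fun t ht =>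
    ContinuousAt.comp_continuousWithinAt (f := γ j) (hR j t ht) (hK.continuousOn t ht)
  have hFc : ContinuousOn (fun t => (lmul (f (sl I (γ j t))) : Vn V n →L[ℝ] Vn V n)) (Icc 0 1) :=
    fun t ht => ContinuousAt.comp_continuousWithinAt (f := γ j) (hf j t ht) (hK.continuousOn t ht)
  have hint := intervalIntegrable_contour hK (hR j) (hf j)
  rw [← ℓ.intervalIntegral_comp_comm hint]
  -- The real part of the pairing multiplied by dz would be ℓ(R dz F); the factor -i in ds_I = -ds I
  -- turns it into the imaginary part.
  have him : ∀ t, ℓ (R (sl I (γ j t)) ∘L lmul (toCl (sl I (-Complex.I * deriv (γ j) t))) ∘L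
      lmul (f (sl I (γ j t)))) = Complex.imCLM (pairing ℓ (lmul (toCl I))
      (fun z => R (sl I z)) (fun z => lmul (f (sl I z))) (γ j t) * deriv (γ j) t) := by
    intro t
    rw [contour_integrand_eq]
    simp only [Complex.imCLM_apply, map_sub,
      map_smul, smul_eq_mul, pairing, Complex.mul_im, Complex.sub_im, Complex.sub_re,
      Complex.ofReal_re, Complex.ofReal_im, Complex.mul_re, Complex.I_re, Complex.I_im]
    ring
  simp only [him]
  rw [Complex.imCLM.intervalIntegral_comp_comm]
  · rfl
  · refine intervalIntegrable_mul_deriv hK ?_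
    have hJ : ContinuousOn (fun t => (pairing ℓ (lmul (toCl I))
        (fun z => R (sl I z)) (fun z => lmul (f (sl I z))) (γ j t))) (Icc 0 1) := by
      unfold pairing
      have h1 := ℓ.continuous.comp_continuousOn (hRc.mul hFc)
      have h2 := ℓ.continuous.comp_continuousOn
        ((hRc.mul (continuousOn_const (c := (lmul (toCl I) : Vn V n →L[ℝ] Vn V n)))).mul hFc)
      exact (Complex.continuous_ofReal.comp_continuousOn h1).sub
        (continuousOn_const.mul (Complex.continuous_ofReal.comp_continuousOn h2))
    exact hJ

/-- The contour integral as an area integral. -/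
theorem apply_contourIntegral_eq [CompleteSpace V] (ℓ : (Vn V n →L[ℝ] Vn V n) →L[ℝ] ℝ)
    {R : Para n → Vn V n →L[ℝ] Vn V n} {f : Para n → Cl n} {I : Para n} (hI : I ∈ unitSphere n)
    {w : ℤ} {m : ℕ} {γ : Fin m → ℝ → ℂ} {G Ω C : Set ℂ}
    (hγ : IsContour w γ G) (hΩ : IsOpen Ω) (hC : IsClosed C)
    (hGΩ : closure G ⊆ Ω) (hb : Bornology.IsBounded (G \ C)) {χ : ℂ → ℝ} (hχ : IsCutoff χ C G)
    (hR : ∀ z ∈ Ω \ C, RightHolo (lmul (toCl I)) (fun z => R (sl I z)) z)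
    (hf : ∀ z ∈ Ω \ C,
      LeftHolo (lmul (toCl I)) (fun z => (lmul (f (sl I z)) : Vn V n →L[ℝ] Vn V n)) z) :
    ℓ (contourIntegral R f I γ) = -(π⁻¹ * (∫ z, pairing ℓ (lmul (toCl I)) (fun z => R (sl I z))
      (fun z => lmul (f (sl I z))) z * dbar (fun z => (χ z : ℂ)) z).re) := by
  have htr : ∀ j, ∀ t ∈ Icc (0 : ℝ) 1, γ j t ∈ Ω \ C := by
    refine fun j t ht => ⟨hGΩ (hγ.mem_closure j t ht), fun h => ?_⟩
    have h0 := (hχ.eq_zero _ (hγ.notMem j t ht)).self_of_nhds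
    rw [(hχ.eq_one _ h).self_of_nhds] at h0
    exact one_ne_zero h0
  rw [apply_contourIntegral ℓ hγ.lipschitz (fun j t ht => (hR _ (htr j t ht)).continuousAt)
    (fun j t ht => (hf _ (htr j t ht)).continuousAt),
    hγ.arcIntegral_eq hΩ hC hGΩ hb hχ fun z hz =>
      (differentiableAt_pairing (lmul_toCl_mul_self hI) ℓ (hR z hz) (hf z hz)).differentiableWithinAt]
  generalize ∫ z, pairing ℓ (lmul (toCl I)) (fun z => R (sl I z))
      (fun z => lmul (f (sl I z))) z * dbar (fun z => (χ z : ℂ)) z = X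
  have : π ≠ 0 := Real.pi_ne_zero
  simp only [Complex.neg_im, Complex.mul_im, Complex.mul_re, Complex.re_ofNat, Complex.im_ofNat,
    Complex.I_re, Complex.I_im]
  field_simp
  ring

end Operators

end SliceMonogenic

namespace SliceMonogenic

open scoped Real ComplexConjugate

/-! ### The representation formula -/

section Holo

variable {𝔸 : Type*} [NormedRing 𝔸] [NormedAlgebra ℝ 𝔸]

theorem LeftHolo.const_mul {J J' : 𝔸} {F : ℂ → 𝔸} {z : ℂ} (h : LeftHolo J F z) {a : 𝔸}
    (ha : J' * a = a * J) : LeftHolo J' (fun w => a * F w) z := by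
  obtain ⟨F', h, h'⟩ := h
  refine ⟨_, h.const_mul a, ?_⟩
  simp only [smul_apply, smul_eq_mul, h']
  rw [← mul_assoc, ← mul_assoc, ha]

theorem LeftHolo.sub {J : 𝔸} {F G : ℂ → 𝔸} {z : ℂ} (hF : LeftHolo J F z) (hG : LeftHolo J G z) :
    LeftHolo J (fun w => F w - G w) z := by
  obtain ⟨F', h1, h1'⟩ := hF
  obtain ⟨G', h2, h2'⟩ := hG
  exact ⟨_, h1.sub h2, by simp [h1', h2', mul_sub]⟩

/-- The identity theorem: a function that is holomorphic with respect to `J` on a connected open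
set and vanishes on the real axis is zero. -/
theorem LeftHolo.eq_zero {J : 𝔸} (hJ : J * J = -1) {Ψ : ℂ → 𝔸} {Ω : Set ℂ} (hΩ : IsOpen Ω)
    (hc : IsPreconnected Ω) {u : ℝ} (hu : (u : ℂ) ∈ Ω) (hΨ : ∀ z ∈ Ω, LeftHolo J Ψ z)
    (h0 : ∀ x : ℝ, (x : ℂ) ∈ Ω → Ψ x = 0) {z : ℂ} (hz : z ∈ Ω) : Ψ z = 0 := by
  refine SeparatingDual.eq_zero_of_forall_dual_eq_zero (R := ℝ) fun ℓ => ?_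
  have h1 : DifferentiableOn ℂ (pairing ℓ J (fun _ => 1) Ψ) Ω := fun w hw =>
    (differentiableAt_pairing hJ ℓ rightHolo_const (hΨ w hw)).differentiableWithinAt
  have h2 : ∃ᶠ w in 𝓝[≠] (u : ℂ), pairing ℓ J (fun _ => 1) Ψ w = 0 := by
    have h3 : Tendsto (fun x : ℝ => (x : ℂ)) (𝓝[≠] u) (𝓝[≠] (u : ℂ)) := by
      refine tendsto_nhdsWithin_of_tendsto_nhds_of_eventually_within _
        (Complex.continuous_ofReal.continuousAt.tendsto.mono_left nhdsWithin_le_nhds) ?_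
      filter_upwards [self_mem_nhdsWithin] with x hx
      simpa using hx
    refine h3.frequently (Eventually.frequently ?_)
    have h4 : ∀ᶠ x : ℝ in 𝓝 u, (x : ℂ) ∈ Ω :=
      Complex.continuous_ofReal.continuousAt.eventually (hΩ.mem_nhds hu)
    filter_upwards [nhdsWithin_le_nhds h4] with x hx
    simp [pairing, h0 x hx]
  have h5 := (h1.analyticOnNhd hΩ).eqOn_zero_of_preconnected_of_frequently_eq_zero hc hu h2 hz
  have h6 := congrArg Complex.re h5
  simpa [pairing] using h6

end Holo

variable {n : ℕ}

/-- On the sphere through `sl I z` the function `f` has the form `α + I β`. -/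
def HasRep (f : Para n → Cl n) (z : ℂ) : Prop :=
  ∃ α β : Cl n, ∀ I ∈ unitSphere n, f (sl I z) = α + lmul (toCl I) β

theorem lmul_toCl_neg {V : Type*} [NormedAddCommGroup V] [NormedSpace ℝ V] (x : Para n) :
    (lmul (toCl (-x)) : Vn V n →L[ℝ] Vn V n) = -lmul (toCl x) := by
  rw [← neg_one_smul ℝ x, toCl_smul, lmul_smul, neg_one_smul]

theorem lmul_toCl_lmul_toCl {I : Para n} (hI : I ∈ unitSphere n) (v : Cl n) :
    lmul (toCl I) (lmul (toCl I) v) = -v := by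
  have := congrArg (fun L : Cl n →L[ℝ] Cl n => L v) (lmul_toCl_mul_self hI (V := ℝ))
  simpa using this

/-- The hypothesis is the representation formula 2 f(u+Iv) = (1 - IJ) f(u+Jv) + (1 + IJ) f(u-Jv); it
is affine in I, and α and β are its coefficients. -/
theorem hasRep_of_forall {f : Para n → Cl n} {z : ℂ} {J : Para n}
    (h : ∀ I ∈ unitSphere n, (2 : ℝ) • f (sl I z) =
      f (sl J z) - lmul (toCl I) (lmul (toCl J) (f (sl J z))) +
      (f (sl (-J) z) + lmul (toCl I) (lmul (toCl J) (f (sl (-J) z))))) : HasRep f z := by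
  refine ⟨(2 : ℝ)⁻¹ • (f (sl J z) + f (sl (-J) z)),
    (2 : ℝ)⁻¹ • lmul (toCl J) (f (sl (-J) z) - f (sl J z)), fun I hI => ?_⟩
  have h1 := congrArg (fun x => (2 : ℝ)⁻¹ • x) (h I hI)
  simp only [smul_smul] at h1
  rw [inv_mul_cancel₀ two_ne_zero, one_smul] at h1
  rw [h1, map_smul, map_sub, map_sub]
  module

/-- For n = 1 the sphere 𝕊 consists of J and -J only, so two values always fit. This is why no
s-domains are required in that case. -/
theorem hasRep_of_eq_one (f : Para 1 → Cl 1) (z : ℂ) : HasRep f z := by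
  obtain ⟨J, hJ⟩ := exists_mem_unitSphere (n := 1) le_rfl
  refine hasRep_of_forall (J := J) fun I hI => ?_
  have h1 : I = J ∨ I = -J := by
    have hI1 := sum_sq_of_mem_unitSphere hI
    have hJ1 := sum_sq_of_mem_unitSphere hJ
    simp only [Finset.univ_unique, Fin.default_eq_zero, Fin.isValue, Finset.sum_singleton] at hI1 hJ1
    rcases sq_eq_sq_iff_eq_or_eq_neg.mp (hI1.trans hJ1.symm) with h | h
    · left
      ext i
      fin_cases i
      · exact hI.1.trans hJ.1.symm
      · exact h
    · right
      ext i
      fin_cases i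
      · simpa [hJ.1] using hI.1
      · exact h
  rcases h1 with rfl | rfl
  · rw [lmul_toCl_lmul_toCl hI, lmul_toCl_lmul_toCl hI]
    module
  · rw [lmul_toCl_neg]
    simp only [neg_apply]
    rw [lmul_toCl_lmul_toCl hJ, lmul_toCl_lmul_toCl hJ]
    module

theorem SMonogenicOn.mono {f : Para n → Cl n} {U U' : Set (Para n)} (h : SMonogenicOn f U)
    (hU' : IsOpen U') (hs : U' ⊆ U) : SMonogenicOn f U' :=
  ⟨hU', h.2.1.mono hs, fun I hI z hz => h.2.2 I hI z (hs hz)⟩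

/-- The factors 1 - IJ and 1 + IJ intertwine the structures J and -J with I. Hence the difference of
the two sides of the representation formula is holomorphic along L_I; it vanishes on the real axis,
and the identity theorem applies because D meets the axis and its slice is connected. -/
theorem hasRep_of_isAxialSDomain {f : Para n → Cl n} {D : Set (Para n)} (hf : SMonogenicOn f D)
    (hD : IsAxialSDomain D) {J : Para n} (hJ : J ∈ unitSphere n) {z : ℂ} (hz : sl J z ∈ D) :
    HasRep f z := by
  refine hasRep_of_forall (J := J) fun I hI => ?_
  obtain ⟨hDo, hDs, ⟨u, hu⟩, hDc⟩ := hD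
  let e : Para n → (Cl n →L[ℝ] Cl n) := fun I => lmul (toCl I)
  let F : Para n → ℂ → (Cl n →L[ℝ] Cl n) := fun I w => lmul (f (sl I w))
  have heI : e I * e I = -1 := lmul_toCl_mul_self hI
  have heJ : e J * e J = -1 := lmul_toCl_mul_self hJ
  have hJ' := neg_mem_unitSphere hJ
  have henJ : e (-J) = -e J := lmul_toCl_neg J
  let Ψ : ℂ → (Cl n →L[ℝ] Cl n) := fun w =>
    2 * F I w - (1 - e I * e J) * F J w - (1 + e I * e J) * F (-J) w
  have hΨ : ∀ w ∈ slice I D, LeftHolo (e I) Ψ w := by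
    intro w hw
    have h1 := hf.leftHolo (V := ℝ) hI hw
    have h2 := hf.leftHolo (V := ℝ) hJ (hDs I hI J hJ w hw)
    have h3 := hf.leftHolo (V := ℝ) hJ' (hDs I hI (-J) hJ' w hw)
    refine ((h1.const_mul ?_).sub (h2.const_mul ?_)).sub (h3.const_mul ?_)
    · rw [mul_two, two_mul]
    · change e I * (1 - e I * e J) = (1 - e I * e J) * e J
      rw [mul_sub, sub_mul, ← mul_assoc, heI, mul_assoc (e I), heJ]
      simp only [mul_one, one_mul, neg_mul, mul_neg, sub_neg_eq_add]
      abel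
    · change e I * (1 + e I * e J) = (1 + e I * e J) * e (-J)
      rw [henJ, mul_add, add_mul, ← mul_assoc, heI, mul_neg, mul_neg, mul_assoc (e I), heJ]
      simp only [mul_one, one_mul, neg_mul, mul_neg, neg_neg]
      abel
  have hzero : ∀ x : ℝ, (x : ℂ) ∈ slice I D → Ψ x = 0 := by
    intro x _
    simp only [Ψ, F, sl_ofReal]
    noncomm_ring
  have h0 := LeftHolo.eq_zero heI (hDo.preimage (continuous_sl I)) (hDc I hI).isPreconnected
    (u := u) (by rwa [mem_preimage, sl_ofReal]) hΨ hzero (hDs J hJ I hI z hz)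
  have h1 := congrArg (fun L : Cl n →L[ℝ] Cl n => L (eA ∅)) h0
  simp only [Ψ, F, e, sub_mul, add_mul, two_mul, one_mul, sub_apply, add_apply, mul_apply_eq_comp,
    zero_apply, lmul_apply_eA_empty] at h1
  rw [two_smul]
  rw [sub_sub, sub_eq_zero] at h1
  exact h1

end SliceMonogenic

namespace SliceMonogenic

open scoped Real ComplexConjugate

/-! ### The functional calculus of a bounded operator -/

/-- ∂̄χ vanishes near `C` and near the complement of `G`, so the product is continuous and supported
in the closure of the bounded set `G \ C`. -/
theorem integrable_mul_dbar {G Ω C : Set ℂ} (hΩ : IsOpen Ω) (hC : IsClosed C) (hGΩ : G ⊆ Ω)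
    (hb : Bornology.IsBounded (G \ C)) {χ : ℂ → ℝ} (hχ : IsCutoff χ C G)
    {h : ℂ → ℂ} (hh : ContinuousOn h (Ω \ C)) :
    Integrable fun z => h z * dbar (fun z => (χ z : ℂ)) z := by
  have h1 : ∀ z ∈ C, dbar (fun z => (χ z : ℂ)) =ᶠ[𝓝 z] 0 := by
    intro z hz
    have h2 : (fun z => (χ z : ℂ)) =ᶠ[𝓝 z] fun _ => 1 := by
      filter_upwards [hχ.eq_one z hz] with w hw
      simp [hw]
    filter_upwards [h2.eventually_nhds] with w hw
    rw [dbar_congr hw, dbar_const, Pi.zero_apply]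
  have h2 : ∀ z ∉ G, dbar (fun z => (χ z : ℂ)) =ᶠ[𝓝 z] 0 := by
    intro z hz
    have h2 : (fun z => (χ z : ℂ)) =ᶠ[𝓝 z] fun _ => 0 := by
      filter_upwards [hχ.eq_zero z hz] with w hw
      simp [hw]
    filter_upwards [h2.eventually_nhds] with w hw
    rw [dbar_congr hw, dbar_const, Pi.zero_apply]
  have hd : Continuous (dbar fun z => (χ z : ℂ)) :=
    continuous_dbar (Complex.ofRealCLM.contDiff.comp hχ.contDiff)
  refine Continuous.integrable_of_hasCompactSupport ?_ ?_
  · rw [continuous_iff_continuousAt]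
    intro z
    by_cases hz : z ∈ G \ C
    · exact ((hh.continuousAt ((hΩ.sdiff hC).mem_nhds ⟨hGΩ hz.1, hz.2⟩))).mul hd.continuousAt
    · have h3 : dbar (fun z => (χ z : ℂ)) =ᶠ[𝓝 z] 0 := by
        by_cases hzC : z ∈ C
        · exact h1 z hzC
        · exact h2 z fun h => hz ⟨h, hzC⟩
      refine (continuousAt_const (y := (0 : ℂ))).congr ?_
      filter_upwards [h3] with w hw
      simp [hw]
  · refine HasCompactSupport.intro (K := closure (G \ C)) hb.isCompact_closure fun z hz => ?_
    have hz' : z ∉ G \ C := fun h => hz (subset_closure h)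
    have h3 : dbar (fun z => (χ z : ℂ)) z = 0 := by
      by_cases hzC : z ∈ C
      · exact (h1 z hzC).self_of_nhds
      · exact (h2 z fun h => hz' ⟨h, hzC⟩).self_of_nhds
    rw [h3, mul_zero]

theorem dbar_star {χ : ℂ → ℝ} (hχ : Differentiable ℝ χ) (hs : ∀ z, χ (star z) = χ z) (z : ℂ) :
    dbar (fun z => (χ z : ℂ)) (star z) = star (dbar (fun z => (χ z : ℂ)) z) := by
  have h1 : ∀ z, HasFDerivAt (fun z => (χ z : ℂ)) (Complex.ofRealCLM ∘L fderiv ℝ χ z) z :=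
    fun z => Complex.ofRealCLM.hasFDerivAt.comp z (hχ z).hasFDerivAt
  have h2 : ∀ w, fderiv ℝ χ z w = fderiv ℝ χ (star z) (star w) := by
    intro w
    have h3 : HasFDerivAt (fun z => χ (star z))
        (fderiv ℝ χ (star z) ∘L (Complex.conjCLE : ℂ →L[ℝ] ℂ)) z :=
      (hχ (star z)).hasFDerivAt.comp z Complex.conjCLE.hasFDerivAt
    simp only [hs] at h3
    rw [h3.fderiv]
    rfl
  have h4 := h2 1
  have h5 := h2 Complex.I
  rw [star_one] at h4
  rw [Complex.star_def, Complex.conj_I, map_neg] at h5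
  rw [dbar, dbar, (h1 _).fderiv, (h1 _).fderiv]
  simp only [ContinuousLinearMap.comp_apply, Complex.ofRealCLM_apply, Complex.star_def, map_div₀,
    map_add, map_mul, Complex.conj_ofReal, Complex.conj_I, h4, h5, Complex.conj_ofNat]
  push_cast
  ring

/-- The second term is the first with J replaced by -J: the odd powers of J cancel and J² = -1
removes the even ones. -/
theorem sum_conj_eq {𝔸 : Type*} [Ring 𝔸] [Algebra ℝ 𝔸] {J : 𝔸} (hJ : J * J = -1)
    (c α β : 𝔸) (v x y : ℝ) :
    (c + v • J) * (x • 1 + y • J) * (α + J * β) + (c - v • J) * (x • 1 - y • J) * (α - J * β) =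
      (2 : ℝ) • ((x • c - (v * y) • 1) * α - (y • c + (v * x) • 1) * β) := by
  have h1 : (c + v • J) * (x • 1 + y • J) = (x • c - (v * y) • 1) + (y • c + (v * x) • 1) * J := by
    simp only [mul_add, add_mul, smul_mul_assoc, mul_smul_comm, mul_one, hJ, one_mul]
    module
  have h2 : (c - v • J) * (x • 1 - y • J) = (x • c - (v * y) • 1) - (y • c + (v * x) • 1) * J := by
    simp only [mul_sub, sub_mul, add_mul, smul_mul_assoc, mul_smul_comm, mul_one, hJ, one_mul]
    module
  have h3 : ∀ p q : 𝔸, (p + q * J) * (α + J * β) + (p - q * J) * (α - J * β) =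
      (2 : ℝ) • (p * α - q * β) := by
    intro p q
    have h4 : q * J * (J * β) = -(q * β) := by
      rw [mul_assoc, ← mul_assoc J, hJ, neg_one_mul, mul_neg]
    simp only [mul_add, add_mul, mul_sub, sub_mul, h4]
    module
  rw [h1, h2, h3]

/-- Conjugate points have the same quadratic factor and opposite J in the linear one, so J
disappears from the sum. This is the source of the independence of the complex line. -/
theorem resolv_conj_sum {𝔸 : Type*} [NormedRing 𝔸] [NormedAlgebra ℝ 𝔸] {J : 𝔸} (hJ : J * J = -1)
    (a α β : 𝔸) (z w : ℂ) :
    resolv a 1 J z * (w.re • 1 + w.im • J) * (α + J * β) +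
      resolv a 1 J (star z) * ((star w).re • 1 + (star w).im • J) * (α - J * β) =
    Ring.inverse (a * a - (2 * z.re) • (a * 1) + (‖z‖ ^ 2) • (1 * 1)) *
      ((2 : ℝ) • ((w.re • (a - z.re • 1) - (z.im * w.im) • 1) * α -
        (w.im • (a - z.re • 1) + (z.im * w.re) • 1) * β)) := by
  rw [← sum_conj_eq hJ, resolv, resolv]
  simp only [Complex.star_def, Complex.conj_re, Complex.conj_im, Complex.norm_conj]
  have h4 : a - 1 * (z.re • 1 - z.im • J) = (a - z.re • 1) + z.im • J := by
    rw [one_mul]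
    abel
  have h5 : a - 1 * (z.re • 1 - -z.im • J) = (a - z.re • 1) - z.im • J := by
    rw [one_mul, neg_smul]
    abel
  rw [h4, h5, neg_smul, ← sub_eq_add_neg (w.re • 1)]
  generalize Ring.inverse (a * a - (2 * z.re) • (a * 1) + (‖z‖ ^ 2) • (1 * 1)) = q
  generalize a - z.re • 1 + z.im • J = p
  generalize a - z.re • 1 - z.im • J = p'
  simp only [mul_add q, mul_assoc]

/-- The winding integral tends to 0 as z tends to infinity, so it cannot equal 2πi w with w ≠ 0 at
arbitrarily distant points of G. -/
theorem IsContour.isBounded {w : ℤ} {m : ℕ} {γ : Fin m → ℝ → ℂ} {G : Set ℂ}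
    (hγ : IsContour w γ G) (hw : w ≠ 0) : Bornology.IsBounded G := by
  choose K hK using hγ.lipschitz
  have hc : ∀ j, ∃ M, ∀ t ∈ Icc (0 : ℝ) 1, ‖γ j t‖ ≤ M := fun j => by
    obtain ⟨M, hM⟩ := (isCompact_Icc.image_of_continuousOn
      (hK j).continuousOn).isBounded.exists_norm_le
    exact ⟨M, fun t ht => hM _ (mem_image_of_mem _ ht)⟩
  choose M hM using hc
  have hlim : Tendsto (fun z => arcIntegral γ fun ζ => (ζ - z)⁻¹) (Bornology.cobounded ℂ) (𝓝 0) := by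
    have : (0 : ℂ) = ∑ j : Fin m, 0 := by simp
    rw [this]
    refine tendsto_finsetSum _ fun j _ => ?_
    have h1 : Tendsto (fun z : ℂ => (‖z‖ - M j)⁻¹ * K j * |(1 : ℝ) - 0|) (Bornology.cobounded ℂ)
        (𝓝 0) := by
      have h2 : Tendsto (fun z : ℂ => (‖z‖ - M j)⁻¹) (Bornology.cobounded ℂ) (𝓝 0) :=
        tendsto_inv_atTop_zero.comp (tendsto_atTop_add_const_right _ _ tendsto_norm_cobounded_atTop)
      simpa using h2.mul_const (K j : ℝ)
    refine squeeze_zero_norm' ?_ h1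
    filter_upwards [tendsto_norm_cobounded_atTop.eventually_gt_atTop (M j)] with z hz
    refine intervalIntegral.norm_integral_le_of_norm_le_const_ae ?_
    rw [uIoc_of_le zero_le_one]
    have h3 : ∀ᵐ t : ℝ, t ≠ 1 := by simp [ae_iff]
    filter_upwards [h3] with t ht1 ht
    have ht' : t ∈ Ioo (0 : ℝ) 1 := ⟨ht.1, lt_of_le_of_ne ht.2 ht1⟩
    rw [norm_mul, norm_inv]
    have h4 := hM j t (Ioo_subset_Icc_self ht')
    have h5 : ‖z‖ - M j ≤ ‖γ j t - z‖ := by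
      have := norm_sub_norm_le z (γ j t)
      rw [norm_sub_rev] at this
      linarith
    have h6 : 0 < ‖z‖ - M j := by linarith
    gcongr
    exact norm_deriv_le_of_lipschitzOn_Icc (hK j) ht'
  have hne : (2 * π * Complex.I * w : ℂ) ≠ 0 :=
    mul_ne_zero Complex.two_pi_I_ne_zero (by exact_mod_cast hw)
  have h7 := hlim.eventually_ne hne.symm
  refine Bornology.isBounded_def.mpr (mem_of_superset h7 fun z hz hzG => ?_)
  exact hz (hγ.winding z hzG)

variable {V : Type*} [NormedAddCommGroup V] [NormedSpace ℝ V] {n : ℕ}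

/-- The `S`-spectrum of `A`, read in `ℂ`. -/
def planarSpectrum (A : Vn V n →L[ℝ] Vn V n) : Set ℂ :=
  {z | ¬ IsUnit (A * A - (2 * z.re) • (A * 1) + (‖z‖ ^ 2) • (1 * 1))}

theorem quadB_sl (A : Vn V n →L[ℝ] Vn V n) {I : Para n} (hI : I ∈ unitSphere n) (z : ℂ) :
    quadB A (sl I z) = A * A - (2 * z.re) • (A * 1) + (‖z‖ ^ 2) • (1 * 1) := by
  rw [quadB, sl_zero_apply hI, norm_sl hI, mul_one, mul_one]

/-- `quadB A s` involves only Re s and |s|, so the spectrum is a union of spheres and one planar set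
describes it on all lines. -/
theorem sl_mem_sSpectrumB_iff {A : Vn V n →L[ℝ] Vn V n} {I : Para n} (hI : I ∈ unitSphere n)
    {z : ℂ} : sl I z ∈ sSpectrumB A ↔ z ∈ planarSpectrum A := by
  rw [sSpectrumB, mem_ofPred_eq, quadB_sl A hI, planarSpectrum, mem_ofPred_eq]

theorem star_mem_planarSpectrum {A : Vn V n →L[ℝ] Vn V n} {z : ℂ} (hz : z ∈ planarSpectrum A) :
    star z ∈ planarSpectrum A := by
  rw [planarSpectrum, mem_ofPred_eq, norm_star]
  simpa [planarSpectrum] using hz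

theorem sResolventB_sl (A : Vn V n →L[ℝ] Vn V n) {I : Para n} (hI : I ∈ unitSphere n) (z : ℂ) :
    sResolventB A (sl I z) = -resolv A 1 (lmul (toCl I)) z := by
  rw [sResolventB, quadB_sl A hI, paraConj_sl hI, lmul_toCl_sl, resolv]
  simp only [Complex.star_def, Complex.conj_re, Complex.conj_im, neg_smul, sub_eq_add_neg, one_mul]

theorem lmul_sub (a b : Cl n) : (lmul (a - b) : Vn V n →L[ℝ] Vn V n) = lmul a - lmul b :=
  (lmulL V n).map_sub a b

/-- The part of the area integral for `φ(A)` that comes from conjugate points does not depend on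
the complex line. -/
theorem pairing_add_conj (A : Vn V n →L[ℝ] Vn V n) (ℓ : (Vn V n →L[ℝ] Vn V n) →L[ℝ] ℝ)
    {φ : Para n → Cl n} {z : ℂ} (hφ : HasRep φ z) {I J : Para n} (hI : I ∈ unitSphere n)
    (hJ : J ∈ unitSphere n) (w : ℂ) :
    (pairing ℓ (lmul (toCl I)) (fun z => sResolventB A (sl I z)) (fun z => lmul (φ (sl I z))) z
      * w).re +
    (pairing ℓ (lmul (toCl I)) (fun z => sResolventB A (sl I z)) (fun z => lmul (φ (sl I z)))
      (star z) * star w).re =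
    (pairing ℓ (lmul (toCl J)) (fun z => sResolventB A (sl J z)) (fun z => lmul (φ (sl J z))) z
      * w).re +
    (pairing ℓ (lmul (toCl J)) (fun z => sResolventB A (sl J z)) (fun z => lmul (φ (sl J z)))
      (star z) * star w).re := by
  obtain ⟨α, β, hαβ⟩ := hφ
  have hre : ∀ (K : Para n) (z w : ℂ), (pairing ℓ (lmul (toCl K)) (fun z => sResolventB A (sl K z))
      (fun z => lmul (φ (sl K z))) z * w).re =
      ℓ (sResolventB A (sl K z) * (w.re • 1 + w.im • lmul (toCl K)) * lmul (φ (sl K z))) := by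
    intro K z w
    simp only [pairing, mul_add, add_mul, mul_smul_comm, smul_mul_assoc, mul_one, map_add, map_smul,
      smul_eq_mul, Complex.mul_re, Complex.sub_re, Complex.sub_im, Complex.mul_im, Complex.I_re,
      Complex.I_im, Complex.ofReal_re, Complex.ofReal_im]
    ring
  have key : ∀ K ∈ unitSphere n, (pairing ℓ (lmul (toCl K)) (fun z => sResolventB A (sl K z))
      (fun z => lmul (φ (sl K z))) z * w).re +
      (pairing ℓ (lmul (toCl K)) (fun z => sResolventB A (sl K z)) (fun z => lmul (φ (sl K z)))
      (star z) * star w).re =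
      ℓ (-(Ring.inverse (A * A - (2 * z.re) • (A * 1) + (‖z‖ ^ 2) • (1 * 1)) *
        ((2 : ℝ) • ((w.re • (A - z.re • 1) - (z.im * w.im) • 1) * lmul α -
          (w.im • (A - z.re • 1) + (z.im * w.re) • 1) * lmul β)))) := by
    intro K hK
    have h1 : φ (sl K (star z)) = α - lmul (toCl K) β := by
      rw [← sl_neg, hαβ _ (neg_mem_unitSphere hK), lmul_toCl_neg, neg_apply, sub_eq_add_neg]
    rw [hre, hre, ← map_add, hαβ K hK, h1, lmul_add, lmul_sub, lmul_mul, sResolventB_sl A hK,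
      sResolventB_sl A hK, ← resolv_conj_sum (lmul_toCl_mul_self hK)]
    congr 1
    rw [neg_mul, neg_mul, neg_mul, neg_mul, neg_add]
  rw [key I hI, key J hJ]

variable [CompleteSpace V]

theorem isCompact_planarSpectrum (A : Vn V n →L[ℝ] Vn V n) : IsCompact (planarSpectrum A) := by
  have hcl : IsClosed (planarSpectrum A) := by
    rw [← isOpen_compl_iff]
    have h1 : (planarSpectrum A)ᶜ = (fun z : ℂ => A * A - (2 * z.re) • (A * 1) +
        (‖z‖ ^ 2) • ((1 : Vn V n →L[ℝ] Vn V n) * 1)) ⁻¹' {x | IsUnit x} := by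
      ext z
      simp [planarSpectrum]
    rw [h1]
    exact Units.isOpen.preimage (by fun_prop)
  refine Metric.isCompact_of_isClosed_isBounded hcl ?_
  rw [isBounded_iff_forall_norm_le]
  -- For |z| > 3‖A‖ + 1 one has 2|z|‖A‖ + ‖A‖² < |z|², and the quadratic polynomial divided by |z|²
  -- is inverted by a Neumann series.
  refine ⟨3 * ‖A‖ + 1, fun z hz => ?_⟩
  by_contra! h
  refine hz ?_
  have hA := norm_nonneg A
  have hz0 : 0 < ‖z‖ := by linarith
  have h2 : A * A - (2 * z.re) • (A * 1) + (‖z‖ ^ 2) • ((1 : Vn V n →L[ℝ] Vn V n) * 1) =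
      (‖z‖ ^ 2) • (1 - (‖z‖ ^ 2)⁻¹ • ((2 * z.re) • A - A * A)) := by
    rw [smul_sub, smul_smul, mul_inv_cancel₀ (by positivity), mul_one, mul_one]
    module
  rw [h2]
  have h3 : IsUnit (1 - (‖z‖ ^ 2)⁻¹ • ((2 * z.re) • A - A * A)) := by
    refine isUnit_one_sub_of_norm_lt_one ?_
    rw [norm_smul, norm_inv, norm_pow, norm_norm, inv_mul_lt_iff₀ (by positivity), mul_one]
    calc ‖(2 * z.re) • A - A * A‖ ≤ ‖(2 * z.re) • A‖ + ‖A * A‖ := norm_sub_le _ _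
      _ ≤ 2 * ‖z‖ * ‖A‖ + ‖A‖ * ‖A‖ := by
        rw [norm_smul, norm_mul, Real.norm_eq_abs, Real.norm_eq_abs, abs_two]
        gcongr
        · exact Complex.abs_re_le_norm z
        · exact norm_mul_le _ _
      _ < ‖z‖ ^ 2 := by nlinarith
  exact h3.smul (Units.mk0 (‖z‖ ^ 2) (by positivity))

theorem rightHolo_sResolventB (A : Vn V n →L[ℝ] Vn V n) {I : Para n} (hI : I ∈ unitSphere n)
    {z : ℂ} (hz : z ∉ planarSpectrum A) :
    RightHolo (lmul (toCl I)) (fun w => sResolventB A (sl I w)) z := by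
  simp only [sResolventB_sl A hI]
  exact (rightHolo_resolv (by rw [one_mul, mul_one]) (lmul_toCl_mul_self hI)
    (not_not.mp hz)).neg

end SliceMonogenic

/-! ### Axially symmetric sets, existence of admissible sets, independence of the contour -/

namespace SliceMonogenic

open scoped Real ComplexConjugate

variable {n : ℕ}

/-- The points `u + i v` with `u + 𝕊 v ⊆ U`. -/
def allSlices (U : Set (Para n)) : Set ℂ := {z | ∀ I ∈ unitSphere n, sl I z ∈ U}

/-- A tube lemma: 𝕊 is compact and u + I v depends continuously on all variables. -/
theorem isOpen_allSlices {U : Set (Para n)} (hU : IsOpen U) : IsOpen (allSlices U) := by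
  rw [isOpen_iff_eventually]
  intro z hz
  refine isCompact_unitSphere.eventually_forall_of_forall_eventually fun I hI => ?_
  have hc : Continuous fun p : ℂ × Para n => sl p.2 p.1 := by
    unfold sl
    fun_prop
  exact hc.continuousAt.eventually (hU.mem_nhds (hz I hI))

theorem star_mem_allSlices {U : Set (Para n)} {z : ℂ} (hz : z ∈ allSlices U) :
    star z ∈ allSlices U := by
  intro I hI
  rw [← sl_neg]
  exact hz _ (neg_mem_unitSphere hI)

/-- This extracts the use made of the s-domains: a symmetric open planar set O around the spheres in
σ on which the representation formula holds. For n ≥ 2 it is the union of the planar traces of the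
domains D. -/
theorem LocallySMonogenic.exists_hasRep (hn : 1 ≤ n) {φ : Para n → Cl n} {σ : Set (Para n)}
    (hφ : LocallySMonogenic φ σ) : ∃ (U : Set (Para n)) (O : Set ℂ), SMonogenicOn φ U ∧
      IsOpen O ∧ allSlices σ ⊆ O ∧ (∀ z ∈ O, star z ∈ O) ∧ O ⊆ allSlices U ∧ ∀ z ∈ O, HasRep φ z := by
  obtain ⟨J, hJ⟩ := exists_mem_unitSphere hn
  obtain ⟨U, hU, hσ, hD⟩ := hφ
  rcases hn.eq_or_lt with rfl | hn2
  · exact ⟨U, allSlices U, hU, isOpen_allSlices hU.1, fun z hz I hI => hσ (hz I hI),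
      fun z hz => star_mem_allSlices hz, subset_rfl, fun z _ => hasRep_of_eq_one φ z⟩
  · refine ⟨U, ⋃ D ∈ {D | D ⊆ U ∧ IsAxialSDomain D}, allSlices D, hU,
      isOpen_biUnion fun D hD => isOpen_allSlices hD.2.1, fun z hz => ?_, fun z hz => ?_,
      iUnion₂_subset fun D hD z hz I hI => hD.1 (hz I hI), fun z hz => ?_⟩
    · obtain ⟨D, hDU, hzD, hD⟩ := hD hn2 _ (hz J hJ)
      exact mem_biUnion (show D ∈ {D | D ⊆ U ∧ IsAxialSDomain D} from ⟨hDU, hD⟩)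
        fun I hI => hD.2.1 J hJ I hI z hzD
    · obtain ⟨D, hD, hzD⟩ := mem_iUnion₂.mp hz
      exact mem_biUnion hD (star_mem_allSlices hzD)
    · obtain ⟨D, hD, hzD⟩ := mem_iUnion₂.mp hz
      exact hasRep_of_isAxialSDomain (hU.mono hD.2.1 hD.1) hD.2 hJ (hzD J hJ)

/-- The point `u + i v`, `v ≥ 0`, with `x ∈ u + 𝕊 v`. -/
noncomputable def rad (x : Para n) : ℂ := ⟨x 0, √(∑ j : Fin n, x j.succ ^ 2)⟩

theorem continuous_rad : Continuous (rad : Para n → ℂ) := by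
  have h : (rad : Para n → ℂ) = fun x => (x 0 : ℂ) + (√(∑ j : Fin n, x j.succ ^ 2) : ℝ) * Complex.I := by
    funext x
    rw [← Complex.mk_eq_add_mul_I]
    rfl
  rw [h]
  fun_prop

theorem rad_sl {I : Para n} (hI : I ∈ unitSphere n) (z : ℂ) : rad (sl I z) = ⟨z.re, |z.im|⟩ := by
  rw [rad, sl_zero_apply hI]
  simp only [sl_succ_apply, mul_pow, ← Finset.mul_sum, sum_sq_of_mem_unitSphere hI, mul_one,
    Real.sqrt_sq_eq_abs]

theorem rad_sl_mem_iff {I : Para n} (hI : I ∈ unitSphere n) {G : Set ℂ}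
    (hG : ∀ z ∈ G, star z ∈ G) (z : ℂ) : rad (sl I z) ∈ G ↔ z ∈ G := by
  rw [rad_sl hI]
  rcases abs_cases z.im with ⟨h, -⟩ | ⟨h, -⟩
  · rw [h]
  · have h1 : (⟨z.re, |z.im|⟩ : ℂ) = star z := by
      rw [h]
      rfl
    rw [h1]
    exact ⟨fun h => by simpa using hG _ h, hG z⟩

/-- Rotating a conjugation-invariant planar set about the real axis recovers that set on every L_I;
one planar contour then serves all lines. -/
theorem slice_preimage_rad {I : Para n} (hI : I ∈ unitSphere n) {G : Set ℂ}
    (hG : ∀ z ∈ G, star z ∈ G) : slice I (rad ⁻¹' G) = G :=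
  ext fun z => rad_sl_mem_iff hI hG z

variable {V : Type*} [NormedAddCommGroup V] [NormedSpace ℝ V]

theorem allSlices_sSpectrumB (hn : 1 ≤ n) (A : Vn V n →L[ℝ] Vn V n) :
    allSlices (sSpectrumB A) = planarSpectrum A := by
  obtain ⟨J, hJ⟩ := exists_mem_unitSphere hn
  ext z
  exact ⟨fun h => (sl_mem_sSpectrumB_iff hJ).mp (h J hJ),
    fun h I hI => (sl_mem_sSpectrumB_iff hI).mpr h⟩

/-- There are admissible open sets containing a given compact set of spheres. -/
theorem exists_isAdmissible (hn : 1 ≤ n) (A : Vn V n →L[ℝ] Vn V n) {φ : Para n → Cl n}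
    {U : Set (Para n)} (hφ : SMonogenicOn φ U) {K : Set ℂ} (hK : IsCompact K)
    (hs : ∀ z ∈ K, star z ∈ K) (hAK : planarSpectrum A ⊆ K) (hKU : K ⊆ allSlices U) :
    ∃ G : Set ℂ, IsOpen G ∧ K ⊆ G ∧ closure G ⊆ allSlices U ∧ Bornology.IsBounded G ∧
      (∀ I ∈ unitSphere n, slice I (rad ⁻¹' G) = G) ∧ IsAdmissible A φ (rad ⁻¹' G) := by
  obtain ⟨G, hGo, hKG, hGO, hGb, hGs, m, γ, hγ⟩ :=
    exists_isOrientedBoundary hK (isOpen_allSlices hφ.1) hKU hs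
  have hsl : ∀ I ∈ unitSphere n, slice I (rad ⁻¹' G) = G := fun I hI => slice_preimage_rad hI hGs
  refine ⟨G, hGo, hKG, hGO, hGb, hsl, hGo.preimage continuous_rad, fun x hx => ?_,
    ⟨U, fun x hx => ?_, hφ⟩, fun I hI => ⟨m, γ, by rwa [hsl I hI]⟩⟩
  · obtain ⟨I, hI, z, rfl⟩ := exists_sl_eq hn x
    exact (rad_sl_mem_iff hI hGs z).mpr (hKG (hAK ((sl_mem_sSpectrumB_iff hI).mp hx)))
  · have h1 : rad x ∈ allSlices U :=
      hGO (continuous_rad.closure_preimage_subset G hx)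
    obtain ⟨I, hI, z, rfl⟩ := exists_sl_eq hn x
    exact (rad_sl_mem_iff hI (fun z hz => star_mem_allSlices hz) z).mp h1 I hI

variable [CompleteSpace V]

/-- Both contour integrals become area integrals over ℂ with the same ∂̄χ, although they live on
different lines. Averaging over z and z̄ makes the integrands equal by `pairing_add_conj` where the
representation formula holds; elsewhere ∂̄χ = 0. -/
theorem contourIntegral_eq_of_isAdmissible (hn : 1 ≤ n) {A : Vn V n →L[ℝ] Vn V n}
    {φ : Para n → Cl n} (hφ : LocallySMonogenic φ (sSpectrumB A))
    {U U' : Set (Para n)} (hU : IsAdmissible A φ U) (hU' : IsAdmissible A φ U')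
    {I I' : Para n} (hI : I ∈ unitSphere n) (hI' : I' ∈ unitSphere n) {m m' : ℕ}
    {γ : Fin m → ℝ → ℂ} {γ' : Fin m' → ℝ → ℂ} (hγ : IsOrientedBoundary 1 γ (slice I U))
    (hγ' : IsOrientedBoundary 1 γ' (slice I' U')) :
    contourIntegral (sResolventB A) φ I γ = contourIntegral (sResolventB A) φ I' γ' := by
  obtain ⟨_, O, -, hO, hσO, hOs, -, hrep⟩ := hφ.exists_hasRep hn
  rw [allSlices_sSpectrumB hn] at hσO
  have hsub : ∀ {U : Set (Para n)}, IsAdmissible A φ U → planarSpectrum A ⊆ allSlices U :=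
    fun h z hz J hJ => h.2.1 ((sl_mem_sSpectrumB_iff hJ).mpr hz)
  -- U and U' need not be axially symmetric, so χ is supported where the whole sphere through the
  -- point lies in both of them and where the representation formula holds.
  obtain ⟨χ, hχ, hχs⟩ := exists_isCutoff_conj (isCompact_planarSpectrum A).isClosed
    ((hO.inter (isOpen_allSlices hU.1)).inter (isOpen_allSlices hU'.1))
    (fun z hz => ⟨⟨hσO hz, hsub hU hz⟩, hsub hU' hz⟩)
    (fun z hz => star_mem_planarSpectrum hz)
    (fun z hz => ⟨⟨hOs z hz.1.1, star_mem_allSlices hz.1.2⟩, star_mem_allSlices hz.2⟩)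
  have hd0 : ∀ z ∉ O, dbar (fun z => (χ z : ℂ)) z = 0 := by
    intro z hz
    have h2 : (fun z => (χ z : ℂ)) =ᶠ[𝓝 z] fun _ => 0 := by
      filter_upwards [hχ.eq_zero z fun h => hz h.1.1] with w hw
      simp [hw]
    rw [dbar_congr h2, dbar_const]
  refine (SeparatingDual.eq_iff_forall_dual_eq (R := ℝ)).mpr fun ℓ => ?_
  let X : Para n → ℂ → ℂ := fun J z => pairing ℓ (lmul (toCl J)) (fun z => sResolventB A (sl J z))
    (fun z => lmul (φ (sl J z))) z * dbar (fun z => (χ z : ℂ)) z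
  have main : ∀ {U : Set (Para n)} {J : Para n} {m : ℕ} {γ : Fin m → ℝ → ℂ},
      IsAdmissible A φ U → J ∈ unitSphere n → IsOrientedBoundary 1 γ (slice J U) →
      IsCutoff χ (planarSpectrum A) (slice J U) →
      ℓ (contourIntegral (sResolventB A) φ J γ) = -(π⁻¹ * (∫ z, X J z).re) ∧ Integrable (X J) := by
    intro U J m γ hU hJ hγ hχ
    obtain ⟨U'', hcl, hφU⟩ := hU.2.2.1
    have hG : IsOpen (slice J U) := hU.1.preimage (continuous_sl J)
    have hΩ : IsOpen (slice J U'') := hφU.1.preimage (continuous_sl J)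
    have hGΩ : closure (slice J U) ⊆ slice J U'' :=
      ((continuous_sl J).closure_preimage_subset U).trans (preimage_mono hcl)
    have hγ' := hγ.isContour hG
    have hb : Bornology.IsBounded (slice J U \ planarSpectrum A) :=
      (hγ'.isBounded one_ne_zero).subset sdiff_subset
    have hR : ∀ z ∈ slice J U'' \ planarSpectrum A, RightHolo (lmul (toCl J))
        (fun z => sResolventB A (sl J z)) z := fun z hz => rightHolo_sResolventB A hJ hz.2
    have hF : ∀ z ∈ slice J U'' \ planarSpectrum A, LeftHolo (lmul (toCl J))
        (fun z => (lmul (φ (sl J z)) : Vn V n →L[ℝ] Vn V n)) z := fun z hz => hφU.leftHolo hJ hz.1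
    have hC := (isCompact_planarSpectrum A).isClosed
    refine ⟨apply_contourIntegral_eq ℓ hJ hγ' hΩ hC hGΩ hb hχ hR hF,
      integrable_mul_dbar hΩ hC (subset_closure.trans hGΩ) hb hχ fun z hz => ?_⟩
    exact (differentiableAt_pairing (lmul_toCl_mul_self hJ) ℓ (hR z hz)
      (hF z hz)).continuousAt.continuousWithinAt
  obtain ⟨h1, i1⟩ := main hU hI hγ
    (hχ.mono subset_rfl fun z hz => hz.1.2 I hI)
  obtain ⟨h2, i2⟩ := main hU' hI' hγ'
    (hχ.mono subset_rfl fun z hz => hz.2 I' hI')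
  -- Conjugation preserves area, so the integral may be averaged over z and z̄.
  have hsym : ∀ {J : Para n}, Integrable (X J) →
      2 * (∫ z, X J z).re = ∫ z, ((X J z).re + (X J (star z)).re) := by
    intro J hJ
    have hmp : MeasurePreserving (fun z : ℂ => star z) :=
      Complex.conjLIE.measurePreserving
    have hJ' : Integrable (fun z => X J (star z)) :=
      hmp.integrable_comp_of_integrable hJ
    have h3 : ∫ z, X J (star z) = ∫ z, X J z :=
      hmp.integral_comp Complex.conjLIE.toHomeomorph.measurableEmbedding _
    have h4 : ∀ {Y : ℂ → ℂ}, Integrable Y → ∫ z, (Y z).re = (∫ z, Y z).re := fun hY =>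
      Complex.reCLM.integral_comp_comm hY
    have h5 : ∀ {Y : ℂ → ℂ}, Integrable Y → Integrable fun z => (Y z).re := fun hY =>
      Complex.reCLM.integrable_comp hY
    rw [integral_add (h5 hJ) (h5 hJ'), h4 hJ, h4 hJ', h3]
    ring
  rw [h1, h2]
  congr 2
  refine mul_left_cancel₀ (two_ne_zero' ℝ) ?_
  rw [hsym i1, hsym i2]
  refine integral_congr_ae (Eventually.of_forall fun z => ?_)
  simp only [X, dbar_star (hχ.contDiff.differentiable one_ne_zero) hχs]
  by_cases hz : z ∈ O
  · exact pairing_add_conj A ℓ (hrep z hz) hI hI' _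
  · rw [hd0 z hz]
    simp

end SliceMonogenic

namespace SliceMonogenic

/-! ### The algebra `𝓑_n(V_n)` -/

section RightAction

variable {V : Type*} [NormedAddCommGroup V] [NormedSpace ℝ V] {n : ℕ}

/-- Right multiplication by `e_B`: `(∑_A v_A e_A) e_B = ∑_A v_A e_A e_B`. -/
noncomputable def rAct (B : Finset (Fin n)) : Vn V n →L[ℝ] Vn V n :=
  (coords (V := V) (n := n)).symm.toContinuousLinearMap ∘L
    ContinuousLinearMap.pi (fun C : Finset (Fin n) =>
      sgn (symmDiff C B) B • ContinuousLinearMap.proj (R := ℝ) (symmDiff C B)) ∘L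
    (coords (V := V) (n := n)).toContinuousLinearMap

theorem rAct_apply (B : Finset (Fin n)) (v : Vn V n) (C : Finset (Fin n)) :
    coords (rAct B v) C = sgn (symmDiff C B) B • coords v (symmDiff C B) := by
  simp [rAct]

theorem eAct_rAct (A B : Finset (Fin n)) (v : Vn V n) :
    eAct A (rAct B v) = rAct B (eAct A v) := by
  refine Vn.ext fun C => ?_
  rw [eAct_apply, rAct_apply, rAct_apply, eAct_apply, smul_smul, smul_smul, symmDiff_assoc]
  congr 1
  simp only [sgn_symmDiff_left, sgn_symmDiff_right]
  ring

/-- The element `v e_∅` of `V_n`. -/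
noncomputable def single (n : ℕ) (v : V) : Vn V n := coords.symm (Pi.single ∅ v)

theorem sum_rAct_single (v : Vn V n) : ∑ B, rAct B (single n (coords v B)) = v := by
  refine Vn.ext fun C => ?_
  rw [map_sum, Finset.sum_apply, Finset.sum_eq_single C]
  · simp [rAct_apply, single, sgn]
  · intro B _ hB
    have h : symmDiff C B ≠ (∅ : Finset (Fin n)) := fun h => hB (symmDiff_eq_bot.mp h).symm
    simp [rAct_apply, single, h]
  · simp

theorem sum_eAct_single (v : Vn V n) : ∑ A, eAct A (single n (coords v A)) = v := by
  refine Vn.ext fun C => ?_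
  rw [map_sum, Finset.sum_apply, Finset.sum_eq_single C]
  · simp [eAct_apply, single, sgn]
  · intro B _ hB
    have h : symmDiff B C ≠ (∅ : Finset (Fin n)) := fun h => hB (symmDiff_eq_bot.mp h)
    simp [eAct_apply, single, h]
  · simp

/-- `𝓑_n(V_n)` consists of the right `ℝ_n`-linear bounded operators. -/
theorem mem_boundedOps_iff {R : Vn V n →L[ℝ] Vn V n} :
    R ∈ boundedOps V n ↔ ∀ B v, R (rAct B v) = rAct B (R v) := by
  constructor
  · rintro ⟨R', hR⟩ B v
    rw [hR, hR, map_sum]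
    refine Finset.sum_congr rfl fun A _ => ?_
    rw [← eAct_rAct]
    congr 1
    refine Vn.ext fun C => ?_
    simp [rAct_apply]
  · intro hR
    -- The components are read off from the values of R on the multiples of e_∅; right linearity
    -- determines the rest.
    let R' : Finset (Fin n) → V →L[ℝ] V := fun A =>
      ContinuousLinearMap.proj (R := ℝ) A ∘L (coords (V := V) (n := n)).toContinuousLinearMap ∘L R
        ∘L (coords (V := V) (n := n)).symm.toContinuousLinearMap ∘L
          ContinuousLinearMap.single ℝ (fun _ : Finset (Fin n) => V) ∅
    have hR' : ∀ A x, R' A x = coords (R (single n x)) A := fun A x => rfl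
    refine ⟨R', fun v => ?_⟩
    have h1 : ∀ A, (coords.symm fun B => R' A (coords v B)) =
        ∑ B, rAct B (single n (R' A (coords v B))) := by
      intro A
      rw [← sum_rAct_single (coords.symm fun B => R' A (coords v B))]
      simp
    simp only [h1, map_sum, eAct_rAct]
    rw [Finset.sum_comm]
    simp only [← map_sum, hR', sum_eAct_single]
    conv_lhs => rw [← sum_rAct_single v]
    rw [map_sum]
    exact Finset.sum_congr rfl fun B _ => hR B _

/-- As a centralizer, 𝓑_n(V_n) is a subalgebra closed under inversion, so it contains the resolvents
built from its elements. -/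
theorem boundedOps_eq_centralizer :
    boundedOps V n = Subalgebra.centralizer ℝ (range (rAct : _ → Vn V n →L[ℝ] Vn V n)) := by
  ext R
  rw [mem_boundedOps_iff, SetLike.mem_coe, Subalgebra.mem_centralizer_iff, forall_mem_range]
  exact forall_congr' fun B => ⟨fun h => ContinuousLinearMap.ext fun v => (h v).symm,
    fun h v => (congrArg (fun L : Vn V n →L[ℝ] Vn V n => L v) h).symm⟩

theorem lmul_mem_boundedOps (a : Cl n) : (lmul a : Vn V n →L[ℝ] Vn V n) ∈ boundedOps V n := by
  rw [mem_boundedOps_iff]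
  intro B v
  simp only [lmul_apply, map_sum, map_smul, eAct_rAct]

end RightAction

/-! ### Resolvents of an inverse -/

section Algebra

variable {𝔸 : Type*} [NormedRing 𝔸] [NormedAlgebra ℝ 𝔸]

theorem ringInverse_mem_centralizer {s : Set 𝔸} {a : 𝔸} (ha : a ∈ Subalgebra.centralizer ℝ s) :
    Ring.inverse a ∈ Subalgebra.centralizer ℝ s := by
  rw [Subalgebra.mem_centralizer_iff] at ha ⊢
  intro g hg
  by_cases hu : IsUnit a
  · obtain ⟨u, rfl⟩ := hu
    rw [Ring.inverse_unit]
    exact (Commute.units_inv_right (ha g hg))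
  · rw [Ring.inverse_non_unit _ hu]
    simp

theorem resolv_mem_centralizer {s : Set 𝔸} {a b J : 𝔸} (ha : a ∈ Subalgebra.centralizer ℝ s)
    (hb : b ∈ Subalgebra.centralizer ℝ s) (hJ : J ∈ Subalgebra.centralizer ℝ s) (z : ℂ) :
    resolv a b J z ∈ Subalgebra.centralizer ℝ s :=
  mul_mem (ringInverse_mem_centralizer (add_mem (sub_mem (mul_mem ha ha)
      (Subalgebra.smul_mem _ (mul_mem ha hb) _)) (Subalgebra.smul_mem _ (mul_mem hb hb) _)))
    (sub_mem ha (mul_mem hb (sub_mem (Subalgebra.smul_mem _ (one_mem _) _)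
      (Subalgebra.smul_mem _ hJ _))))

/-- The polynomial `1 - 2 Re[q] A + |q|² A²`. -/
noncomputable def quadPoly (A : 𝔸) (q : ℂ) : 𝔸 :=
  1 * 1 - (2 * q.re) • (1 * A) + (‖q‖ ^ 2) • (A * A)

theorem commute_quadPoly (A : 𝔸) (q : ℂ) : Commute A (quadPoly A q) := by
  simp only [Commute, SemiconjBy, quadPoly, mul_add, mul_sub, add_mul, sub_mul, mul_smul_comm,
    smul_mul_assoc, one_mul, mul_one, mul_assoc]

theorem commute_inverse_quadPoly (A : 𝔸) (q : ℂ) : Commute A (Ring.inverse (quadPoly A q)) := by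
  by_cases hu : IsUnit (quadPoly A q)
  · obtain ⟨u, hu⟩ := hu
    rw [← hu, Ring.inverse_unit]
    exact Commute.units_inv_right (hu ▸ commute_quadPoly A q)
  · rw [Ring.inverse_non_unit _ hu]
    exact Commute.zero_right A

theorem quad_inv_eq (A : 𝔸) {q : ℂ} (hq : q ≠ 0) :
    A * A - (2 * (q⁻¹).re) • (A * 1) + (‖q⁻¹‖ ^ 2) • (1 * 1) = (‖q‖ ^ 2)⁻¹ • quadPoly A q := by
  have h : ‖q‖ ≠ 0 := norm_ne_zero_iff.mpr hq
  rw [quadPoly, Complex.inv_re, Complex.normSq_eq_norm_sq, norm_inv]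
  simp only [mul_one, one_mul]
  match_scalars <;> field_simp

theorem isUnit_quad_inv_iff (A : 𝔸) {q : ℂ} (hq : q ≠ 0) :
    IsUnit (A * A - (2 * (q⁻¹).re) • (A * 1) + (‖q⁻¹‖ ^ 2) • (1 * 1)) ↔
      IsUnit (quadPoly A q) := by
  have h : ‖q‖ ≠ 0 := norm_ne_zero_iff.mpr hq
  rw [quad_inv_eq A hq]
  exact isUnit_smul_iff (Units.mk0 (‖q‖ ^ 2)⁻¹ (by positivity)) (quadPoly A q)

/-- If A commuted with q, this would be -(A - q⁻¹)⁻¹ q⁻² = q⁻¹ + A (1 - A q)⁻¹. It is checked for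
noncommuting J by clearing the quadratic factor on the left. -/
theorem resolv_inv {A J : 𝔸} (hJ : J * J = -1) {q : ℂ} (hq : q ≠ 0)
    (hP : IsUnit (quadPoly A q)) :
    -resolv A 1 J q⁻¹ * ((q⁻¹).re • 1 + (q⁻¹).im • J) * ((q⁻¹).re • 1 + (q⁻¹).im • J) =
      ((q⁻¹).re • 1 + (q⁻¹).im • J) + A * resolv 1 A J q := by
  have h : ‖q‖ ≠ 0 := norm_ne_zero_iff.mpr hq
  have h1 : resolv A 1 J q⁻¹ = (‖q‖ ^ 2) • Ring.inverse (quadPoly A q) *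
      (A - 1 * ((q⁻¹).re • 1 - (q⁻¹).im • J)) := by
    rw [resolv, quad_inv_eq A hq]
    congr 1
    have h2 := (isUnit_smul_iff (Units.mk0 (‖q‖ ^ 2)⁻¹ (by positivity)) (quadPoly A q)).mpr hP
    change IsUnit ((‖q‖ ^ 2)⁻¹ • quadPoly A q) at h2
    refine h2.mul_left_cancel ?_
    rw [Ring.mul_inverse_cancel _ h2, smul_mul_smul_comm, Ring.mul_inverse_cancel _ hP,
      inv_mul_cancel₀ (by positivity), one_smul]
  refine hP.mul_left_cancel ?_
  have h3 : quadPoly A q * (A * resolv 1 A J q) = A * (1 - A * (q.re • 1 - q.im • J)) := by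
    rw [← mul_assoc, ← (commute_quadPoly A q).eq, mul_assoc]
    congr 1
    change quadPoly A q * (Ring.inverse (quadPoly A q) * _) = _
    rw [← mul_assoc, Ring.mul_inverse_cancel _ hP, one_mul]
  have h4 : quadPoly A q * resolv A 1 J q⁻¹ =
      (‖q‖ ^ 2) • (A - 1 * ((q⁻¹).re • 1 - (q⁻¹).im • J)) := by
    rw [h1, ← mul_assoc, mul_smul_comm, Ring.mul_inverse_cancel _ hP, smul_mul_assoc, one_mul]
  rw [mul_add _ _ (A * resolv 1 A J q), h3, ← mul_assoc, ← mul_assoc, mul_neg, h4, quadPoly, Complex.inv_re, Complex.inv_im,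
    Complex.normSq_eq_norm_sq]
  have h5 : ‖q‖ ^ 2 = q.re ^ 2 + q.im ^ 2 := by
    rw [norm_sq_eq_re_im, sq, sq]
  have h6 : q.re ^ 2 + q.im ^ 2 ≠ 0 := by
    rw [← h5]
    positivity
  rw [h5]
  generalize q.re = a at *
  generalize q.im = b at *
  simp only [mul_add, add_mul, mul_sub, sub_mul, smul_mul_assoc, mul_smul_comm, one_mul, mul_one,
    mul_assoc, hJ, smul_add, smul_sub, neg_mul, mul_neg, smul_neg]
  match_scalars <;> field_simp <;> ring

end Algebra

end SliceMonogenic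

namespace SliceMonogenic

/-! ### Unbounded operators with a bounded inverse -/

section Unbounded

variable {V : Type*} [NormedAddCommGroup V] [NormedSpace ℝ V] {n : ℕ}

/-- Working with pairs in the graph avoids the domain proofs chosen in `quad`. -/
theorem exists_domSq_of_mem_graph {T : Vn V n →ₗ.[ℝ] Vn V n} {x y z : Vn V n}
    (hxy : (x, y) ∈ T.graph) (hyz : (y, z) ∈ T.graph) (s : Para n) :
    ∃ v : domSq T, v.1 = x ∧ quad T s v = z - (2 * s 0) • y + (‖s‖ ^ 2) • x := by
  obtain ⟨⟨x', hx⟩, rfl, rfl⟩ := T.mem_graph_iff.mp hxy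
  obtain ⟨⟨y', hy⟩, hy', rfl⟩ := T.mem_graph_iff.mp hyz
  dsimp only at hy'
  subst hy'
  exact ⟨⟨x', hx, hy⟩, rfl, rfl⟩

theorem exists_mem_graph {T : Vn V n →ₗ.[ℝ] Vn V n} (v : domSq T) (s : Para n) :
    ∃ y z, (v.1, y) ∈ T.graph ∧ (y, z) ∈ T.graph ∧
      quad T s v = z - (2 * s 0) • y + (‖s‖ ^ 2) • v.1 :=
  ⟨T ⟨v.1, v.2.choose⟩, T ⟨T ⟨v.1, v.2.choose⟩, v.2.choose_spec⟩, T.mem_graph ⟨v.1, v.2.choose⟩,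
    T.mem_graph ⟨T ⟨v.1, v.2.choose⟩, v.2.choose_spec⟩, rfl⟩

theorem paraConj_ofR (k : ℝ) : paraConj (ofR k : Para n) = ofR k := by
  rw [paraConj, ofR_zero_apply, mul_smul, ← ofR_eq_smul, two_smul, add_sub_cancel_right]

theorem norm_ofR_sq (k : ℝ) : ‖(ofR k : Para n)‖ ^ 2 = k ^ 2 := by
  rw [norm_sq_para]
  simp [ofR_zero_apply, ofR_succ_apply]

theorem mem_graph_sub {T : Vn V n →ₗ.[ℝ] Vn V n} {x y x' y' : Vn V n}
    (h : (x, y) ∈ T.graph) (h' : (x', y') ∈ T.graph) : (x - x', y - y') ∈ T.graph :=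
  T.graph.sub_mem h h'

theorem mem_graph_smul {T : Vn V n →ₗ.[ℝ] Vn V n} {x y : Vn V n}
    (h : (x, y) ∈ T.graph) (r : ℝ) : (r • x, r • y) ∈ T.graph :=
  T.graph.smul_mem r h

/-- `A` is the inverse of `T - k 𝓘`, in terms of the graph of `T`. -/
def GraphInverse (T : Vn V n →ₗ.[ℝ] Vn V n) (k : ℝ) (A : Vn V n →L[ℝ] Vn V n) : Prop :=
  ∀ x y, (x, y) ∈ T.graph ↔ A (y - k • x) = x

/-- At a real point the quadratic polynomial is (T - k)² and R is -(T - k)⁻²(T - k) on 𝓓(T). For v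
in 𝓓(T) let (T - k)² x = (T - k) v; since T - k is injective, (T - k) x = v, and x = -R v.
Closedness of T and density of 𝓓(T) extend this to all v. -/
theorem graphInverse_of_isSResolvent {T : Vn V n →ₗ.[ℝ] Vn V n} (hcl : T.IsClosed)
    (hd : Dense (T.domain : Set (Vn V n))) {k : ℝ} {R : Vn V n →L[ℝ] Vn V n}
    (hR : IsSResolvent T (ofR k) R) : GraphInverse T k (-R) := by
  -- A solution of T u = k u lies in 𝓓(T²) and is annihilated by (T - k)², which is one-to-one.
  have hinj : ∀ u, (u, k • u) ∈ T.graph → u = 0 := by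
    intro u hu
    obtain ⟨v, rfl, hv⟩ := exists_domSq_of_mem_graph hu (mem_graph_smul hu k) (ofR k)
    have h0 : ((0 : Vn V n), (0 : Vn V n)) ∈ T.graph := T.graph.zero_mem
    obtain ⟨v', hv', hv0⟩ := exists_domSq_of_mem_graph h0 h0 (ofR k)
    rw [← hv']
    congr 1
    refine hR.1.1 ?_
    rw [hv, hv0, ofR_zero_apply, norm_ofR_sq]
    module
  have hdom : ∀ v ∈ T.domain, (-R v, k • (-R v) + v) ∈ T.graph := by
    intro v hv
    obtain ⟨x, hx, hRx⟩ := hR.2.2 ⟨v, hv⟩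
    obtain ⟨y, z, hxy, hyz, hq⟩ := exists_mem_graph x (ofR k)
    have hv' := T.mem_graph ⟨v, hv⟩
    rw [hx, paraConj_ofR, toCl_ofR, lmul_smul, lmul_eA_empty, smul_apply,
      one_apply_eq_self, ofR_zero_apply, norm_ofR_sq] at hq
    dsimp only at hRx hq hv'
    have h1 := mem_graph_sub (mem_graph_sub hyz (mem_graph_smul hxy k)) hv'
    have h2 : z - k • y - T ⟨v, hv⟩ = k • (y - k • x.1 - v) := by
      have : T ⟨v, hv⟩ = z - (2 * k) • y + (k ^ 2) • x.1 + k • v := by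
        rw [← hq]
        abel
      rw [this]
      module
    rw [h2] at h1
    have h3 := hinj _ h1
    rw [hRx, neg_neg]
    have h4 : y = k • x.1 + v := by
      rw [sub_sub] at h3
      exact sub_eq_zero.mp h3
    rwa [← h4]
  have hall : ∀ v, (-R v, k • (-R v) + v) ∈ T.graph := by
    have hc : Continuous fun v => (-R v, k • (-R v) + v) := by fun_prop
    intro v
    have h1 : closure (T.domain : Set (Vn V n)) ⊆
        (fun v => (-R v, k • (-R v) + v)) ⁻¹' (T.graph : Set (Vn V n × Vn V n)) :=
      closure_minimal hdom (IsClosed.preimage hc hcl)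
    exact h1 (hd v)
  intro x y
  rw [neg_apply]
  constructor
  · intro h
    have h1 := mem_graph_sub h (hall (y - k • x))
    have h2 : y - (k • (-R (y - k • x)) + (y - k • x)) = k • (x - -R (y - k • x)) := by
      module
    rw [h2] at h1
    exact (sub_eq_zero.mp (hinj _ h1)).symm
  · intro h
    have h1 := hall (y - k • x)
    rwa [h, add_sub_cancel] at h1

theorem GraphInverse.isInverse {T : Vn V n →ₗ.[ℝ] Vn V n} {k : ℝ} {A : Vn V n →L[ℝ] Vn V n}
    (h : GraphInverse T k A) : IsInverse T k A := by
  refine ⟨fun v => ?_, fun x => (h _ _).mp (T.mem_graph x)⟩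
  have h1 : (A v, v + k • A v) ∈ T.graph := (h _ _).mpr (by rw [add_sub_cancel_right])
  obtain ⟨x, hx, hx'⟩ := T.mem_graph_iff.mp h1
  dsimp only at hx hx'
  exact ⟨x, hx, by rw [hx', hx, add_sub_cancel_right]⟩

/-! ### Spectrum and resolvent of `T` in terms of the inverse of `T - k` -/

section GraphInverse

variable {T : Vn V n →ₗ.[ℝ] Vn V n} {k : ℝ} {A : Vn V n →L[ℝ] Vn V n}

theorem GraphInverse.mem_graph (h : GraphInverse T k A) (v : Vn V n) :
    (A v, v + k • A v) ∈ T.graph :=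
  (h _ _).mpr (by rw [add_sub_cancel_right])

theorem GraphInverse.injective (h : GraphInverse T k A) : Function.Injective A := by
  refine (injective_iff_map_eq_zero A).mpr fun y hy => ?_
  have h1 := h.mem_graph y
  rw [hy, smul_zero, add_zero] at h1
  exact T.graph_fst_eq_zero_snd h1 rfl

theorem quadPoly_apply (A : Vn V n →L[ℝ] Vn V n) (q : ℂ) (v : Vn V n) :
    quadPoly A q v = v - (2 * q.re) • A v + (‖q‖ ^ 2) • A (A v) := by
  simp only [quadPoly, mul_one, one_mul]
  rfl

/-- At s = k + q the quadratic polynomial of T is (T - k)² - 2 Re[q] (T - k) + |q|²; applied to A² w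
it gives 1 - 2 Re[q] A + |q|² A² applied to w. -/
theorem GraphInverse.exists_quad_eq (h : GraphInverse T k A) {I : Para n} (hI : I ∈ unitSphere n)
    (q : ℂ) (w : Vn V n) :
    ∃ v : domSq T, v.1 = A (A w) ∧ quad T (sl I (k + q)) v = quadPoly A q w := by
  have h1 := h.mem_graph (A w)
  have h2 : (A w + k • A (A w), (w + k • A w) + k • (A w + k • A (A w))) ∈ T.graph := by
    have := T.graph.add_mem (h.mem_graph w) (mem_graph_smul h1 k)
    exact this
  obtain ⟨v, hv, hv'⟩ := exists_domSq_of_mem_graph h1 h2 (sl I (k + q))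
  refine ⟨v, hv, hv'.trans ?_⟩
  rw [sl_zero_apply hI, norm_sl hI, quadPoly_apply, norm_sq_eq_re_im (k + q), norm_sq_eq_re_im q]
  simp only [Complex.add_re, Complex.add_im, Complex.ofReal_re, Complex.ofReal_im]
  module

theorem GraphInverse.exists_eq (h : GraphInverse T k A) (v : domSq T) : ∃ w, v.1 = A (A w) := by
  obtain ⟨y, z, h1, h2, -⟩ := exists_mem_graph v 0
  have h3 := mem_graph_sub h2 (mem_graph_smul h1 k)
  refine ⟨z - k • y - k • (y - k • v.1), ?_⟩
  rw [(h _ _).mp h3, (h _ _).mp h1]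

/-- A² is a bijection of V_n onto 𝓓(T²), so the unbounded question is transported to a bounded
operator. -/
theorem GraphInverse.bijective_quad_iff (h : GraphInverse T k A) {I : Para n}
    (hI : I ∈ unitSphere n) (q : ℂ) :
    Function.Bijective (quad T (sl I (k + q))) ↔
      Function.Bijective (quadPoly A q : Vn V n →L[ℝ] Vn V n) := by
  choose F hF hF' using h.exists_quad_eq hI q
  have hFb : Function.Bijective F := by
    refine ⟨fun w w' hw => h.injective (h.injective ?_), fun v => ?_⟩
    · rw [← hF, ← hF, hw]
    · obtain ⟨w, hw⟩ := h.exists_eq v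
      exact ⟨w, Subtype.ext ((hF w).trans hw.symm)⟩
  have h1 : ⇑(quadPoly A q : Vn V n →L[ℝ] Vn V n) = quad T (sl I (k + q)) ∘ F := funext fun w => (hF' w).symm
  rw [h1, Function.Bijective.of_comp_iff _ hFb]

theorem IsSResolvent.eq {s : Para n} {R R' : Vn V n →L[ℝ] Vn V n}
    (hd : Dense (T.domain : Set (Vn V n))) (h : IsSResolvent T s R) (h' : IsSResolvent T s R') :
    R = R' := by
  refine ContinuousLinearMap.coeFn_injective
    (Continuous.ext_on hd R.continuous R'.continuous fun v hv => ?_)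
  obtain ⟨x, hx, hRx⟩ := h.2.2 ⟨v, hv⟩
  obtain ⟨x', hx', hRx'⟩ := h'.2.2 ⟨v, hv⟩
  dsimp only at hRx hRx'
  rw [hRx, hRx', h.1.1 (hx.trans hx'.symm)]

theorem sResolvent_eq {s : Para n} {R : Vn V n →L[ℝ] Vn V n}
    (hd : Dense (T.domain : Set (Vn V n))) (h : IsSResolvent T s R) : sResolvent T s = R := by
  have h1 : ∃ R, IsSResolvent T s R := ⟨R, h⟩
  rw [sResolvent, dif_pos h1]
  exact h1.choose_spec.eq hd h

variable [CompleteSpace V]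

/-- For v = A u one has T v - s̄ v = u - q̄ A u. With Q the inverse of `quadPoly A q`, its preimage
under the quadratic polynomial of T is A² Q (u - q̄ A u) = A Q (v - A q̄ v), which is bounded in v.
-/
theorem GraphInverse.isSResolvent (h : GraphInverse T k A) (hA : A ∈ boundedOps V n) {I : Para n}
    (hI : I ∈ unitSphere n) {q : ℂ} (hq : IsUnit (quadPoly A q)) :
    IsSResolvent T (sl I (k + q)) (-(A * resolv 1 A (lmul (toCl I)) q)) := by
  refine ⟨(h.bijective_quad_iff hI q).mpr (ContinuousLinearMap.isUnit_iff_bijective.mp hq), ?_,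
    fun v => ?_⟩
  · have hJ : (lmul (toCl I) : Vn V n →L[ℝ] Vn V n) ∈ boundedOps V n := lmul_mem_boundedOps _
    rw [boundedOps_eq_centralizer] at hA hJ ⊢
    exact neg_mem (mul_mem hA (resolv_mem_centralizer (one_mem _) hA hJ q))
  · obtain ⟨u, hu⟩ : ∃ u, u = T v - k • v.1 := ⟨_, rfl⟩
    have hv : A u = v.1 := by
      rw [hu]
      exact (h _ _).mp (T.mem_graph v)
    have hTv : T v = u + k • A u := by
      rw [hu, ← hu, hv, hu, sub_add_cancel]
    let Q := Ring.inverse (quadPoly A q)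
    let L : Vn V n →L[ℝ] Vn V n := q.re • 1 - q.im • lmul (toCl I)
    have hQ : ∀ w, A (Q w) = Q (A w) := fun w =>
      congrArg (fun B : Vn V n →L[ℝ] Vn V n => B w) (commute_inverse_quadPoly A q).eq
    have hPQ : ∀ w, quadPoly A q (Q w) = w := fun w =>
      congrArg (fun B : Vn V n →L[ℝ] Vn V n => B w) (Ring.mul_inverse_cancel _ hq)
    obtain ⟨x, hx, hx'⟩ := h.exists_quad_eq hI q (Q (u - L (A u)))
    refine ⟨x, ?_, ?_⟩
    · rw [hx', hPQ, hTv, paraConj_sl hI, lmul_toCl_sl, ← hv]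
      simp only [L, star_add, Complex.add_re, Complex.add_im, Complex.star_def, Complex.conj_re,
        Complex.conj_im, Complex.ofReal_re, Complex.ofReal_im, add_apply, sub_apply, smul_apply,
        one_apply_eq_self, neg_zero, zero_add]
      module
    · rw [hx, ← hv]
      change -(A (Q (A u - A (L (A u))))) = _
      rw [← map_sub, ← hQ]

/-- Bijectivity suffices: by the inverse mapping theorem `quadPoly A q` is then a unit, and the
formula for the resolvent supplies the operator in 𝓑_n(V_n). -/
theorem GraphInverse.sl_mem_sResolventSet_iff (h : GraphInverse T k A) (hA : A ∈ boundedOps V n)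
    {I : Para n} (hI : I ∈ unitSphere n) {q : ℂ} :
    sl I (k + q) ∈ sResolventSet T ↔ IsUnit (quadPoly A q) := by
  refine ⟨fun ⟨R, hR⟩ => ?_, fun hq => ⟨_, h.isSResolvent hA hI hq⟩⟩
  exact ContinuousLinearMap.isUnit_iff_bijective.mpr ((h.bijective_quad_iff hI q).mp hR.1)

theorem GraphInverse.sResolvent_eq (h : GraphInverse T k A) (hA : A ∈ boundedOps V n)
    (hd : Dense (T.domain : Set (Vn V n))) {I : Para n} (hI : I ∈ unitSphere n) {q : ℂ}
    (hq : IsUnit (quadPoly A q)) :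
    sResolvent T (sl I (k + q)) = -(A * resolv 1 A (lmul (toCl I)) q) :=
  SliceMonogenic.sResolvent_eq hd (h.isSResolvent hA hI hq)

theorem GraphInverse.isOpen_setOf (A : Vn V n →L[ℝ] Vn V n) :
    IsOpen {q : ℂ | IsUnit (quadPoly A q)} := by
  have hc : Continuous fun q : ℂ => quadPoly A q := by
    unfold quadPoly
    fun_prop
  exact Units.isOpen.preimage hc

theorem GraphInverse.rightHolo_sResolvent (h : GraphInverse T k A) (hA : A ∈ boundedOps V n)
    (hd : Dense (T.domain : Set (Vn V n))) {I : Para n} (hI : I ∈ unitSphere n) {z : ℂ}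
    (hz : sl I z ∈ sResolventSet T) :
    RightHolo (lmul (toCl I)) (fun w => sResolvent T (sl I w)) z := by
  have hz' : IsUnit (quadPoly A (z - k)) := by
    rw [← h.sl_mem_sResolventSet_iff hA hI, add_sub_cancel]
    exact hz
  have h1 : RightHolo (lmul (toCl I)) (fun w : ℂ => resolv 1 A (lmul (toCl I)) (w - k)) z :=
    (rightHolo_resolv (by rw [one_mul, mul_one]) (lmul_toCl_mul_self hI) hz').comp
      (g := fun w => w - (k : ℂ)) (lmul_toCl_mul_self hI) ((hasDerivAt_id z).sub_const (k : ℂ))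
  refine (h1.const_mul A).neg.congr ?_
  have h2 : ∀ᶠ w : ℂ in 𝓝 z, IsUnit (quadPoly A (w - k)) :=
    (continuous_sub_right (k : ℂ)).continuousAt.eventually ((isOpen_setOf A).mem_nhds hz')
  filter_upwards [h2] with w hw
  rw [← h.sResolvent_eq hA hd hI hw, add_sub_cancel]

theorem GraphInverse.mem_planarSpectrum_iff (h : GraphInverse T k A) (hA : A ∈ boundedOps V n)
    {I : Para n} (hI : I ∈ unitSphere n) {p : ℂ} (hp : p ≠ 0) :
    p ∈ planarSpectrum A ↔ sl I (k + p⁻¹) ∈ sSpectrum T := by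
  rw [sSpectrum, mem_compl_iff, h.sl_mem_sResolventSet_iff hA hI, planarSpectrum,
    mem_ofPred_eq, not_iff_not, ← isUnit_quad_inv_iff A (inv_ne_zero hp), inv_inv]

/-- `resolv_inv` with q = p⁻¹, multiplied by w/p². When w stands for dp_I, the argument -w/p² stands
for ds_I under s = p⁻¹ + k. -/
theorem GraphInverse.sResolventB_mul (h : GraphInverse T k A) (hA : A ∈ boundedOps V n)
    (hd : Dense (T.domain : Set (Vn V n))) {I : Para n} (hI : I ∈ unitSphere n) {p : ℂ}
    (hp : p ≠ 0) (hpA : p ∉ planarSpectrum A) (w : ℂ) :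
    sResolventB A (sl I p) * lmul (toCl (sl I w)) =
      lmul (toCl (sl I (w / p))) + sResolvent T (sl I (k + p⁻¹)) * lmul (toCl (sl I (-w / p ^ 2))) := by
  have hq : IsUnit (quadPoly A p⁻¹) := by
    rw [← isUnit_quad_inv_iff A (inv_ne_zero hp), inv_inv]
    exact not_not.mp hpA
  have h1 := resolv_inv (lmul_toCl_mul_self hI) (inv_ne_zero hp) hq
  rw [inv_inv, ← lmul_toCl_sl, ← sResolventB_sl A hI] at h1
  have h2 := congrArg (fun B : Vn V n →L[ℝ] Vn V n => B * lmul (toCl (sl I (w / p ^ 2)))) h1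
  rw [mul_assoc, mul_assoc, ← lmul_sl_mul hI, ← lmul_sl_mul hI, add_mul, ← lmul_sl_mul hI] at h2
  have e1 : p * (p * (w / p ^ 2)) = w := by field_simp
  have e2 : p * (w / p ^ 2) = w / p := by field_simp
  rw [e1, e2] at h2
  rw [h2, h.sResolvent_eq hA hd hI hq]
  have e3 : (lmul (toCl (sl I (-w / p ^ 2))) : Vn V n →L[ℝ] Vn V n) =
      -lmul (toCl (sl I (w / p ^ 2))) := by
    rw [neg_div, lmul_toCl_sl, lmul_toCl_sl, Complex.neg_re, Complex.neg_im, neg_smul, neg_smul,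
      neg_add]
  rw [e3, neg_mul_neg]

end GraphInverse

end Unbounded

end SliceMonogenic

namespace SliceMonogenic

/-! ### Connectedness in the plane -/

/-- The punctured disc is the image of a half-plane under a translate of the exponential. -/
theorem isPreconnected_punctured_ball (k : ℂ) {ε : ℝ} (hε : 0 < ε) :
    IsPreconnected (Metric.ball k ε \ {k}) := by
  have h : (fun z => k + Complex.exp z) '' {z : ℂ | z.re < Real.log ε} = Metric.ball k ε \ {k} := by
    ext w
    constructor
    · rintro ⟨z, hz, rfl⟩
      refine ⟨?_, ?_⟩
      · rw [mem_ball_iff_norm, add_sub_cancel_left, Complex.norm_exp]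
        exact (Real.lt_log_iff_exp_lt hε).mp hz
      · simp
    · rintro ⟨hw, hwk⟩
      have h0 : w - k ≠ 0 := sub_ne_zero.mpr hwk
      refine ⟨Complex.log (w - k), ?_, ?_⟩
      · rw [mem_ofPred_eq, Complex.log_re]
        exact Real.log_lt_log (norm_pos_iff.mpr h0) (mem_ball_iff_norm.mp hw)
      · change k + Complex.exp _ = w
        rw [Complex.exp_log h0, add_sub_cancel]
  rw [← h]
  exact (convex_halfSpace_re_lt _).isPreconnected.image _ (by fun_prop)

theorem isConnected_norm_gt {r : ℝ} (hr : 0 < r) : IsConnected {z : ℂ | r < ‖z‖} := by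
  have h : Complex.exp '' {z : ℂ | Real.log r < z.re} = {z : ℂ | r < ‖z‖} := by
    ext w
    constructor
    · rintro ⟨z, hz, rfl⟩
      rw [mem_ofPred_eq, Complex.norm_exp]
      exact (Real.log_lt_iff_lt_exp hr).mp hz
    · intro hw
      have h0 : w ≠ 0 := norm_pos_iff.mp (hr.trans hw)
      refine ⟨Complex.log w, ?_, Complex.exp_log h0⟩
      rw [mem_ofPred_eq, Complex.log_re]
      exact Real.log_lt_log hr hw
  refine ⟨⟨((r + 1 : ℝ) : ℂ), ?_⟩, ?_⟩
  · rw [mem_ofPred_eq, Complex.norm_real, Real.norm_of_nonneg (by linarith)]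
    linarith
  · rw [← h]
    exact (convex_halfSpace_re_gt _).isPreconnected.image _ (by fun_prop)

/-- In a separation of the punctured set, a small punctured disc around k is connected and lies in
one part; adding the disc to that part would separate the set itself. -/
theorem IsPreconnected.sdiff_singleton {Ω : Set ℂ} (h : IsPreconnected Ω) (hΩ : IsOpen Ω) (k : ℂ) :
    IsPreconnected (Ω \ {k}) := by
  by_cases hk : k ∈ Ω
  · obtain ⟨ε, hε, hb⟩ := Metric.isOpen_iff.mp hΩ k hk
    have hP := isPreconnected_iff_subset_of_disjoint.mp (isPreconnected_punctured_ball k hε)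
    have main : ∀ u v : Set ℂ, IsOpen u → IsOpen v → Ω \ {k} ⊆ u ∪ v →
        (Ω \ {k}) ∩ (u ∩ v) = ∅ → Metric.ball k ε \ {k} ⊆ u → Ω \ {k} ⊆ u := by
      intro u v hu hv huv hd hPu
      have hd' : ∀ z ∈ Ω, z ≠ k → z ∈ u → z ∈ v → False := fun z h1 h2 h3 h4 =>
        (hd ▸ (⟨⟨h1, h2⟩, h3, h4⟩ : z ∈ (Ω \ {k}) ∩ (u ∩ v)) : z ∈ (∅ : Set ℂ))
      have hcov : Ω ⊆ (u ∪ Metric.ball k ε) ∪ (v \ {k}) := by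
        intro z hz
        by_cases hzk : z = k
        · exact Or.inl (Or.inr (hzk ▸ Metric.mem_ball_self hε))
        · rcases huv ⟨hz, hzk⟩ with h2 | h2
          · exact Or.inl (Or.inl h2)
          · exact Or.inr ⟨h2, hzk⟩
      have hdis : Ω ∩ ((u ∪ Metric.ball k ε) ∩ (v \ {k})) = ∅ := by
        rw [eq_empty_iff_forall_notMem]
        rintro z ⟨hz, hzu | hzb, hzv, hzk⟩
        · exact hd' z hz hzk hzu hzv
        · exact hd' z hz hzk (hPu ⟨hzb, hzk⟩) hzv
      rcases isPreconnected_iff_subset_of_disjoint.mp h _ _ (hu.union Metric.isOpen_ball)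
        (hv.sdiff isClosed_singleton) hcov hdis with h1 | h1
      · rintro z ⟨hz, hzk⟩
        rcases h1 hz with h2 | h2
        · exact h2
        · exact hPu ⟨h2, hzk⟩
      · exact absurd (mem_singleton k) (h1 hk).2
    refine isPreconnected_iff_subset_of_disjoint.mpr fun u v hu hv huv hd => ?_
    have hsub : Metric.ball k ε \ {k} ⊆ Ω \ {k} := sdiff_subset_sdiff_left hb
    rcases hP u v hu hv (hsub.trans huv) (subset_empty_iff.mp
      (hd ▸ inter_subset_inter_left _ hsub)) with h1 | h1
    · exact Or.inl (main u v hu hv huv hd h1)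
    · exact Or.inr (main v u hv hu (union_comm u v ▸ huv) (inter_comm u v ▸ hd) h1)
  · rwa [sdiff_singleton_eq_self hk]

/-! ### Removable singularities -/

/-- Riemann's theorem is applied to the scalar functions `pairing ℓ J 1 F`. Finite dimension allows
real differentiability to be reassembled from coordinates, and the functionals then give F'(i) = J
F'(1). -/
theorem LeftHolo.removable {𝔸 : Type*} [NormedRing 𝔸] [NormedAlgebra ℝ 𝔸] [FiniteDimensional ℝ 𝔸]
    {J : 𝔸} (hJ : J * J = -1) {F : ℂ → 𝔸} {z : ℂ} (h : ∀ᶠ w in 𝓝[≠] z, LeftHolo J F w)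
    (hc : ContinuousAt F z) : LeftHolo J F z := by
  have h1 : ∀ ℓ : 𝔸 →L[ℝ] ℝ, DifferentiableAt ℂ (pairing ℓ J (fun _ => 1) F) z := by
    intro ℓ
    refine (Complex.analyticAt_of_differentiable_on_punctured_nhds_of_continuousAt
      ?_ ?_).differentiableAt
    · filter_upwards [h] with w hw
      exact differentiableAt_pairing hJ ℓ rightHolo_const hw
    · unfold pairing
      fun_prop
  have h2 : ∀ ℓ : 𝔸 →L[ℝ] ℝ, DifferentiableAt ℝ (fun w => ℓ (F w)) z := by
    intro ℓ
    have h3 := Complex.reCLM.differentiableAt.comp z ((h1 ℓ).restrictScalars ℝ)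
    refine h3.congr_of_eventuallyEq (Eventually.of_forall fun w => ?_)
    simp [pairing]
  have h3 : DifferentiableAt ℝ F z := by
    let e := (Module.finBasis ℝ 𝔸).equivFunL
    have h4 : DifferentiableAt ℝ (fun w => e (F w)) z := by
      rw [differentiableAt_pi]
      exact fun i => h2 (ContinuousLinearMap.proj (R := ℝ) (φ := fun _ => ℝ) i ∘L e.toContinuousLinearMap)
    exact e.comp_differentiableAt_iff.mp h4
  obtain ⟨F', hF'⟩ := h3
  refine ⟨F', hF', (SeparatingDual.eq_iff_forall_dual_eq (R := ℝ)).mpr fun ℓ => ?_⟩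
  have h5 : HasFDerivAt (pairing ℓ J (fun _ => 1) F)
      (Complex.ofRealCLM ∘L ℓ ∘L F' - Complex.I • (Complex.ofRealCLM ∘L ℓ ∘L
        (ContinuousLinearMap.mul ℝ 𝔸 J) ∘L F')) z := by
    have h6 := Complex.ofRealCLM.hasFDerivAt.comp z (ℓ.hasFDerivAt.comp z hF')
    have h7 := Complex.ofRealCLM.hasFDerivAt.comp z (ℓ.hasFDerivAt.comp z
      ((ContinuousLinearMap.mul ℝ 𝔸 J).hasFDerivAt.comp z hF'))
    refine (h6.sub (h7.const_smul Complex.I)).congr_of_eventuallyEq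
      (Eventually.of_forall fun w => ?_)
    simp [pairing]
  have h8 := h5.unique ((h1 ℓ).hasDerivAt.hasFDerivAt.restrictScalars ℝ)
  have h9 : ∀ w : ℂ, (ℓ (F' w) : ℂ) - Complex.I * ℓ (J * F' w) =
      w * deriv (pairing ℓ J (fun _ => 1) F) z := by
    intro w
    have := congrArg (fun L : ℂ →L[ℝ] ℂ => L w) h8
    simpa using this
  have e1 := h9 1
  have e2 := h9 Complex.I
  rw [← one_mul (deriv _ _), ← e1] at e2
  have := congrArg Complex.re e2
  simpa using this

end SliceMonogenic

namespace SliceMonogenic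

/-! ### The transformed function -/

section Transform

variable {n : ℕ}

theorem transform_sl {f : Para n → Cl n} {c : Cl n} {k : ℝ} {I : Para n} (hI : I ∈ unitSphere n)
    {p : ℂ} (hp : p ≠ 0) : transform f c k (sl I p) = f (sl I (p⁻¹ + k)) := by
  rw [transform, if_neg (fun h => hp ((sl_eq_zero_iff hI).mp h)), paraInv_sl hI, sl_add,
    sl_ofReal]

theorem transform_zero (f : Para n → Cl n) (c : Cl n) (k : ℝ) : transform f c k 0 = c :=
  if_pos rfl

theorem differentiableAt_paraInv {p : Para n} (hp : p ≠ 0) : DifferentiableAt ℝ paraInv p := by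
  have h0 : Differentiable ℝ fun x : Para n => x 0 :=
    (EuclideanSpace.proj 0 : Para n →L[ℝ] ℝ).differentiable
  have h1 : Differentiable ℝ (paraConj : Para n → Para n) := by
    unfold paraConj
    fun_prop
  have h2 : DifferentiableAt ℝ (fun x : Para n => (‖x‖ ^ 2)⁻¹) p :=
    (differentiableAt_id.norm_sq ℝ).inv (by simpa using hp)
  exact h2.smul (h1 p)

theorem norm_paraInv (hn : 1 ≤ n) (p : Para n) : ‖paraInv p‖ = ‖p‖⁻¹ := by
  obtain ⟨I, hI, z, rfl⟩ := exists_sl_eq hn p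
  rw [paraInv_sl hI, norm_sl hI, norm_sl hI, norm_inv]

theorem isOpen_preimage_paraInv {O : Set (Para n)} (hO : IsOpen O) (k : ℝ) :
    IsOpen {p : Para n | p ≠ 0 ∧ paraInv p + ofR k ∈ O} := by
  have h : ContinuousOn (fun p : Para n => paraInv p + ofR k) {0}ᶜ := fun p hp =>
    ((differentiableAt_paraInv hp).continuousAt.add continuousAt_const).continuousWithinAt
  exact h.isOpen_inter_preimage isOpen_compl_singleton hO

/-- Since k is real, p ↦ p⁻¹ + k preserves every L_I and is holomorphic on it. -/
theorem SMonogenicOn.transform {f : Para n → Cl n} {O : Set (Para n)} (hf : SMonogenicOn f O)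
    (c : Cl n) (k : ℝ) :
    SMonogenicOn (transform f c k) {p | p ≠ 0 ∧ paraInv p + ofR k ∈ O} := by
  refine smonogenicOn_of_leftHolo (isOpen_preimage_paraInv hf.1 k) (fun p hp => ?_) ?_
  · have h1 : DifferentiableAt ℝ (fun p => f (paraInv p + ofR k)) p :=
      (hf.2.1.differentiableAt (hf.1.mem_nhds hp.2)).comp p
        ((differentiableAt_paraInv hp.1).add_const _)
    refine (h1.congr_of_eventuallyEq ?_).differentiableWithinAt
    filter_upwards [isOpen_ne.mem_nhds hp.1] with x hx
    exact if_neg hx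
  · rintro I hI z ⟨hz, hz'⟩
    have hz0 : z ≠ 0 := fun h => hz ((sl_eq_zero_iff hI).mpr h)
    rw [paraInv_sl hI, ← sl_ofReal I, ← sl_add] at hz'
    refine ((hf.leftHolo (V := ℝ) hI hz').comp (g := fun w => w⁻¹ + (k : ℂ)) (lmul_toCl_mul_self hI)
      ((hasDerivAt_inv hz0).add_const (k : ℂ))).congr ?_
    filter_upwards [isOpen_ne.mem_nhds hz0] with w hw
    rw [transform_sl hI hw]

theorem SMonogenicOn.union {f : Para n → Cl n} {U U' : Set (Para n)} (h : SMonogenicOn f U)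
    (h' : SMonogenicOn f U') : SMonogenicOn f (U ∪ U') := by
  refine ⟨h.1.union h'.1, fun p hp => ?_, fun I hI z hz => ?_⟩
  · rcases hp with hp | hp
    · exact (h.2.1.differentiableAt (h.1.mem_nhds hp)).differentiableWithinAt
    · exact (h'.2.1.differentiableAt (h'.1.mem_nhds hp)).differentiableWithinAt
  · rcases hz with hz | hz
    · exact h.2.2 I hI z hz
    · exact h'.2.2 I hI z hz

theorem continuousAt_transform (hn : 1 ≤ n) {f : Para n → Cl n} {c : Cl n} (k : ℝ)
    (hc : Tendsto f (Bornology.cobounded (Para n)) (𝓝 c)) :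
    ContinuousAt (SliceMonogenic.transform f c k) 0 := by
  rw [continuousAt_iff_punctured_nhds, transform_zero]
  have h1 : Tendsto (fun p : Para n => paraInv p + ofR k) (𝓝[≠] 0) (Bornology.cobounded _) := by
    rw [← tendsto_norm_atTop_iff_cobounded]
    have h2 : Tendsto (fun p : Para n => ‖p‖⁻¹ + -‖(ofR k : Para n)‖) (𝓝[≠] 0) atTop :=
      tendsto_atTop_add_const_right _ _ (tendsto_inv_nhdsGT_zero.comp tendsto_norm_nhdsNE_zero)
    refine tendsto_atTop_mono (fun p => ?_) h2
    rw [← norm_paraInv hn, ← sub_eq_add_neg, sub_le_iff_le_add]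
    exact norm_le_add_norm_add _ _
  refine (hc.comp h1).congr' ?_
  filter_upwards [self_mem_nhdsWithin] with p hp
  exact (if_neg hp).symm

/-- The exterior of a ball is an axially symmetric s-domain, so the representation formula is
available near infinity without any further hypothesis. -/
theorem hasRep_of_norm_gt {f : Para n → Cl n} {r : ℝ} (hr : 0 < r)
    (hf : SMonogenicOn f {x | r < ‖x‖}) (hn : 1 ≤ n) {z : ℂ} (hz : r < ‖z‖) : HasRep f z := by
  obtain ⟨J, hJ⟩ := exists_mem_unitSphere hn
  have hD : IsAxialSDomain {x : Para n | r < ‖x‖} := by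
    refine ⟨hf.1, fun I hI J hJ w hw => ?_, ⟨r + 1, ?_⟩, fun I hI => ?_⟩
    · rw [mem_ofPred_eq, norm_sl hI] at hw
      rwa [mem_ofPred_eq, norm_sl hJ]
    · rw [mem_ofPred_eq, ← sl_ofReal J, norm_sl hJ, Complex.norm_real,
        Real.norm_of_nonneg (by linarith)]
      linarith
    · have h : slice I {x : Para n | r < ‖x‖} = {z : ℂ | r < ‖z‖} := by
        ext w
        rw [slice, mem_ofPred_eq, mem_ofPred_eq, norm_sl hI, mem_ofPred_eq]
      rw [h]
      exact isConnected_norm_gt hr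
  refine hasRep_of_isAxialSDomain hf hD hJ ?_
  rwa [mem_ofPred_eq, norm_sl hJ]

/-- A function with a representation on all small spheres that is holomorphic at `0` on one complex
line is differentiable at `0`. -/
theorem hasFDerivAt_zero_of_hasRep (hn : 1 ≤ n) {φ : Para n → Cl n} {J : Para n}
    (hJ : J ∈ unitSphere n) (hrep : ∀ᶠ z in 𝓝 0, HasRep φ z)
    (hφ : LeftHolo (lmul (toCl J)) (fun z => (lmul (φ (sl J z)) : Cl n →L[ℝ] Cl n)) 0) :
    ∃ (a : Cl n) (D : Para n →L[ℝ] Cl n), HasFDerivAt φ D 0 ∧ ∀ x, D x = lmul (toCl x) a := by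
  obtain ⟨F', hF, hF'⟩ := hφ
  let a : Cl n := F' 1 (eA ∅)
  let D : Para n →L[ℝ] Cl n := LinearMap.toContinuousLinearMap
    { toFun := fun x => lmul (toCl x) a
      map_add' := fun x y => by rw [toCl_add, lmul_add]; rfl
      map_smul' := fun r x => by rw [toCl_smul, lmul_smul]; rfl }
  have hD : ∀ x, D x = lmul (toCl x) a := fun x => rfl
  have hg : HasFDerivAt (fun z => φ (sl J z)) (ContinuousLinearMap.apply ℝ (Cl n) (eA ∅) ∘L F') 0 := by
    have h := (ContinuousLinearMap.apply ℝ (Cl n) (eA ∅)).hasFDerivAt.comp (0 : ℂ) hF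
    refine h.congr_of_eventuallyEq (Eventually.of_forall fun z => ?_)
    exact (lmul_apply_eA_empty _).symm
  have hg' : ∀ z : ℂ, F' z (eA ∅) = z.re • a + z.im • lmul (toCl J) a := by
    intro z
    rw [clm_apply_eq F' z, hF']
    rfl
  obtain ⟨M, hM⟩ := isCompact_unitSphere (n := n) |>.exists_bound_of_continuousOn
    (f := fun I : Para n => (lmul (toCl I) : Cl n →L[ℝ] Cl n)) (by
      refine Continuous.continuousOn ((lmulL ℝ n).continuous.comp ?_)
      unfold toCl
      fun_prop)
  have hM0 : 0 ≤ M := (norm_nonneg _).trans (hM J hJ)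
  refine ⟨a, D, ?_, hD⟩
  rw [hasFDerivAt_iff_isLittleO, Asymptotics.isLittleO_iff]
  intro η hη
  -- M bounds the left multiplications by elements of 𝕊; two of them occur in the error term below.
  have hη' : 0 < η / (1 + M * M) := by positivity
  rw [hasFDerivAt_iff_isLittleO, Asymptotics.isLittleO_iff] at hg
  obtain ⟨δ, hδ, hball⟩ := Metric.eventually_nhds_iff_ball.mp ((hg hη').and hrep)
  filter_upwards [Metric.ball_mem_nhds (0 : Para n) hδ] with x hx
  obtain ⟨I, hI, z, rfl⟩ := exists_sl_eq hn x
  rw [mem_ball_zero_iff, norm_sl hI] at hx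
  obtain ⟨h1, α, β, hαβ⟩ := hball z (mem_ball_zero_iff.mpr hx)
  obtain ⟨h2, -⟩ := hball (star z) (mem_ball_zero_iff.mpr (by rwa [norm_star]))
  have h0 : sl J 0 = 0 := sl_zero J
  simp only [sub_zero, ContinuousLinearMap.comp_apply, ContinuousLinearMap.apply_apply, hg', h0,
    norm_star] at h1 h2
  have e1 : φ (sl J (star z)) = α - lmul (toCl J) β := by
    rw [← sl_neg, hαβ _ (neg_mem_unitSphere hJ), lmul_toCl_neg, neg_apply, sub_eq_add_neg]
  rw [hαβ J hJ] at h1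
  rw [e1] at h2
  rw [sub_zero, norm_sl hI, hD, hαβ I hI, lmul_toCl_sl]
  set r1 := α + lmul (toCl J) β - φ 0 - (z.re • a + z.im • lmul (toCl J) a) with hr1
  set r2 := α - lmul (toCl J) β - φ 0 - ((star z).re • a + (star z).im • lmul (toCl J) a) with hr2
  have hJJ := fun v => lmul_toCl_lmul_toCl hJ v
  -- The remainder of the first-order expansion on L_I is expressed by the remainders r1 and r2 at
  -- the two conjugate points of L_J, so it is small uniformly in I.
  have key : α + lmul (toCl I) β - φ 0 -
      (z.re • (1 : Cl n →L[ℝ] Cl n) + z.im • (lmul (toCl I) : Cl n →L[ℝ] Cl n)) a =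
      (2 : ℝ)⁻¹ • (r1 + r2) - (2 : ℝ)⁻¹ • lmul (toCl I) (lmul (toCl J) (r1 - r2)) := by
    have e2 : r1 - r2 = (2 : ℝ) • lmul (toCl J) (β - z.im • a) := by
      simp only [hr1, hr2, Complex.star_def, Complex.conj_re, Complex.conj_im, map_sub, map_smul]
      module
    have e3 : r1 + r2 = (2 : ℝ) • (α - φ 0 - z.re • a) := by
      simp only [hr1, hr2, Complex.star_def, Complex.conj_re, Complex.conj_im]
      module
    rw [e2, e3, map_smul, hJJ, map_smul, map_neg, map_sub, map_smul]
    simp only [add_apply, smul_apply, one_apply_eq_self]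
    module
  rw [key]
  have b1 : ∀ K ∈ unitSphere n, ∀ v : Cl n, ‖lmul (toCl K) v‖ ≤ M * ‖v‖ := fun K hK v =>
    ContinuousLinearMap.le_of_opNorm_le _ (hM K hK) v
  calc ‖(2 : ℝ)⁻¹ • (r1 + r2) - (2 : ℝ)⁻¹ • lmul (toCl I) (lmul (toCl J) (r1 - r2))‖
      ≤ ‖(2 : ℝ)⁻¹ • (r1 + r2)‖ + ‖(2 : ℝ)⁻¹ • lmul (toCl I) (lmul (toCl J) (r1 - r2))‖ :=
        norm_sub_le _ _
    _ = 2⁻¹ * ‖r1 + r2‖ + 2⁻¹ * ‖lmul (toCl I) (lmul (toCl J) (r1 - r2))‖ := by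
        rw [norm_smul, norm_smul, norm_inv, Real.norm_two]
    _ ≤ 2⁻¹ * (‖r1‖ + ‖r2‖) + 2⁻¹ * (M * (M * (‖r1‖ + ‖r2‖))) := by
        gcongr
        · exact norm_add_le _ _
        · refine (b1 I hI _).trans ?_
          gcongr
          refine (b1 J hJ _).trans ?_
          gcongr
          exact norm_sub_le _ _
    _ = 2⁻¹ * (1 + M * M) * (‖r1‖ + ‖r2‖) := by ring
    _ ≤ 2⁻¹ * (1 + M * M) * (η / (1 + M * M) * ‖z‖ + η / (1 + M * M) * ‖z‖) := by gcongr
    _ = η * ‖z‖ := by field_simp; ring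

/-- Only the point 0 matters. The singularity is removable on one line L_J by continuity, and the
representation formula upgrades this to differentiability at 0 with differential x ↦ x a, which
satisfies the equation for every I. -/
theorem smonogenicOn_ball_transform (hn : 1 ≤ n) {f : Para n → Cl n} {c : Cl n}
    (hc : SMonogenicAtInfty f c) (k : ℝ) :
    ∃ ε > 0, SMonogenicOn (SliceMonogenic.transform f c k) (Metric.ball 0 ε) := by
  obtain ⟨⟨r, hr⟩, hlim⟩ := hc
  obtain ⟨R, hR0, hrR⟩ : ∃ R : ℝ, 0 < R ∧ r ≤ R := ⟨max r 1, by positivity, le_max_left _ _⟩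
  have hR : SMonogenicOn f {x | R < ‖x‖} :=
    hr.mono (isOpen_lt continuous_const continuous_norm) fun x hx => hrR.trans_lt hx
  have hpos : 0 < R + |k| := by positivity
  -- The radius 1/(R + |k|) is chosen so that p⁻¹ + k stays in the region |x| > R.
  have hlarge : ∀ z : ℂ, z ≠ 0 → ‖z‖ < (R + |k|)⁻¹ → R < ‖z⁻¹ + k‖ := by
    intro z hz hzn
    have h1 : R + |k| < ‖z‖⁻¹ := by
      rwa [lt_inv_comm₀ hpos (norm_pos_iff.mpr hz)]
    have h2 : ‖z⁻¹‖ ≤ ‖z⁻¹ + k‖ + ‖(k : ℂ)‖ := norm_le_add_norm_add _ _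
    rw [norm_inv, Complex.norm_real, Real.norm_eq_abs] at h2
    linarith
  have hpunct := hR.transform c k
  have hsub : ∀ p : Para n, p ∈ Metric.ball 0 (R + |k|)⁻¹ → p ≠ 0 →
      p ∈ {p | p ≠ 0 ∧ paraInv p + ofR k ∈ {x : Para n | R < ‖x‖}} := by
    intro p hp hp0
    obtain ⟨I, hI, z, rfl⟩ := exists_sl_eq hn p
    rw [mem_ball_zero_iff, norm_sl hI] at hp
    refine ⟨hp0, ?_⟩
    rw [paraInv_sl hI, ← sl_ofReal I, ← sl_add, mem_ofPred_eq, norm_sl hI]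
    exact hlarge z (fun h => hp0 ((sl_eq_zero_iff hI).mpr h)) hp
  have hrep : ∀ z : ℂ, ‖z‖ < (R + |k|)⁻¹ → HasRep (SliceMonogenic.transform f c k) z := by
    intro z hz
    by_cases hz0 : z = 0
    · refine ⟨c, 0, fun I hI => ?_⟩
      rw [hz0, sl_zero, transform_zero, map_zero, add_zero]
    · obtain ⟨α, β, h⟩ := hasRep_of_norm_gt hR0 hR hn (hlarge z hz0 hz)
      exact ⟨α, β, fun I hI => by rw [transform_sl hI hz0, h I hI]⟩
  have hε : 0 < (R + |k|)⁻¹ := inv_pos.mpr hpos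
  obtain ⟨J, hJ⟩ := exists_mem_unitSphere hn
  have hballc : ∀ᶠ z : ℂ in 𝓝 0, ‖z‖ < (R + |k|)⁻¹ := by
    filter_upwards [Metric.ball_mem_nhds (0 : ℂ) hε] with z hz
    exact mem_ball_zero_iff.mp hz
  have h0 : LeftHolo (lmul (toCl J))
      (fun z => (lmul (SliceMonogenic.transform f c k (sl J z)) : Cl n →L[ℝ] Cl n)) 0 := by
    refine LeftHolo.removable (lmul_toCl_mul_self hJ) ?_ ?_
    · filter_upwards [self_mem_nhdsWithin, nhdsWithin_le_nhds hballc] with z hz0 hz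
      refine hpunct.leftHolo hJ (hsub _ ?_ fun h => hz0 ((sl_eq_zero_iff hJ).mp h))
      rwa [mem_ball_zero_iff, norm_sl hJ]
    · have h1 : ContinuousAt (SliceMonogenic.transform f c k) (sl J 0) := by
        rw [sl_zero]
        exact continuousAt_transform hn k hlim
      exact (lmulL ℝ n).continuous.continuousAt.comp
        (ContinuousAt.comp h1 (continuous_sl J).continuousAt)
  obtain ⟨a, D, hD, hDa⟩ := hasFDerivAt_zero_of_hasRep hn hJ (hballc.mono hrep) h0
  refine ⟨_, hε, Metric.isOpen_ball, fun p hp => ?_, fun I hI z hz => ?_⟩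
  · by_cases hp0 : p = 0
    · rw [hp0]
      exact hD.differentiableAt.differentiableWithinAt
    · exact (hpunct.2.1.differentiableAt
        (hpunct.1.mem_nhds (hsub p hp hp0))).differentiableWithinAt
  · by_cases hz0 : sl I z = 0
    · rw [hz0, hD.fderiv, hDa, hDa, lmul_toCl_lmul_toCl hI, toCl_ofR, one_smul, lmul_eA_empty,
        one_apply_eq_self, add_neg_cancel]
    · exact hpunct.2.2 I hI z (hsub _ hz hz0)

/-- The slices are images of the slices of D without the point k, which is sent to infinity;
deleting it preserves connectedness. As D is open, it contains a real point other than k. -/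
theorem isAxialSDomain_preimage (hn : 1 ≤ n) {D : Set (Para n)} (hD : IsAxialSDomain D) (k : ℝ) :
    IsAxialSDomain {p : Para n | p ≠ 0 ∧ paraInv p + ofR k ∈ D} := by
  have hmem : ∀ {I : Para n}, I ∈ unitSphere n → ∀ z : ℂ,
      sl I z ∈ {p : Para n | p ≠ 0 ∧ paraInv p + ofR k ∈ D} ↔ z ≠ 0 ∧ sl I (z⁻¹ + k) ∈ D := by
    intro I hI z
    rw [mem_ofPred_eq, ne_eq, sl_eq_zero_iff hI, paraInv_sl hI, sl_add, sl_ofReal]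
  obtain ⟨hDo, hDs, ⟨u, hu⟩, hDc⟩ := hD
  have hreal : ∃ u : ℝ, u ≠ k ∧ ofR u ∈ D := by
    have hc : Continuous (ofR : ℝ → Para n) := by
      have : (ofR : ℝ → Para n) = fun u => u • ofR 1 := funext ofR_eq_smul
      rw [this]
      fun_prop
    have h1 : ∀ᶠ v in 𝓝 u, ofR v ∈ D := hc.continuousAt.eventually (hDo.mem_nhds hu)
    by_cases huk : u = k
    · have h2 : ∀ᶠ v in 𝓝[≠] u, ofR v ∈ D := nhdsWithin_le_nhds h1
      obtain ⟨v, hv, hvu⟩ := (h2.and self_mem_nhdsWithin).exists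
      exact ⟨v, fun h => hvu (h.trans huk.symm), hv⟩
    · exact ⟨u, huk, hu⟩
  obtain ⟨v, hvk, hv⟩ := hreal
  have hvk' : v - k ≠ 0 := sub_ne_zero.mpr hvk
  refine ⟨isOpen_preimage_paraInv hDo k, fun I hI J hJ z hz => ?_, ⟨(v - k)⁻¹, ?_⟩, fun I hI => ?_⟩
  · rw [hmem hI] at hz
    rw [hmem hJ]
    exact ⟨hz.1, hDs I hI J hJ _ hz.2⟩
  · obtain ⟨J, hJ⟩ := exists_mem_unitSphere hn
    rw [← sl_ofReal J (v - k)⁻¹, hmem hJ]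
    have h1 : (((v - k)⁻¹ : ℝ) : ℂ)⁻¹ + k = v := by
      rw [Complex.ofReal_inv, inv_inv, Complex.ofReal_sub, sub_add_cancel]
    rw [h1, sl_ofReal]
    exact ⟨by exact_mod_cast inv_ne_zero hvk', hv⟩
  · have h1 : slice I {p : Para n | p ≠ 0 ∧ paraInv p + ofR k ∈ D} =
        (fun z : ℂ => (z - k)⁻¹) '' (slice I D \ {(k : ℂ)}) := by
      ext z
      rw [slice, mem_ofPred_eq, hmem hI]
      constructor
      · rintro ⟨hz, hz'⟩
        refine ⟨z⁻¹ + k, ⟨hz', fun h => ?_⟩, by simp⟩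
        exact inv_ne_zero hz (by simpa using h)
      · rintro ⟨w, ⟨hw, hwk⟩, rfl⟩
        have hwk' : w - k ≠ 0 := sub_ne_zero.mpr hwk
        exact ⟨inv_ne_zero hwk', by rwa [inv_inv, sub_add_cancel]⟩
    rw [h1]
    have hvm : (v : ℂ) ∈ slice I D \ {(k : ℂ)} :=
      ⟨by rwa [slice, mem_ofPred_eq, sl_ofReal], by simpa using hvk⟩
    refine IsConnected.image ⟨⟨_, hvm⟩, IsPreconnected.sdiff_singleton (hDc I hI).2
      (hDo.preimage (continuous_sl I)) _⟩ _ ?_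
    · exact ContinuousOn.inv₀ (by fun_prop) fun w hw => sub_ne_zero.mpr hw.2

/-- The point 0 corresponds to infinity and is included even if it is not in the spectrum of A, so
that Cauchy's formula at 0 can be used later. -/
theorem LocallySMonogenic.transform (hn : 1 ≤ n) {f : Para n → Cl n} {c : Cl n}
    {σ σ' : Set (Para n)} {k : ℝ} (hf : LocallySMonogenic f σ) (hc : SMonogenicAtInfty f c)
    (hσ : ∀ p ∈ σ', p ≠ 0 → paraInv p + ofR k ∈ σ) :
    LocallySMonogenic (SliceMonogenic.transform f c k) (insert 0 σ') := by
  obtain ⟨U, hU, hσU, hD⟩ := hf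
  obtain ⟨ε, hε, hball⟩ := smonogenicOn_ball_transform hn hc k
  refine ⟨_, (hU.transform c k).union hball, ?_, fun hn2 p hp => ?_⟩
  · rintro p (rfl | hp)
    · exact Or.inr (Metric.mem_ball_self hε)
    · by_cases hp0 : p = 0
      · exact Or.inr (hp0 ▸ Metric.mem_ball_self hε)
      · exact Or.inl ⟨hp0, hσU (hσ p hp hp0)⟩
  · by_cases hp0 : p = 0
    · refine ⟨Metric.ball 0 ε, subset_union_right, hp0 ▸ Metric.mem_ball_self hε,
        Metric.isOpen_ball, fun I hI J hJ z hz => ?_, ⟨0, ?_⟩, fun I hI => ?_⟩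
      · rw [mem_ball_zero_iff, norm_sl hI] at hz
        rwa [mem_ball_zero_iff, norm_sl hJ]
      · rw [ofR_eq_smul, zero_smul]
        exact Metric.mem_ball_self hε
      · have h : slice I (Metric.ball (0 : Para n) ε) = Metric.ball 0 ε := by
          ext z
          rw [slice, mem_ofPred_eq, mem_ball_zero_iff, norm_sl hI, mem_ball_zero_iff]
        rw [h]
        exact ⟨⟨0, Metric.mem_ball_self hε⟩, (convex_ball 0 ε).isPreconnected⟩
    · have hpσ : p ∈ σ' := hp.resolve_left hp0
      obtain ⟨D, hDU, hpD, hDD⟩ := hD hn2 _ (hσ p hpσ hp0)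
      exact ⟨{p | p ≠ 0 ∧ paraInv p + ofR k ∈ D}, fun q hq => Or.inl ⟨hq.1, hDU hq.2⟩,
        ⟨hp0, hpD⟩, isAxialSDomain_preimage hn hDD k⟩

end Transform

end SliceMonogenic

namespace SliceMonogenic

open scoped Real NNReal

/-! ### Inversion of contours -/

section Inversion

open Complex (I)

/-- The difference quotient (h(z) - h(0))/z extends holomorphically, so Cauchy's theorem leaves h(0)
times the winding integral at 0. -/
theorem IsContour.arcIntegral_inv_mul {m : ℕ} {γ : Fin m → ℝ → ℂ} {G Ω : Set ℂ}
    (hγ : IsContour 1 γ G) (hΩ : IsOpen Ω) (hGΩ : closure G ⊆ Ω) (h0 : (0 : ℂ) ∈ G)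
    {h : ℂ → ℂ} (hh : DifferentiableOn ℂ h Ω) :
    arcIntegral γ (fun z => z⁻¹ * h z) = 2 * π * I * h 0 := by
  have h0Ω : Ω ∈ 𝓝 (0 : ℂ) := hΩ.mem_nhds (hGΩ (subset_closure h0))
  have hd : DifferentiableOn ℂ (dslope h 0) Ω := (Complex.differentiableOn_dslope h0Ω).mpr hh
  have hz := hγ.arcIntegral_eq_zero hΩ hGΩ (hγ.isBounded one_ne_zero) hd
  have hw := hγ.winding 0 h0
  rw [Int.cast_one, mul_one] at hw
  have hne : ∀ j, ∀ t ∈ Icc (0 : ℝ) 1, γ j t ≠ 0 := fun j t ht h => hγ.notMem j t ht (h ▸ h0)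
  have key : arcIntegral γ (fun z => z⁻¹ * h z) =
      arcIntegral γ (dslope h 0) + h 0 * arcIntegral γ (fun ζ => (ζ - 0)⁻¹) := by
    rw [arcIntegral, arcIntegral, arcIntegral, Finset.mul_sum, ← Finset.sum_add_distrib]
    refine Finset.sum_congr rfl fun j _ => ?_
    obtain ⟨K, hK⟩ := hγ.lipschitz j
    rw [← intervalIntegral.integral_const_mul, ← intervalIntegral.integral_add]
    · refine intervalIntegral.integral_congr fun t ht => ?_
      rw [uIcc_of_le zero_le_one] at ht
      have := hne j t ht
      rw [dslope_of_ne _ this, slope_def_field]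
      field_simp
      ring
    · refine intervalIntegrable_mul_deriv hK fun t ht => ?_
      have h1 := hGΩ (hγ.mem_closure j t ht)
      exact ((hd.differentiableAt (hΩ.mem_nhds h1)).continuousAt).comp_continuousWithinAt
        (f := γ j) (hK.continuousOn t ht)
    · refine (intervalIntegrable_mul_deriv hK (f := fun t => (γ j t - 0)⁻¹) ?_).const_mul _
      exact ContinuousOn.inv₀ (hK.continuousOn.sub continuousOn_const)
        fun t ht => by simpa using hne j t ht
  rw [key, hz, hw]
  ring

theorem deriv_inv_add {γ : ℝ → ℂ} {t : ℝ} (h : γ t ≠ 0) (k : ℂ) :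
    deriv (fun t => (γ t)⁻¹ + k) t = -deriv γ t / γ t ^ 2 := by
  by_cases hd : DifferentiableAt ℝ γ t
  · exact ((hd.hasDerivAt.fun_inv h).add_const k).deriv
  -- Where γ is not differentiable neither is its transform, and both derivatives have the default
  -- value 0.
  · have hd' : ¬ DifferentiableAt ℝ (fun t => (γ t)⁻¹ + k) t := by
      intro h1
      refine hd ?_
      have h2 : DifferentiableAt ℝ (fun t => ((γ t)⁻¹ + k - k)⁻¹) t :=
        (h1.sub_const k).fun_inv (by simpa using h)
      simpa using h2
    rw [deriv_zero_of_not_differentiableAt hd, deriv_zero_of_not_differentiableAt hd']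
    simp

/-- The image of `G` under `p ↦ p⁻¹ + k`. -/
def invImage (k : ℂ) (G : Set ℂ) : Set ℂ := {z | z ≠ k ∧ (z - k)⁻¹ ∈ G}

theorem continuousOn_inv_sub (k : ℂ) : ContinuousOn (fun z : ℂ => (z - k)⁻¹) {k}ᶜ :=
  ContinuousOn.inv₀ (by fun_prop) fun _ hw => sub_ne_zero.mpr hw

theorem isOpen_invImage (k : ℂ) {G : Set ℂ} (hG : IsOpen G) : IsOpen (invImage k G) :=
  (continuousOn_inv_sub k).isOpen_inter_preimage isOpen_compl_singleton hG

theorem inv_add_mem_closure {k p : ℂ} {G : Set ℂ} (hp : p ∈ closure G) (hp0 : p ≠ 0) :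
    p⁻¹ + k ∈ closure (invImage k G) := by
  have h1 : p ∈ closure ({0}ᶜ ∩ G) :=
    isOpen_compl_singleton.inter_closure ⟨hp0, hp⟩
  have h2 : ContinuousWithinAt (fun p : ℂ => p⁻¹ + k) ({0}ᶜ ∩ G) p :=
    ((continuousAt_inv₀ hp0).add continuousAt_const).continuousWithinAt
  refine h2.mem_closure h1 ?_
  rintro q ⟨hq, hqG⟩
  refine ⟨?_, ?_⟩
  · simpa using hq
  · simpa using hqG

/-- Boundedness of G keeps its image away from k, and off k the map z ↦ (z - k)⁻¹ is continuous. -/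
theorem closure_invImage_subset {k : ℂ} {G Ω : Set ℂ} (hb : Bornology.IsBounded G)
    (hGΩ : closure G ⊆ Ω) : closure (invImage k G) ⊆ invImage k Ω := by
  intro z hz
  have hzk : z ≠ k := by
    rintro rfl
    obtain ⟨M, hM0, hM⟩ := hb.exists_pos_norm_le
    obtain ⟨w, hw, hwz⟩ := Metric.mem_closure_iff.mp hz M⁻¹ (inv_pos.mpr hM0)
    have h1 := hM _ hw.2
    rw [norm_inv] at h1
    have h2 : 0 < ‖w - z‖ := norm_pos_iff.mpr (sub_ne_zero.mpr hw.1)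
    rw [dist_comm, dist_eq_norm, lt_inv_comm₀ h2 hM0] at hwz
    exact absurd h1 (not_le.mpr hwz)
  refine ⟨hzk, hGΩ ?_⟩
  exact (((continuousOn_inv_sub k).continuousAt (isOpen_ne.mem_nhds hzk)).continuousWithinAt
    (s := invImage k G)).mem_closure hz fun w hw => hw.2

/-- Inversion turns the oriented boundary of a bounded neighbourhood of `0` into that of a
neighbourhood of infinity. -/
theorem IsContour.inv {m : ℕ} {γ : Fin m → ℝ → ℂ} {G : Set ℂ} (hγ : IsContour 1 γ G)
    (h0 : (0 : ℂ) ∈ G) (hG : IsOpen G) (k : ℂ) :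
    IsContour 0 (fun j t => (γ j t)⁻¹ + k) (invImage k G) := by
  have hne : ∀ j, ∀ t ∈ Icc (0 : ℝ) 1, γ j t ≠ 0 := fun j t ht h => hγ.notMem j t ht (h ▸ h0)
  have hw0 := hγ.winding 0 h0
  have hderiv : ∀ j, ∀ t ∈ Icc (0 : ℝ) 1,
      deriv (fun t => (γ j t)⁻¹ + k) t = -deriv (γ j) t / γ j t ^ 2 := fun j t ht =>
    deriv_inv_add (hne j t ht) k
  -- With ζ = p⁻¹ + k, the form dζ/(ζ - z) pulls back to dp/(p - (z - k)⁻¹) - dp/p. Each winding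
  -- number is lowered by the winding number 1 about 0.
  have main : ∀ z ≠ k, (∀ j, ∀ t ∈ Icc (0 : ℝ) 1, γ j t ≠ (z - k)⁻¹) →
      arcIntegral (fun j t => (γ j t)⁻¹ + k) (fun ζ => (ζ - z)⁻¹) =
        arcIntegral γ (fun ζ => (ζ - (z - k)⁻¹)⁻¹) - arcIntegral γ (fun ζ => (ζ - 0)⁻¹) := by
    intro z hz hp
    rw [arcIntegral, arcIntegral, arcIntegral, ← Finset.sum_sub_distrib]
    refine Finset.sum_congr rfl fun j _ => ?_
    obtain ⟨K, hK⟩ := hγ.lipschitz j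
    rw [← intervalIntegral.integral_sub]
    · refine intervalIntegral.integral_congr fun t ht => ?_
      rw [uIcc_of_le zero_le_one] at ht
      have h1 := hne j t ht
      have h2 : z - k ≠ 0 := sub_ne_zero.mpr hz
      have h3 : γ j t * (z - k) - 1 ≠ 0 := fun h => hp j t ht
        (eq_inv_of_mul_eq_one_left (sub_eq_zero.mp h))
      have h4 : (γ j t)⁻¹ + k - z = -(γ j t * (z - k) - 1) / γ j t := by
        field_simp
        ring
      have h5 : γ j t - (z - k)⁻¹ = (γ j t * (z - k) - 1) / (z - k) := by
        field_simp
      rw [hderiv j t ht, h4, h5, sub_zero]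
      field_simp
      ring
    · refine intervalIntegrable_mul_deriv hK (f := fun t => (γ j t - (z - k)⁻¹)⁻¹) ?_
      exact ContinuousOn.inv₀ (hK.continuousOn.sub continuousOn_const)
        fun t ht => sub_ne_zero.mpr (hp j t ht)
    · refine intervalIntegrable_mul_deriv hK (f := fun t => (γ j t - 0)⁻¹) ?_
      exact ContinuousOn.inv₀ (hK.continuousOn.sub continuousOn_const)
        fun t ht => by simpa using hne j t ht
  refine ⟨fun j => ?_, fun j t ht => inv_add_mem_closure (hγ.mem_closure j t ht) (hne j t ht),
    fun j t ht h => ?_, fun z hz => ?_, fun z hz => ?_⟩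
  · obtain ⟨K, hK⟩ := hγ.lipschitz j
    obtain ⟨δ, hδ, hball⟩ := Metric.isOpen_iff.mp hG 0 h0
    lift δ to ℝ≥0 using hδ.le
    have hlow : ∀ t ∈ Icc (0 : ℝ) 1, (δ : ℝ) ≤ ‖γ j t‖ := fun t ht => by
      by_contra! h
      exact hγ.notMem j t ht (hball (mem_ball_zero_iff.mpr h))
    -- The curves avoid the disc of radius δ about 0, so inversion has Lipschitz constant 1/δ² on
    -- them.
    refine ⟨K / δ ^ 2, LipschitzOnWith.of_dist_le_mul fun s hs t ht => ?_⟩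
    have h1 := hK.dist_le_mul s hs t ht
    rw [dist_add_right, dist_inv_inv₀ (hne j s hs) (hne j t ht), NNReal.coe_div, NNReal.coe_pow,
      div_mul_eq_mul_div]
    gcongr
    rw [sq]
    exact mul_le_mul (hlow s hs) (hlow t ht) hδ.le (norm_nonneg _)
  · refine hγ.notMem j t ht ?_
    simpa using h.2
  · rw [main z hz.1 fun j t ht h => hγ.notMem j t ht (h ▸ hz.2), hγ.winding _ hz.2, hw0]
    simp
  -- The point k is the image of infinity: there the pulled-back form is just -dp/p.
  · by_cases hzk : z = k
    · have h1 : arcIntegral (fun j t => (γ j t)⁻¹ + k) (fun ζ => (ζ - z)⁻¹) =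
          -arcIntegral γ (fun ζ => (ζ - 0)⁻¹) := by
        rw [arcIntegral, arcIntegral, ← Finset.sum_neg_distrib]
        refine Finset.sum_congr rfl fun j _ => ?_
        rw [← intervalIntegral.integral_neg]
        refine intervalIntegral.integral_congr fun t ht => ?_
        rw [uIcc_of_le zero_le_one] at ht
        have h1 := hne j t ht
        rw [hderiv j t ht, hzk, add_sub_cancel_right, sub_zero]
        field_simp
      rw [h1, hw0]
      simp
    · have hp : (z - k)⁻¹ ∉ closure G := fun h => hz (by
        have := inv_add_mem_closure (k := k) h (inv_ne_zero (sub_ne_zero.mpr hzk))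
        rwa [inv_inv, sub_add_cancel] at this)
      rw [main z hzk fun j t ht h => hp (h ▸ hγ.mem_closure j t ht), hγ.winding_compl _ hp, hw0]
      simp

end Inversion

end SliceMonogenic

namespace SliceMonogenic

open scoped Real

/-! ### The calculus of an unbounded operator -/

section Calculus

variable {V : Type*} [NormedAddCommGroup V] [NormedSpace ℝ V] {n : ℕ}

/-- The curves `γ` surround `σ` in a neighbourhood of infinity on which `f` is holomorphic along
`L_I`. -/
def Surrounds (f : Para n → Cl n) (σ : Set ℂ) (I : Para n) {m : ℕ} (γ : Fin m → ℝ → ℂ) : Prop :=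
  ∃ G Ω : Set ℂ, IsContour 0 γ G ∧ IsOpen G ∧ IsOpen Ω ∧ closure G ⊆ Ω ∧ σ ⊆ G ∧
    (∃ r : ℝ, {z | r < ‖z‖} ⊆ G) ∧
    ∀ z ∈ Ω, LeftHolo (lmul (toCl I)) (fun w => (lmul (f (sl I w)) : Cl n →L[ℝ] Cl n)) z

theorem LeftHolo.lmul_of_lmul {f : ℂ → Cl n} {J : Para n} {z : ℂ}
    (h : LeftHolo (lmul (toCl J)) (fun w => (lmul (f w) : Cl n →L[ℝ] Cl n)) z) :
    LeftHolo (lmul (toCl J)) (fun w => (lmul (f w) : Vn V n →L[ℝ] Vn V n)) z := by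
  obtain ⟨F', hF, hF'⟩ := h
  have h1 : ∀ w, F' w (eA ∅) = (ContinuousLinearMap.apply ℝ (Cl n) (eA ∅) ∘L F') w := fun _ => rfl
  have hg : HasFDerivAt f (ContinuousLinearMap.apply ℝ (Cl n) (eA ∅) ∘L F') z := by
    refine ((ContinuousLinearMap.apply ℝ (Cl n) (eA ∅)).hasFDerivAt.comp z
      hF).congr_of_eventuallyEq (Eventually.of_forall fun z => ?_)
    exact (lmul_apply_eA_empty _).symm
  refine ⟨_, (lmulL V n).hasFDerivAt.comp z hg, ?_⟩
  simp only [ContinuousLinearMap.comp_apply, lmulL_apply, ContinuousLinearMap.apply_apply, hF']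
  rw [← lmul_mul]
  rfl

/-- One cut-off χ, equal to 1 near σ and near infinity, works for both systems of curves, and both
integrals become the same area integral. No representation formula is needed, since the line is
fixed. -/
theorem contourIntegral_eq_of_surrounds [CompleteSpace V] {f : Para n → Cl n} {σ : Set ℂ} {I : Para n}
    (hI : I ∈ unitSphere n) (hσ : IsClosed σ) {R : Para n → Vn V n →L[ℝ] Vn V n}
    (hR : ∀ z ∉ σ, RightHolo (lmul (toCl I)) (fun w => R (sl I w)) z)
    {m m' : ℕ} {γ : Fin m → ℝ → ℂ} {γ' : Fin m' → ℝ → ℂ} (h : Surrounds f σ I γ)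
    (h' : Surrounds f σ I γ') : contourIntegral R f I γ = contourIntegral R f I γ' := by
  obtain ⟨G, Ω, hγ, hG, hΩ, hGΩ, hσG, ⟨r, hr⟩, hf⟩ := h
  obtain ⟨G', Ω', hγ', hG', hΩ', hGΩ', hσG', ⟨r', hr'⟩, hf'⟩ := h'
  -- Including a neighbourhood of infinity in `C` makes `G \ C` bounded, although σ itself may be
  -- unbounded.
  let C : Set ℂ := σ ∪ {z | max r r' + 1 ≤ ‖z‖}
  have hC : IsClosed C := hσ.union (isClosed_le continuous_const continuous_norm)
  have hCG : C ⊆ G ∩ G' := by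
    rintro z (hz | hz)
    · exact ⟨hσG hz, hσG' hz⟩
    · rw [mem_ofPred_eq] at hz
      exact ⟨hr (show r < ‖z‖ by linarith [le_max_left r r']),
        hr' (show r' < ‖z‖ by linarith [le_max_right r r'])⟩
  have hb : ∀ G : Set ℂ, Bornology.IsBounded (G \ C) := fun G =>
    (Metric.isBounded_ball (x := (0 : ℂ)) (r := max r r' + 1)).subset fun z hz => by
      rw [mem_ball_zero_iff]
      by_contra! h
      exact hz.2 (Or.inr h)
  obtain ⟨χ, hχ⟩ := exists_isCutoff hC (hG.inter hG') hCG
  refine (SeparatingDual.eq_iff_forall_dual_eq (R := ℝ)).mpr fun ℓ => ?_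
  rw [apply_contourIntegral_eq ℓ hI hγ hΩ hC hGΩ (hb G) (hχ.mono subset_rfl inter_subset_left)
      (fun z hz => hR z fun h => hz.2 (Or.inl h)) (fun z hz => (hf z hz.1).lmul_of_lmul),
    apply_contourIntegral_eq ℓ hI hγ' hΩ' hC hGΩ' (hb G') (hχ.mono subset_rfl inter_subset_right)
      (fun z hz => hR z fun h => hz.2 (Or.inl h)) (fun z hz => (hf' z hz.1).lmul_of_lmul)]

theorem continuousAt_lmul_paraInv {I : Para n} (hI : I ∈ unitSphere n) {z : ℂ} (hz : z ≠ 0) :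
    ContinuousAt (fun w => (lmul (toCl (paraInv (sl I w))) : Vn V n →L[ℝ] Vn V n)) z := by
  simp only [paraInv_sl hI, lmul_toCl_sl]
  exact ((Complex.continuous_re.continuousAt.comp (continuousAt_inv₀ hz)).smul
    continuousAt_const).add ((Complex.continuous_im.continuousAt.comp
      (continuousAt_inv₀ hz)).smul continuousAt_const)

/-- Cauchy's formula for `φ(0)`. -/
theorem contourIntegral_paraInv [CompleteSpace V] {φ : Para n → Cl n} {I : Para n} (hI : I ∈ unitSphere n) {m : ℕ}
    {γ : Fin m → ℝ → ℂ} {G Ω : Set ℂ} (hγ : IsContour 1 γ G) (hΩ : IsOpen Ω)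
    (hGΩ : closure G ⊆ Ω) (h0 : (0 : ℂ) ∈ G)
    (hφ : ∀ z ∈ Ω, LeftHolo (lmul (toCl I)) (fun w => (lmul (φ (sl I w)) : Vn V n →L[ℝ] Vn V n)) z) :
    contourIntegral (fun x => (lmul (toCl (paraInv x)) : Vn V n →L[ℝ] Vn V n)) φ I γ =
      lmul (φ 0) := by
  have hne : ∀ j, ∀ t ∈ Icc (0 : ℝ) 1, γ j t ≠ 0 := fun j t ht h => hγ.notMem j t ht (h ▸ h0)
  refine (SeparatingDual.eq_iff_forall_dual_eq (R := ℝ)).mpr fun ℓ => ?_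
  rw [apply_contourIntegral ℓ hγ.lipschitz (fun j t ht => ?_)
    (fun j t ht => (hφ _ (hGΩ (hγ.mem_closure j t ht))).continuousAt)]
  -- Left multiplication by p⁻¹ in L_I comes out of the pairing as an ordinary complex factor.
  · have h1 : pairing ℓ (lmul (toCl I))
        (fun z => (lmul (toCl (paraInv (sl I z))) : Vn V n →L[ℝ] Vn V n))
        (fun z => lmul (φ (sl I z))) = fun z => z⁻¹ * pairing ℓ (lmul (toCl I)) (fun _ => 1)
        (fun z => lmul (φ (sl I z))) z := by
      funext z
      have h2 : ∀ F : Vn V n →L[ℝ] Vn V n, (z⁻¹.re • 1 + z⁻¹.im • lmul (toCl I)) * lmul (toCl I) * F =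
          z⁻¹.re • (1 * lmul (toCl I) * F) - z⁻¹.im • (1 * F) := by
        intro F
        rw [add_mul, smul_mul_assoc, smul_mul_assoc, lmul_toCl_mul_self hI, add_mul, smul_mul_assoc,
          smul_mul_assoc, neg_mul, smul_neg, sub_eq_add_neg]
      have h3 : ∀ F : Vn V n →L[ℝ] Vn V n, (z⁻¹.re • 1 + z⁻¹.im • lmul (toCl I)) * F =
          z⁻¹.re • (1 * F) + z⁻¹.im • (1 * lmul (toCl I) * F) := by
        intro F
        rw [add_mul, smul_mul_assoc, smul_mul_assoc, one_mul (lmul (toCl I))]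
      rw [pairing, pairing, paraInv_sl hI, lmul_toCl_sl, h2, h3]
      simp only [map_add, map_sub, map_smul, smul_eq_mul, Complex.ofReal_add, Complex.ofReal_sub,
        Complex.ofReal_mul]
      conv_rhs => rw [← Complex.re_add_im z⁻¹]
      linear_combination ((z⁻¹.im : ℂ) *
        ℓ (1 * lmul (toCl I) * lmul (φ (sl I z)))) * Complex.I_mul_I
    rw [h1, hγ.arcIntegral_inv_mul hΩ hGΩ h0 (fun z hz => (differentiableAt_pairing
      (lmul_toCl_mul_self hI) ℓ rightHolo_const (hφ z hz)).differentiableWithinAt), pairing, sl_zero]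
    simp only [one_mul, Complex.mul_im, Complex.mul_re, Complex.sub_re, Complex.sub_im,
      Complex.re_ofNat, Complex.im_ofNat, Complex.ofReal_re, Complex.ofReal_im, Complex.I_re,
      Complex.I_im]
    field_simp
    ring
  · exact continuousAt_lmul_paraInv hI (hne j t ht)

end Calculus

end SliceMonogenic

/-! ### The substitution s = p⁻¹ + k and the calculus of the unbounded operator -/

namespace SliceMonogenic

open scoped Real

theorem IsOrientedBoundary.surrounds {n : ℕ} {f : Para n → Cl n} {σ W : Set (Para n)} (hW : IsOpen W)
    (hσ : σ ⊆ W) (hr : ∃ r : ℝ, {x | r < ‖x‖} ⊆ W) (hf : SMonogenicOnClosure f W) {I : Para n}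
    (hI : I ∈ unitSphere n) {m : ℕ} {γ : Fin m → ℝ → ℂ}
    (hγ : IsOrientedBoundary 0 γ (slice I W)) : Surrounds f (slice I σ) I γ := by
  obtain ⟨W', hcl, hf⟩ := hf
  obtain ⟨r, hr⟩ := hr
  have hG : IsOpen (slice I W) := hW.preimage (continuous_sl I)
  refine ⟨slice I W, slice I W', hγ.isContour hG, hG, hf.1.preimage (continuous_sl I),
    ((continuous_sl I).closure_preimage_subset W).trans (preimage_mono hcl), preimage_mono hσ,
    ⟨r, fun z hz => hr ?_⟩, fun z hz => hf.leftHolo hI hz⟩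
  rw [mem_ofPred_eq, norm_sl hI]
  exact hz

section Main

variable {V : Type*} [NormedAddCommGroup V] [NormedSpace ℝ V] {n : ℕ}

theorem exists_graphInverse {T : Vn V n →ₗ.[ℝ] Vn V n} (hcl : T.IsClosed)
    (hd : Dense (T.domain : Set (Vn V n))) {k : ℝ} (hk : ofR k ∈ sResolventSet T) :
    ∃ A, GraphInverse T k A ∧ A ∈ boundedOps V n := by
  obtain ⟨R, hR⟩ := hk
  refine ⟨-R, graphInverse_of_isSResolvent hcl hd hR, ?_⟩
  have := hR.2.1
  rw [boundedOps_eq_centralizer] at this ⊢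
  exact neg_mem this

variable [CompleteSpace V]

theorem GraphInverse.sResolventB_mul_mul {T : Vn V n →ₗ.[ℝ] Vn V n} {k : ℝ}
    {A : Vn V n →L[ℝ] Vn V n} (h : GraphInverse T k A) (hA : A ∈ boundedOps V n)
    (hd : Dense (T.domain : Set (Vn V n))) {I : Para n} (hI : I ∈ unitSphere n) {p : ℂ}
    (hp : p ≠ 0) (hpA : p ∉ planarSpectrum A) (w : ℂ) (F : Vn V n →L[ℝ] Vn V n) :
    sResolventB A (sl I p) * (lmul (toCl (sl I w)) * F) =
      lmul (toCl (sl I p⁻¹)) * (lmul (toCl (sl I w)) * F) +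
        sResolvent T (sl I (p⁻¹ + k)) * (lmul (toCl (sl I (-w / p ^ 2))) * F) := by
  rw [← mul_assoc, ← mul_assoc, ← mul_assoc, h.sResolventB_mul hA hd hI hp hpA, add_mul,
    div_eq_inv_mul w, lmul_sl_mul hI, add_comm (k : ℂ)]

/-- The substitution `s = p⁻¹ + k` in the integral that defines `φ(A)`. -/
theorem GraphInverse.contourIntegral_eq {T : Vn V n →ₗ.[ℝ] Vn V n} {k : ℝ} {A : Vn V n →L[ℝ] Vn V n}
    (h : GraphInverse T k A) (hA : A ∈ boundedOps V n) (hd : Dense (T.domain : Set (Vn V n)))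
    {f : Para n → Cl n} {c : Cl n} {I : Para n} (hI : I ∈ unitSphere n) {m : ℕ}
    {γ : Fin m → ℝ → ℂ} {G Ω : Set ℂ} (hγ : IsContour 1 γ G) (hG : IsOpen G) (hΩ : IsOpen Ω)
    (hGΩ : closure G ⊆ Ω) (h0 : (0 : ℂ) ∈ G) (hAG : planarSpectrum A ⊆ G)
    (hφ : ∀ z ∈ Ω, LeftHolo (lmul (toCl I))
      (fun w => (lmul (transform f c k (sl I w)) : Cl n →L[ℝ] Cl n)) z) :
    Surrounds f (slice I (sSpectrum T)) I (fun j t => (γ j t)⁻¹ + k) ∧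
      contourIntegral (sResolventB A) (transform f c k) I γ =
        lmul c + contourIntegral (sResolvent T) f I (fun j t => (γ j t)⁻¹ + k) := by
  have hne : ∀ j, ∀ t ∈ Icc (0 : ℝ) 1, γ j t ≠ 0 := fun j t ht h => hγ.notMem j t ht (h ▸ h0)
  have hinv := hγ.inv h0 hG k
  have hf : ∀ z ∈ invImage k Ω,
      LeftHolo (lmul (toCl I)) (fun w => (lmul (f (sl I w)) : Cl n →L[ℝ] Cl n)) z := by
    rintro z ⟨hzk, hz⟩
    have hzk' : z - k ≠ 0 := sub_ne_zero.mpr hzk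
    refine ((hφ _ hz).comp (g := fun w : ℂ => (w - k)⁻¹) (lmul_toCl_mul_self hI)
      (((hasDerivAt_id z).sub_const (k : ℂ)).fun_inv hzk')).congr ?_
    filter_upwards [isOpen_ne.mem_nhds hzk] with w hw
    rw [transform_sl hI (inv_ne_zero (sub_ne_zero.mpr hw)), inv_inv, sub_add_cancel]
  have hσ : slice I (sSpectrum T) ⊆ invImage k G := by
    intro z hz
    have hz' : ¬ IsUnit (quadPoly A (z - k)) := by
      rw [← h.sl_mem_sResolventSet_iff hA hI, add_sub_cancel]
      exact hz
    -- The point k is not in the spectrum, because `quadPoly A 0` is the identity.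
    have hzk : z ≠ k := by
      rintro rfl
      refine hz' ?_
      simp [quadPoly]
    refine ⟨hzk, hAG ?_⟩
    rw [h.mem_planarSpectrum_iff hA hI (inv_ne_zero (sub_ne_zero.mpr hzk)), inv_inv, add_sub_cancel]
    exact hz
  have hlarge : ∃ r : ℝ, {z : ℂ | r < ‖z‖} ⊆ invImage k G := by
    obtain ⟨δ, hδ, hball⟩ := Metric.isOpen_iff.mp hG 0 h0
    refine ⟨δ⁻¹ + ‖(k : ℂ)‖, fun z hz => ?_⟩
    rw [mem_ofPred_eq] at hz
    have h1 : δ⁻¹ < ‖z - k‖ := by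
      have := norm_sub_norm_le z (k : ℂ)
      linarith
    have h2 : 0 < ‖z - k‖ := (inv_pos.mpr hδ).trans h1
    refine ⟨sub_ne_zero.mp (norm_pos_iff.mp h2), hball ?_⟩
    rw [mem_ball_zero_iff, norm_inv]
    exact (inv_lt_comm₀ hδ h2).mp h1
  refine ⟨⟨_, _, hinv, isOpen_invImage _ hG, isOpen_invImage _ hΩ,
    closure_invImage_subset (hγ.isBounded one_ne_zero) hGΩ, hσ, hlarge, hf⟩, ?_⟩
  -- The term with kernel p⁻¹ evaluates to φ(0) = c; the remaining equality holds pointwise in the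
  -- integrands.
  have hc := contourIntegral_paraInv (V := V) hI hγ hΩ hGΩ h0 fun z hz => (hφ z hz).lmul_of_lmul
  rw [transform_zero] at hc
  rw [← hc, contourIntegral, contourIntegral, contourIntegral, ← smul_add, ← Finset.sum_add_distrib]
  congr 1
  refine Finset.sum_congr rfl fun j _ => ?_
  obtain ⟨K, hK⟩ := hγ.lipschitz j
  obtain ⟨K', hK'⟩ := hinv.lipschitz j
  have i1 := intervalIntegrable_contour (I := I) (V := V) (R := fun x => lmul (toCl (paraInv x)))
    (f := transform f c k) hK (fun t ht => continuousAt_lmul_paraInv hI (hne j t ht))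
    (fun t ht => ((hφ _ (hGΩ (hγ.mem_closure j t ht))).lmul_of_lmul).continuousAt)
  have hcl := closure_invImage_subset (k := k) (hγ.isBounded one_ne_zero) hGΩ
  have i2 := intervalIntegrable_contour (I := I) (V := V) (R := sResolvent T) (f := f) hK'
    (fun t ht => (h.rightHolo_sResolvent hA hd hI (not_not.mp fun hs =>
      hinv.notMem j t ht (hσ hs))).continuousAt)
    (fun t ht => ((hf _ (hcl (hinv.mem_closure j t ht))).lmul_of_lmul).continuousAt)
  refine Eq.trans (intervalIntegral.integral_congr fun t ht => ?_)
    (intervalIntegral.integral_add i1 i2)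
  rw [uIcc_of_le zero_le_one] at ht
  have ht0 := hne j t ht
  have h1 := h.sResolventB_mul_mul hA hd hI ht0 (fun hp => hγ.notMem j t ht (hAG hp))
    (-Complex.I * deriv (γ j) t) (lmul (transform f c k (sl I (γ j t))))
  have e1 : -(-Complex.I * deriv (γ j) t) / γ j t ^ 2 =
      -Complex.I * deriv (fun t => (γ j t)⁻¹ + (k : ℂ)) t := by
    rw [deriv_inv_add ht0]
    ring
  rw [e1, ← paraInv_sl hI] at h1
  rw [← transform_sl (f := f) (c := c) hI ht0]
  exact h1

/-- On each complex line the spectrum of `T` is closed and the resolvent is holomorphic off it. -/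
theorem isClosed_slice_sSpectrum {T : Vn V n →ₗ.[ℝ] Vn V n} (hcl : T.IsClosed)
    (hd : Dense (T.domain : Set (Vn V n))) {k : ℝ} (hk : ofR k ∈ sResolventSet T) {I : Para n}
    (hI : I ∈ unitSphere n) : IsClosed (slice I (sSpectrum T)) ∧
      ∀ z ∉ slice I (sSpectrum T),
        RightHolo (lmul (toCl I)) (fun w => sResolvent T (sl I w)) z := by
  obtain ⟨A, h, hA⟩ := exists_graphInverse hcl hd hk
  refine ⟨?_, fun z hz => h.rightHolo_sResolvent hA hd hI (not_not.mp hz)⟩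
  have h1 : (slice I (sSpectrum T))ᶜ = (fun z : ℂ => z - k) ⁻¹' {q | IsUnit (quadPoly A q)} := by
    ext z
    rw [mem_preimage, mem_ofPred_eq, ← h.sl_mem_sResolventSet_iff hA hI, add_sub_cancel]
    exact not_not
  rw [← isOpen_compl_iff, h1]
  exact (GraphInverse.isOpen_setOf A).preimage (by fun_prop)

/-- For every real `k` in the resolvent set `φ_k(A_k)` is well defined, and it is given by an
integral of the resolvent of `T` over curves that surround the spectrum of `T`. -/
theorem exists_hasSCalculus (hn : 1 ≤ n) {T : Vn V n →ₗ.[ℝ] Vn V n} (hcl : T.IsClosed)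
    (hd : Dense (T.domain : Set (Vn V n))) {f : Para n → Cl n} {c : Cl n}
    (hf : LocallySMonogenic f (sSpectrum T)) (hc : SMonogenicAtInfty f c) {k : ℝ}
    (hk : ofR k ∈ sResolventSet T) :
    ∃ A B, IsInverse T k A ∧ HasSCalculus A (transform f c k) B ∧ ∀ I ∈ unitSphere n,
      ∃ (m : ℕ) (γ : Fin m → ℝ → ℂ), Surrounds f (slice I (sSpectrum T)) I γ ∧
        B = lmul c + contourIntegral (sResolvent T) f I γ := by
  obtain ⟨A, h, hA⟩ := exists_graphInverse hcl hd hk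
  obtain ⟨J, hJ⟩ := exists_mem_unitSphere hn
  have hφ : LocallySMonogenic (transform f c k) (insert 0 (sSpectrumB A)) := by
    refine hf.transform hn hc fun p hp hp0 => ?_
    obtain ⟨I, hI, z, rfl⟩ := exists_sl_eq hn p
    rw [sl_mem_sSpectrumB_iff hI, h.mem_planarSpectrum_iff hA hI fun hz => hp0
      ((sl_eq_zero_iff hI).mpr hz)] at hp
    rwa [paraInv_sl hI, ← sl_ofReal I, ← sl_add, add_comm]
  have hφ' : LocallySMonogenic (transform f c k) (sSpectrumB A) := by
    obtain ⟨U, hU, hσ, hD⟩ := hφ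
    exact ⟨U, hU, (subset_insert _ _).trans hσ, fun hn s hs => hD hn s (Or.inr hs)⟩
  obtain ⟨U, hU, hσU, -⟩ := hφ
  -- The set is chosen around the spectrum together with 0, so that its inversion is a neighbourhood
  -- of infinity.
  obtain ⟨G, hG, hKG, hGU, hGb, hsl, hadm⟩ := exists_isAdmissible hn A hU
    ((isCompact_planarSpectrum A).insert 0)
    (fun z hz => by
      rcases hz with rfl | hz
      · exact Or.inl (star_zero _)
      · exact Or.inr (star_mem_planarSpectrum hz))
    (subset_insert _ _) (by
      rintro z (rfl | hz) I hI
      · rw [sl_zero]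
        exact hσU (mem_insert _ _)
      · exact hσU (Or.inr ((sl_mem_sSpectrumB_iff hI).mpr hz)))
  obtain ⟨m₀, γ₀, hγ₀⟩ := hadm.2.2.2 J hJ
  refine ⟨A, contourIntegral (sResolventB A) (transform f c k) J γ₀, h.isInverse,
    ⟨hφ', ⟨_, hadm⟩, fun U' hU' I hI m γ hγ =>
      contourIntegral_eq_of_isAdmissible hn hφ' hU' hadm hI hJ hγ hγ₀⟩, fun I hI => ?_⟩
  obtain ⟨m, γ, hγ⟩ := hadm.2.2.2 I hI
  rw [contourIntegral_eq_of_isAdmissible hn hφ' hadm hadm hJ hI hγ₀ hγ]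
  rw [hsl I hI] at hγ
  obtain ⟨h1, h2⟩ := h.contourIntegral_eq hA hd (f := f) (c := c) hI (hγ.isContour hG) hG
    (isOpen_allSlices hU.1) hGU (hKG (mem_insert _ _)) ((subset_insert _ _).trans hKG)
    fun z hz => hU.leftHolo hI (hz I hI)
  exact ⟨m, _, h1, h2⟩

end Main

end SliceMonogenic

/-! ### The main theorem -/

theorem mainTheorem3 {V : Type*} [NormedAddCommGroup V] [NormedSpace ℝ V] [CompleteSpace V]
    {n : ℕ} (hn : 1 ≤ n) (T : Fin (n + 1) → V →ₗ.[ℝ] V) (hT : IsClosedOperator T)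
    (hρ : ∃ k : ℝ, ofR k ∈ sResolventSet (opT T))
    (f : Para n → Cl n) (c : Cl n) (hf : LocallySMonogenic f (sSpectrum (opT T)))
    (hc : SMonogenicAtInfty f c) :
    ∃ B : Vn V n →L[ℝ] Vn V n,
      (∀ k : ℝ, ofR k ∈ sResolventSet (opT T) →
        ∃ A, IsInverse (opT T) k A ∧ HasSCalculus A (transform f c k) B) ∧
      ∀ W : Set (Para n), IsOpen W → sSpectrum (opT T) ⊆ W → (∃ r : ℝ, {x | r < ‖x‖} ⊆ W) →
        SMonogenicOnClosure f W →
        ∀ I ∈ unitSphere n, ∀ (m : ℕ) (γ : Fin m → ℝ → ℂ),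
          IsOrientedBoundary 0 γ (slice I W) →
          B = lmul c + contourIntegral (sResolvent (opT T)) f I γ := by
  obtain ⟨k₀, hk₀⟩ := hρ
  obtain ⟨A₀, B, -, -, hB⟩ := exists_hasSCalculus hn hT.closed hT.dense_dom hf hc hk₀
  -- The operator obtained from one fixed k₀ is computed by every contour surrounding the spectrum
  -- of T. This covers the boundaries of all W as well as the inverted contours that come from other
  -- values of k.
  have key : ∀ I ∈ unitSphere n, ∀ (m : ℕ) (γ : Fin m → ℝ → ℂ),
      Surrounds f (slice I (sSpectrum (opT T))) I γ →
      B = lmul c + contourIntegral (sResolvent (opT T)) f I γ := by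
    intro I hI m γ hγ
    obtain ⟨m', γ', hγ', hB'⟩ := hB I hI
    obtain ⟨hcl, hhol⟩ := isClosed_slice_sSpectrum hT.closed hT.dense_dom hk₀ hI
    rw [hB', contourIntegral_eq_of_surrounds hI hcl hhol hγ' hγ]
  refine ⟨B, fun k hk => ?_, fun W hW hσ hr hfW I hI m γ hγ =>
    key I hI m γ (hγ.surrounds hW hσ hr hfW hI)⟩
  obtain ⟨A, B', hA, hAB, hB'⟩ := exists_hasSCalculus hn hT.closed hT.dense_dom hf hc hk
  obtain ⟨J, hJ⟩ := exists_mem_unitSphere hn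
  obtain ⟨m, γ, hγ, hBγ⟩ := hB' J hJ
  have : B' = B := hBγ.trans (key J hJ m γ hγ).symm
  exact ⟨A, hA, this ▸ hAB⟩
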